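/- Let $1<p<\infty$, let $H$ be a complex Hilbert space, and let $S^p(H)$ be the Schatten class of all bounded operators $A$ on $H$ with $\|A\|_p=\mathrm{Tr}(|A|^p)^{1/p}<\infty$, with the norm $\|\cdot\|_p$. A bounded linear map $T:S^p(H)\to S^p(H)$ is called completely bounded if for every Hilbert space $K$ the map $\mathrm{id}\otimes T$ on the algebraic tensor product $S^p(K)\otimes S^p(H)\subset S^p(K\otimes_2 H)$ extends to a bounded map on $S^p(K\otimes_2 H)$ (again denoted $\mathrm{id}\otimes T$); its completely bounded norm $\|T\|_{cb}$ is the supremum over all $K$ of the norms of these extensions. Let $CB(S^p(H),S^p(H))$ be the space of completely bounded maps; it contains all bounded finite rank operators on $S^p(H)$. The stable point-norm topology $\mathcal T_n$ on $CB(S^p(H),S^p(H))$ is the locally convex topology defined by the seminorms $$T\mapsto \sup_{i\ge 0}\,\|(\mathrm{id}\otimes T)(x_i)\|_{S^p(\ell^2\otimes_2 H)},$$ where $(x_i)_{i\ge0}$ ranges over all sequences in $S^p(\ell^2\otimes_2 H)$ that converge to $0$ in norm. **Theorem 3.10.** Let $F_0$ be a linear subspace of the space of bounded finite rank operators on $S^p(H)$.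 If $\mathrm{id}_{S^p(H)}$ belongs to the $\mathcal T_n$-closure of $F_0$, then $\mathrm{id}_{S^p(H)}$ belongs to the $\mathcal T_n$-closure of $\{T\in F_0 : \|T\|_{cb}\le 1\}$. -/

import Mathlib

open scoped ComplexOrder InnerProductSpace ENNReal Topology TensorProduct

namespace Schatten

section Definitions

variable {H : Type*} [NormedAddCommGroup H] [InnerProductSpace ℂ H] [CompleteSpace H]

/-- The trace `∑ᵢ ⟪bᵢ, B bᵢ⟫ ∈ [0, ∞]` of a positive bounded operator `B`, computed in some Hilbert
basis `b` of `H` (see `trace_star_mul_self` for the independence of the basis). -/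
noncomputable def trace (B : H →L[ℂ] H) : ℝ≥0∞ :=
  ∑' i, ENNReal.ofReal
    (RCLike.re ⟪(exists_hilbertBasis ℂ H).choose_spec.choose i,
      B ((exists_hilbertBasis ℂ H).choose_spec.choose i)⟫_ℂ)

/-- The Schatten `p`-norm `‖A‖_p = Tr(|A|^p)^(1/p) ∈ [0, ∞]` of a bounded operator `A`. -/
noncomputable def eSchattenNorm (p : ℝ) (A : H →L[ℂ] H) : ℝ≥0∞ :=
  trace (CFC.abs A ^ p) ^ (1 / p)

end Definitions

section Aux

variable {H : Type*} [NormedAddCommGroup H] [InnerProductSpace ℂ H]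

theorem parseval {ι : Type*} (b : HilbertBasis ι ℂ H) (x : H) :
    ∑' i, ‖⟪b i, x⟫_ℂ‖ₑ ^ 2 = ‖x‖ₑ ^ 2 := by
  have h := b.hasSum_inner_mul_inner x x
  have h2 : HasSum (fun i => ‖⟪b i, x⟫_ℂ‖ ^ 2) (‖x‖ ^ 2) := by
    have := (RCLike.hasSum_re ℂ h)
    convert this using 1
    · ext i
      rw [← inner_conj_symm x (b i), RCLike.conj_mul]
      norm_cast
    · rw [inner_self_eq_norm_sq_to_K]; norm_cast
  have h3 := h2.tsum_eq
  have : ∀ y : ℂ, ‖y‖ₑ ^ 2 = ENNReal.ofReal (‖y‖ ^ 2) := fun y => by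
    rw [ENNReal.ofReal_pow (norm_nonneg _), ofReal_norm]
  simp_rw [this]
  rw [← ENNReal.ofReal_tsum_of_nonneg (fun _ => by positivity) h2.summable, h3,
    ENNReal.ofReal_pow (norm_nonneg _), ofReal_norm]

theorem bessel {ι : Type*} {v : ι → H} (hv : Orthonormal ℂ v) (x : H) :
    ∑' i, ‖⟪v i, x⟫_ℂ‖ₑ ^ 2 ≤ ‖x‖ₑ ^ 2 := by
  have : ∀ y : ℂ, ‖y‖ₑ ^ 2 = ENNReal.ofReal (‖y‖ ^ 2) := fun y => by
    rw [ENNReal.ofReal_pow (norm_nonneg _), ofReal_norm]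
  simp_rw [this]
  rw [← ENNReal.ofReal_tsum_of_nonneg (fun _ => by positivity) (hv.inner_products_summable x),
    ← ofReal_norm, ← ENNReal.ofReal_pow (norm_nonneg _)]
  exact ENNReal.ofReal_le_ofReal (hv.tsum_inner_products_le x)

theorem two_mul_le_enn (a b : ℝ≥0∞) : a * b ≤ (a ^ 2 + b ^ 2) / 2 := by
  have := ENNReal.young_inequality a b (p := 2) (q := 2) (by constructor <;> norm_num)
  simp only [ENNReal.ofReal_ofNat] at this
  rw [ENNReal.add_div]
  exact_mod_cast this

theorem enorm_inner_symm (x y : H) : ‖⟪x, y⟫_ℂ‖ₑ = ‖⟪y, x⟫_ℂ‖ₑ :=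
  enorm_eq_iff_norm_eq.2 (norm_inner_symm x y)

theorem rankOne_compact (x y : H) : IsCompactOperator (InnerProductSpace.rankOne ℂ x y) := by
  rw [InnerProductSpace.rankOne_def']
  exact (isCompactOperator_of_locallyCompactSpace_rng (M₂ := ℂ) (M₃ := H)
    (ContinuousLinearMap.toSpanSingleton ℂ x)).comp_clm (innerSL ℂ y)

theorem tsum_mul_le_one {ι : Type*} {a b : ι → ℝ≥0∞} (ha : ∑' i, a i ^ 2 ≤ 1)
    (hb : ∑' i, b i ^ 2 ≤ 1) : ∑' i, a i * b i ≤ 1 := by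
  calc ∑' i, a i * b i ≤ ∑' i, (a i ^ 2 + b i ^ 2) / 2 :=
        ENNReal.tsum_le_tsum fun i => two_mul_le_enn _ _
    _ = (∑' i, a i ^ 2 + ∑' i, b i ^ 2) / 2 := by
        simp_rw [div_eq_mul_inv]; rw [ENNReal.tsum_mul_right, ENNReal.tsum_add]
    _ ≤ (1 + 1) / 2 := by gcongr
    _ = 1 := by rw [one_add_one_eq_two]; exact ENNReal.div_self two_ne_zero ENNReal.ofNat_ne_top

theorem jensen_tsum {ι : Type*} {p : ℝ} (hp : 1 ≤ p) (w l : ι → ℝ≥0∞) (hw : ∑' k, w k ≤ 1) :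
    (∑' k, w k * l k) ^ p ≤ ∑' k, w k * l k ^ p := by
  have hp0 : 0 < p := by linarith
  rw [← ENNReal.le_rpow_inv_iff hp0]
  rw [ENNReal.tsum_eq_iSup_sum]
  refine iSup_le fun s => ?_
  refine (ENNReal.inner_le_weight_mul_Lp_of_nonneg s hp w l).trans ?_
  have h1 : (∑ i ∈ s, w i) ^ (1 - p⁻¹) ≤ 1 :=
    ENNReal.rpow_le_one ((ENNReal.sum_le_tsum s).trans hw) (by
      have := inv_le_one_of_one_le₀ hp; linarith)
  calc _ ≤ 1 * (∑' k, w k * l k ^ p) ^ p⁻¹ := by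
        gcongr
        exact ENNReal.sum_le_tsum s
    _ = _ := one_mul _

theorem doubly_substochastic {ι κ : Type*} {p : ℝ} (hp : 1 ≤ p) (w : κ → ι → ℝ≥0∞)
    (l : ι → ℝ≥0∞) (hw : ∀ i, ∑' k, w i k ≤ 1) (hw' : ∀ k, ∑' i, w i k ≤ 1) :
    ∑' i, (∑' k, w i k * l k) ^ p ≤ ∑' k, l k ^ p := by
  calc _ ≤ ∑' i, ∑' k, w i k * l k ^ p := ENNReal.tsum_le_tsum fun i => jensen_tsum hp _ _ (hw i)
    _ = ∑' k, (∑' i, w i k) * l k ^ p := by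
        rw [ENNReal.tsum_comm]; simp_rw [ENNReal.tsum_mul_right]
    _ ≤ ∑' k, l k ^ p := ENNReal.tsum_le_tsum fun k => by
        calc _ ≤ 1 * l k ^ p := by gcongr; exact hw' k
          _ = _ := one_mul _

variable [CompleteSpace H]

theorem tsum_norm_sq_indep {ι κ : Type*} (b : HilbertBasis ι ℂ H) (c : HilbertBasis κ ℂ H)
    (C : H →L[ℂ] H) : ∑' i, ‖C (b i)‖ₑ ^ 2 = ∑' j, ‖star C (c j)‖ₑ ^ 2 := by
  have h1 : ∀ i, ‖C (b i)‖ₑ ^ 2 = ∑' j, ‖⟪c j, C (b i)⟫_ℂ‖ₑ ^ 2 := fun i => (parseval c _).symm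
  have h2 : ∀ j, ‖star C (c j)‖ₑ ^ 2 = ∑' i, ‖⟪b i, star C (c j)⟫_ℂ‖ₑ ^ 2 :=
    fun j => (parseval b _).symm
  simp_rw [h1, h2]
  rw [ENNReal.tsum_comm]
  refine tsum_congr fun j => tsum_congr fun i => ?_
  rw [ContinuousLinearMap.star_eq_adjoint, ContinuousLinearMap.adjoint_inner_right,
    enorm_eq_iff_norm_eq.2 (norm_inner_symm _ _)]

theorem trace_star_mul_self {κ : Type*} (c : HilbertBasis κ ℂ H) (C : H →L[ℂ] H) :
    trace (star C * C) = ∑' j, ‖C (c j)‖ₑ ^ 2 := by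
  have key : ∀ x : H, ENNReal.ofReal (RCLike.re ⟪x, (star C * C) x⟫_ℂ) = ‖C x‖ₑ ^ 2 := fun x => by
    rw [mul_apply_eq_comp, ContinuousLinearMap.star_eq_adjoint,
      ContinuousLinearMap.adjoint_inner_right, inner_self_eq_norm_sq,
      ENNReal.ofReal_pow (norm_nonneg _), ofReal_norm]
  unfold trace
  simp_rw [key]
  rw [tsum_norm_sq_indep _ c, tsum_norm_sq_indep c c, star_star]

theorem trace_of_nonneg {κ : Type*} (c : HilbertBasis κ ℂ H) {B : H →L[ℂ] H} (hB : 0 ≤ B) :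
    trace B = ∑' j, ENNReal.ofReal (RCLike.re ⟪c j, B (c j)⟫_ℂ) := by
  obtain ⟨C, rfl⟩ := CStarAlgebra.nonneg_iff_eq_star_mul_self.1 hB
  rw [trace_star_mul_self c]
  refine tsum_congr fun x => ?_
  rw [mul_apply_eq_comp, ContinuousLinearMap.star_eq_adjoint,
      ContinuousLinearMap.adjoint_inner_right, inner_self_eq_norm_sq,
      ENNReal.ofReal_pow (norm_nonneg _), ofReal_norm]

/-- An eigenvector of `a` is an eigenvector of `f(a)`. -/
theorem cfc_apply_eigenvector {a : H →L[ℂ] H} (ha : IsSelfAdjoint a) {f : ℝ → ℝ}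
    (hf : ContinuousOn f (spectrum ℝ a)) {v : H} {l : ℝ} (hv : a v = l • v) :
    cfc f a v = f l • v := by
  rcases eq_or_ne v 0 with rfl | hv0
  · simp
  have hl : l ∈ spectrum ℝ a := by
    rw [spectrum.mem_iff]
    intro hu
    obtain ⟨u, hu⟩ := hu
    have h0 : (u : H →L[ℂ] H) v = 0 := by
      rw [hu, sub_apply, hv, Algebra.algebraMap_eq_smul_one]
      simp
    have : ((u⁻¹ : (H →L[ℂ] H)ˣ) : H →L[ℂ] H) ((u : H →L[ℂ] H) v) = v := by
      rw [← mul_apply_eq_comp, Units.inv_mul]; rfl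
    rw [h0, map_zero] at this
    exact hv0 this.symm
  have main : ∀ g : C(spectrum ℝ a, ℝ), cfcHom ha g v = g ⟨l, hl⟩ • v := by
    intro g
    have hid : cfcHom ha (.restrict (spectrum ℝ a) <| .id ℝ) = a := cfcHom_id ha
    induction g using ContinuousMap.induction_on_of_compact with
    | const r =>
      have : (ContinuousMap.const (spectrum ℝ a) r) = algebraMap ℝ _ r := rfl
      rw [this, AlgHomClass.commutes, Algebra.algebraMap_eq_smul_one]
      simp
    | id => rw [hid, hv]; rfl
    | star_id =>
      rw [map_star, hid, ha.star_eq, hv]; rfl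
    | add f g hf hg =>
      rw [map_add, add_apply, hf, hg, ← add_smul]; rfl
    | mul f g hf hg =>
      rw [map_mul, mul_apply_eq_comp, hg, ContinuousMap.mul_apply, mul_smul]
      have : cfcHom ha f (g ⟨l, hl⟩ • v) = g ⟨l, hl⟩ • cfcHom ha f v :=
        (cfcHom ha f).map_smul_of_tower _ _
      rw [this, hf, smul_comm]
    | frequently f h =>
      refine h.mem_of_closed (s := {g | cfcHom ha g v = g ⟨l, hl⟩ • v}) ?_
      refine isClosed_eq ?_ ?_
      · have := cfcHom_continuous (R := ℝ) ha
        exact (ContinuousLinearMap.apply ℂ H v).continuous.comp this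
      · have : Continuous fun g : C(spectrum ℝ a, ℝ) => g ⟨l, hl⟩ :=
          ContinuousEvalConst.continuous_eval_const _
        exact this.smul continuous_const
  rw [cfc_apply f a ha hf, main]
  rfl

theorem abs_apply_norm (A : H →L[ℂ] H) (x : H) : ‖CFC.abs A x‖ = ‖A x‖ := by
  have h := CFC.abs_mul_abs A
  have hsa : star (CFC.abs A) = CFC.abs A := (CFC.abs_nonneg A).isSelfAdjoint.star_eq
  have h2 : ∀ C : H →L[ℂ] H, ‖C x‖ ^ 2 = RCLike.re ⟪x, (star C * C) x⟫_ℂ := fun C => by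
    rw [mul_apply_eq_comp, ContinuousLinearMap.star_eq_adjoint,
      ContinuousLinearMap.adjoint_inner_right, inner_self_eq_norm_sq]
  have : ‖CFC.abs A x‖ ^ 2 = ‖A x‖ ^ 2 := by rw [h2, h2 A, hsa, h]
  exact (pow_left_inj₀ (norm_nonneg _) (norm_nonneg _) two_ne_zero).1 this

theorem compact_of_star_mul_self {A : H →L[ℂ] H} (h : IsCompactOperator (star A * A : H →L[ℂ] H)) :
    IsCompactOperator A := by
  have h1 : IsCompact (closure ((star A * A : H →L[ℂ] H) '' Metric.closedBall 0 1)) :=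
    (isCompactOperator_iff_isCompact_closure_image_closedBall
      ((star A * A : H →L[ℂ] H) : H →ₗ[ℂ] H) zero_lt_one).1 h
  refine (isCompactOperator_iff_isCompact_closure_image_closedBall
      (A : H →ₗ[ℂ] H) zero_lt_one).2 ?_
  have ht := h1.totallyBounded.subset subset_closure
  suffices TotallyBounded (A '' Metric.closedBall 0 1) from
    this.closure.isCompact_of_isClosed isClosed_closure
  rw [Metric.totallyBounded_iff]
  intro ε hε
  obtain ⟨t, hts, htf, ht⟩ := Metric.finite_approx_of_totallyBounded ht (ε ^ 2 / 2) (by positivity)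
  choose! g hg using fun y (hy : y ∈ t) => hts hy
  refine ⟨(fun y => A (g y)) '' t, htf.image _, ?_⟩
  rintro _ ⟨x, hx, rfl⟩
  obtain ⟨y, hy, hxy⟩ := Set.mem_iUnion₂.1 (ht ⟨x, hx, rfl⟩)
  refine Set.mem_iUnion₂.2 ⟨_, ⟨y, hy, rfl⟩, ?_⟩
  rw [Metric.mem_ball, dist_eq_norm] at hxy ⊢
  rw [← (hg y hy).2, ← map_sub] at hxy
  rw [← map_sub]
  have hb : ‖x - g y‖ ≤ 2 := by
    have h1 := (hg y hy).1
    rw [mem_closedBall_zero_iff] at h1 hx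
    exact (norm_sub_le _ _).trans (by linarith)
  have hs : ‖A (x - g y)‖ ^ 2 ≤ ‖x - g y‖ * ‖(star A * A) (x - g y)‖ := by
    rw [← inner_self_eq_norm_sq (𝕜 := ℂ), ← ContinuousLinearMap.adjoint_inner_right]
    exact (RCLike.re_le_norm _).trans (norm_inner_le_norm _ _)
  have : ‖A (x - g y)‖ ^ 2 < ε ^ 2 := by nlinarith [norm_nonneg ((star A * A) (x - g y))]
  exact lt_of_pow_lt_pow_left₀ 2 hε.le this

/-- A Hilbert-Schmidt operator is compact. -/
theorem compact_of_tsum_lt_top {κ : Type*} (c : HilbertBasis κ ℂ H) {C : H →L[ℂ] H}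
    (h : ∑' j, ‖C (c j)‖ₑ ^ 2 < ⊤) : IsCompactOperator C := by
  classical
  let D : Finset κ → (H →L[ℂ] H) := fun s => ∑ j ∈ s, (innerSL ℂ (c j)).smulRight (C (c j))
  have hD : ∀ s, IsCompactOperator (D s) := fun s => by
    have : D s ∈ compactOperator (RingHom.id ℂ) H H := Submodule.sum_mem _ fun j _ => by
      change IsCompactOperator _
      exact (isCompactOperator_of_locallyCompactSpace_rng (M₂ := ℂ) (M₃ := H)
        (ContinuousLinearMap.toSpanSingleton ℂ (C (c j)))).comp_clm (innerSL ℂ (c j))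
    exact this
  have hbound : ∀ s : Finset κ, ∀ x : H,
      ‖(C - D s) x‖ₑ ≤ (∑' j : {j // j ∉ s}, ‖C (c j)‖ₑ ^ 2) ^ (1 / 2 : ℝ) * ‖x‖ₑ := by
    intro s x
    have hsum : HasSum (fun j => ⟪c j, x⟫_ℂ • C (c j)) (C x) := by
      have := (c.hasSum_repr x).mapL C
      simpa [HilbertBasis.repr_apply_apply] using this
    have h2 : HasSum (fun j : {j // j ∉ s} => ⟪c j, x⟫_ℂ • C (c j)) ((C - D s) x) := by
      have := (s.hasSum_compl_iff (f := fun j => ⟪c j, x⟫_ℂ • C (c j)) (a := (C - D s) x)).2 (by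
        convert hsum using 1
        simp [D])
      exact this
    have h3 : ‖(C - D s) x‖ₑ ≤ ∑' j : {j // j ∉ s}, ‖⟪c j, x⟫_ℂ‖ₑ * ‖C (c j)‖ₑ := by
      rw [← h2.tsum_eq]
      refine (enorm_tsum_le_tsum_enorm).trans (le_of_eq ?_)
      simp_rw [enorm_smul]
    have h4 : ∑' j : {j // j ∉ s}, ‖⟪c j, x⟫_ℂ‖ₑ * ‖C (c j)‖ₑ ≤
        (∑' j : {j // j ∉ s}, ‖⟪c j, x⟫_ℂ‖ₑ ^ 2) ^ (1 / 2 : ℝ) *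
        (∑' j : {j // j ∉ s}, ‖C (c j)‖ₑ ^ 2) ^ (1 / 2 : ℝ) := by
      rw [ENNReal.tsum_eq_iSup_sum]
      refine iSup_le fun t => ?_
      refine (ENNReal.inner_le_Lp_mul_Lq t _ _ (p := 2) (q := 2)
        (by constructor <;> norm_num)).trans ?_
      simp only [ENNReal.rpow_ofNat]
      gcongr <;> exact ENNReal.sum_le_tsum t
    refine h3.trans (h4.trans ?_)
    rw [mul_comm]
    gcongr
    have h5 : ∑' j : {j // j ∉ s}, ‖⟪c j, x⟫_ℂ‖ₑ ^ 2 ≤ ‖x‖ₑ ^ 2 :=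
      (ENNReal.tsum_comp_le_tsum_of_injective Subtype.val_injective _).trans (parseval c x).le
    calc _ ≤ (‖x‖ₑ ^ 2) ^ (1 / 2 : ℝ) := by gcongr
      _ = _ := by rw [← ENNReal.rpow_natCast, ← ENNReal.rpow_mul]; norm_num
  refine isCompactOperator_of_tendsto (F := D) (l := Filter.atTop) ?_ (.of_forall hD)
  rw [tendsto_iff_norm_sub_tendsto_zero]
  have ht : Filter.Tendsto (fun s : Finset κ =>
      ((∑' j : {j // j ∉ s}, ‖C (c j)‖ₑ ^ 2) ^ (1 / 2 : ℝ)).toReal) Filter.atTop (𝓝 0) := by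
    have h1 := ENNReal.tendsto_tsum_compl_atTop_zero h.ne
    have h2 := (h1.ennrpow_const (1 / 2 : ℝ))
    rw [ENNReal.zero_rpow_of_pos (by norm_num)] at h2
    exact (ENNReal.tendsto_toReal ENNReal.zero_ne_top).comp h2
  refine squeeze_zero (fun _ => norm_nonneg _) (fun s => ?_) ht
  rw [norm_sub_rev]
  refine ContinuousLinearMap.opNorm_le_bound _ ENNReal.toReal_nonneg fun x => ?_
  have := ENNReal.toReal_mono ?_ (hbound s x)
  · rwa [ENNReal.toReal_mul, toReal_enorm, toReal_enorm] at this
  · refine ENNReal.mul_ne_top (ENNReal.rpow_ne_top_of_nonneg (by norm_num) ?_) enorm_ne_top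
    exact ((ENNReal.tsum_comp_le_tsum_of_injective Subtype.val_injective _).trans_lt h).ne

theorem compact_of_trace_lt_top {B : H →L[ℂ] H} (hB : 0 ≤ B) (h : trace B < ⊤) :
    IsCompactOperator B := by
  obtain ⟨C, rfl⟩ := CStarAlgebra.nonneg_iff_eq_star_mul_self.1 hB
  obtain ⟨w, c, -⟩ := exists_hilbertBasis ℂ H
  rw [trace_star_mul_self c] at h
  exact (compact_of_tsum_lt_top c h).clm_comp (star C)

theorem compact_of_pow {T : H →L[ℂ] H} (hT : 0 ≤ T) (k : ℕ)
    (h : IsCompactOperator (T ^ (2 ^ k) : H →L[ℂ] H)) : IsCompactOperator T := by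
  induction k with
  | zero => simpa using h
  | succ k ih =>
    apply ih
    apply compact_of_star_mul_self
    rw [(hT.isSelfAdjoint.pow _).star_eq, ← pow_add, ← two_mul, ← pow_succ']
    exact h

theorem compact_of_eSchattenNorm_lt_top {p : ℝ} (hp : 1 ≤ p) {A : H →L[ℂ] H}
    (h : eSchattenNorm p A < ⊤) : IsCompactOperator A := by
  have hp0 : 0 < p := by linarith
  have hT := CFC.abs_nonneg A
  set T := CFC.abs A with hTdef
  have h1 : trace (T ^ p) < ⊤ := by
    rw [eSchattenNorm, ENNReal.rpow_lt_top_iff_of_pos (by positivity)] at h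
    exact h
  have h2 : IsCompactOperator (T ^ p : H →L[ℂ] H) := compact_of_trace_lt_top CFC.rpow_nonneg h1
  obtain ⟨k, hk⟩ : ∃ k : ℕ, p ≤ (2 ^ k : ℕ) := by
    obtain ⟨n, hn⟩ := exists_nat_ge p
    exact ⟨n, hn.trans (by exact_mod_cast Nat.lt_two_pow_self.le)⟩
  have h3 : T ^ (2 ^ k) = cfc (fun x : ℝ => x ^ (((2 ^ k : ℕ) : ℝ) - p)) T * T ^ p := by
    rw [CFC.rpow_eq_cfc_real hT, ← cfc_mul _ _ T
      (by exact (Real.continuous_rpow_const (by linarith)).continuousOn)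
      (by exact (Real.continuous_rpow_const hp0.le).continuousOn),
      ← cfc_pow_id (R := ℝ) T (2 ^ k) hT.isSelfAdjoint]
    refine cfc_congr fun x hx => ?_
    have hx0 : 0 ≤ x := spectrum_nonneg_of_nonneg hT hx
    rw [← Real.rpow_natCast]
    rcases hx0.eq_or_lt with rfl | hx0
    · rw [Real.zero_rpow hp0.ne', mul_zero, Real.zero_rpow]
      positivity
    · rw [← Real.rpow_add hx0]; ring_nf
  have h4 : IsCompactOperator (T ^ (2 ^ k) : H →L[ℂ] H) := by
    rw [h3]; exact h2.clm_comp _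
  have h5 := compact_of_pow hT k h4
  apply compact_of_star_mul_self
  rw [← CFC.abs_mul_abs A]
  exact h5.clm_comp _

/-- Diagonalization of a compact positive operator in a Hilbert basis. -/
theorem exists_eigenbasis {T : H →L[ℂ] H} (hT : 0 ≤ T) (hc : IsCompactOperator T) :
    ∃ (w : Set H) (g : HilbertBasis w ℂ H) (l : w → ℝ), (∀ i, 0 ≤ l i) ∧
      ∀ i, T (g i) = l i • g i := by
  classical
  have hpos : T.IsPositive := (ContinuousLinearMap.nonneg_iff_isPositive T).1 hT
  -- a maximal orthonormal set of eigenvectors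
  have hsym : T.IsSymmetric := hpos.isSymmetric
  have hbot := ContinuousLinearMap.orthogonalComplement_iSup_eigenspaces_eq_bot hc hsym
  let E := fun μ : ℂ => Module.End.eigenspace (T : Module.End ℂ H) μ
  have hcl : ∀ μ, IsClosed (E μ : Set H) := fun μ => by
    have : (E μ : Set H) = {x | T x = μ • x} := by
      ext x; exact Module.End.mem_eigenspace_iff
    rw [this]
    exact isClosed_eq T.continuous (continuous_const_smul μ)
  have : ∀ μ, CompleteSpace (E μ) := fun μ => (hcl μ).completeSpace_coe
  choose w b hb using fun μ => exists_hilbertBasis ℂ (E μ)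
  have hof : OrthogonalFamily ℂ (fun μ => E μ) fun μ => (E μ).subtypeₗᵢ :=
    hsym.orthogonalFamily_eigenspaces
  let v : (Σ μ, w μ) → H := fun i => (b i.1 i.2 : H)
  have hv : Orthonormal ℂ v := hof.orthonormal_sigma_orthonormal fun μ => (b μ).orthonormal
  have hvsp : (Submodule.span ℂ (Set.range v))ᗮ = ⊥ := by
    rw [eq_bot_iff, ← hbot]
    intro x hx
    rw [Submodule.mem_orthogonal] at hx ⊢
    have hle : (⨆ μ, E μ) ≤ (ℂ ∙ x)ᗮ := by
      refine iSup_le fun μ y hy => ?_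
      rw [Submodule.mem_orthogonal_singleton_iff_inner_left]
      have hs := (b μ).hasSum_repr ⟨y, hy⟩
      have hs2 := (hs.mapL (E μ).subtypeL).mapL ((innerSL ℂ) x)
      have hz : ∀ i, ⟪x, (b μ i : H)⟫_ℂ = 0 := fun i => by
        rw [inner_eq_zero_symm]
        exact hx _ (Submodule.subset_span ⟨⟨μ, i⟩, rfl⟩)
      have hs3 : ⟪x, y⟫_ℂ = 0 := by
        refine hs2.unique ?_
        simp [hz, hasSum_zero]
      rw [inner_eq_zero_symm]; exact hs3
    intro u hu
    exact (Submodule.mem_orthogonal_singleton_iff_inner_left).1 (hle hu)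
  have hv' : Orthonormal ℂ ((↑) : Set.range v → H) := hv.toSubtypeRange
  have hr : Set.range ((↑) : Set.range v → H) = Set.range v := Subtype.range_coe
  let g := HilbertBasis.mkOfOrthogonalEqBot hv' (by rw [hr]; exact hvsp)
  have hg : ∀ i, g i = i := fun i => by
    simp [g]
  have heig : ∀ i : Set.range v, ∃ l : ℝ, 0 ≤ l ∧ T i = l • (i : H) := by
    rintro ⟨_, ⟨μ, i⟩, rfl⟩
    have h1 : T (v ⟨μ, i⟩) = μ • v ⟨μ, i⟩ := Module.End.mem_eigenspace_iff.1 (b μ i).2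
    have h2 : 0 ≤ ⟪v ⟨μ, i⟩, T (v ⟨μ, i⟩)⟫_ℂ := hpos.inner_nonneg_right _
    rw [h1, inner_smul_right, inner_self_eq_norm_sq_to_K, hv.1] at h2
    have h3 : 0 ≤ μ := by simpa using h2
    refine ⟨μ.re, (Complex.nonneg_iff.1 h3).1, ?_⟩
    have h4 : μ = (μ.re : ℂ) := by
      apply Complex.ext <;> simp [(Complex.nonneg_iff.1 h3).2.symm]
    change T (v ⟨μ, i⟩) = μ.re • v ⟨μ, i⟩
    rw [h1]
    generalize v ⟨μ, i⟩ = x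
    conv_lhs => rw [h4]
    simp
  choose l hl hl2 using heig
  exact ⟨_, g, l, hl, fun i => by rw [hg]; exact hl2 i⟩

end Aux

section Variational

variable {H : Type*} [NormedAddCommGroup H] [InnerProductSpace ℂ H] [CompleteSpace H]

theorem abs_apply_of_eigen {A : H →L[ℂ] H} {v : H} {l : ℝ} (hl : 0 ≤ l)
    (h : (star A * A) v = (l ^ 2) • v) : CFC.abs A v = l • v := by
  have hpos : 0 ≤ star A * A := star_mul_self_nonneg A
  have : CFC.abs A = cfc Real.sqrt (star A * A) := by
    rw [CFC.abs, CFC.sqrt_eq_real_sqrt _ hpos, cfcₙ_eq_cfc]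
  rw [this, cfc_apply_eigenvector hpos.isSelfAdjoint Real.continuous_sqrt.continuousOn h,
    Real.sqrt_sq hl]

/-- The Schatten norm through the eigenvalues of `|A|²`. -/
theorem eSchattenNorm_of_eigen {p : ℝ} (hp : 1 ≤ p) {ι : Type*} {A : H →L[ℂ] H}
    (g : HilbertBasis ι ℂ H) {l : ι → ℝ} (hl : ∀ i, 0 ≤ l i)
    (h : ∀ i, (star A * A) (g i) = (l i ^ 2) • g i) :
    eSchattenNorm p A = (∑' i, ENNReal.ofReal (l i) ^ p) ^ (1 / p) := by
  have hp0 : 0 < p := by linarith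
  rw [eSchattenNorm, trace_of_nonneg g CFC.rpow_nonneg]
  congr 1
  refine tsum_congr fun i => ?_
  rw [CFC.rpow_eq_cfc_real (CFC.abs_nonneg A),
    cfc_apply_eigenvector (CFC.abs_nonneg A).isSelfAdjoint
      (Real.continuous_rpow_const hp0.le).continuousOn (abs_apply_of_eigen (hl i) (h i)),
    inner_smul_right_eq_smul, inner_self_eq_norm_sq_to_K, g.orthonormal.1,
    ENNReal.ofReal_rpow_of_nonneg (hl i) hp0.le]
  simp

/-- A compact operator `A` has a Hilbert basis of eigenvectors of `|A|²`. -/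
theorem exists_singular_basis {A : H →L[ℂ] H} (hA : IsCompactOperator A) :
    ∃ (w : Set H) (g : HilbertBasis w ℂ H) (l : w → ℝ), (∀ i, 0 ≤ l i) ∧
      ∀ i, (star A * A) (g i) = (l i ^ 2) • g i := by
  have hpos : 0 ≤ star A * A := star_mul_self_nonneg A
  obtain ⟨w, g, l, hl, h⟩ := exists_eigenbasis hpos (hA.clm_comp (star A))
  exact ⟨w, g, fun i => √(l i), fun i => Real.sqrt_nonneg _, fun i => by
    rw [Real.sq_sqrt (hl i)]; exact h i⟩

theorem inner_singular {ι : Type*} {A : H →L[ℂ] H} (g : HilbertBasis ι ℂ H) {l : ι → ℝ}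
    (h : ∀ i, (star A * A) (g i) = (l i ^ 2) • g i) (i j : ι) :
    ⟪A (g i), A (g j)⟫_ℂ = (l j ^ 2 : ℝ) • ⟪g i, g j⟫_ℂ := by
  rw [← ContinuousLinearMap.adjoint_inner_right, ← inner_smul_right_eq_smul, ← h j]
  rfl

/-- The normalized images of the singular vectors are orthonormal. -/
theorem orthonormal_singular {ι : Type*} {A : H →L[ℂ] H} (g : HilbertBasis ι ℂ H) {l : ι → ℝ}
    (h : ∀ i, (star A * A) (g i) = (l i ^ 2) • g i) :
    Orthonormal ℂ (fun i : {i // l i ≠ 0} => (l i)⁻¹ • A (g i)) := by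
  classical
  rw [orthonormal_iff_ite]
  rintro ⟨i, hi⟩ ⟨j, hj⟩
  rw [inner_smul_right_eq_smul, inner_smul_left_eq_smul, inner_singular g h,
    orthonormal_iff_ite.1 g.orthonormal]
  by_cases hij : i = j
  · subst hij
    simp
    field_simp
  · simp [hij]

theorem apply_eq_zero_of_singular {ι : Type*} {A : H →L[ℂ] H} (g : HilbertBasis ι ℂ H) {l : ι → ℝ}
    (h : ∀ i, (star A * A) (g i) = (l i ^ 2) • g i) {i : ι} (hi : l i = 0) : A (g i) = 0 := by
  have := inner_singular g h i i
  rw [hi] at this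
  simpa using this

theorem sum_le_eSchattenNorm {p : ℝ} (hp : 1 ≤ p) {A : H →L[ℂ] H} (hA : IsCompactOperator A)
    {κ : Type*} [Fintype κ] {e f : κ → H} (he : Orthonormal ℂ e) (hf : Orthonormal ℂ f) :
    (∑ i, ‖⟪f i, A (e i)⟫_ℂ‖ₑ ^ p) ^ (1 / p) ≤ eSchattenNorm p A := by
  obtain ⟨w, g, l, hl, h⟩ := exists_singular_basis hA
  have hp0 : 0 < p := by linarith
  rw [eSchattenNorm_of_eigen hp g hl h]
  have ho := orthonormal_singular g h
  let W : κ → {i // l i ≠ 0} → ℝ≥0∞ :=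
    fun i k => ‖⟪g k, e i⟫_ℂ‖ₑ * ‖⟪(l k)⁻¹ • A (g k), f i⟫_ℂ‖ₑ
  have key : ∀ i, ‖⟪f i, A (e i)⟫_ℂ‖ₑ ≤
      ∑' k : {i // l i ≠ 0}, W i k * ENNReal.ofReal (l k) := by
    intro i
    have h1 : HasSum (fun k => ⟪g k, e i⟫_ℂ * ⟪f i, A (g k)⟫_ℂ) ⟪f i, A (e i)⟫_ℂ := by
      have := ((g.hasSum_repr (e i)).mapL A).mapL (innerSL ℂ (f i))
      simpa [HilbertBasis.repr_apply_apply, inner_smul_right] using this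
    have h2 : HasSum (fun k : {i // l i ≠ 0} => ⟪g k, e i⟫_ℂ * ⟪f i, A (g k)⟫_ℂ)
        ⟪f i, A (e i)⟫_ℂ := by
      refine (hasSum_subtype_iff_of_support_subset (s := {i | l i ≠ 0}) ?_).2 h1
      intro k hk
      simp only [Function.mem_support] at hk
      intro h0
      apply hk
      rw [apply_eq_zero_of_singular g h h0]; simp
    rw [← h2.tsum_eq]
    refine enorm_tsum_le_tsum_enorm.trans (le_of_eq (tsum_congr fun k => ?_))
    have hk : 0 < l k := lt_of_le_of_ne (hl k) (Ne.symm k.2)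
    have h3 : ‖⟪f i, A (g k)⟫_ℂ‖ₑ =
        ‖⟪(l k)⁻¹ • A (g k), f i⟫_ℂ‖ₑ * ENNReal.ofReal (l k) := by
      rw [inner_smul_left_eq_smul, enorm_smul, enorm_inner_symm,
        mul_comm, ← mul_assoc, ← Real.enorm_of_nonneg hk.le, ← enorm_mul, mul_inv_cancel₀ hk.ne']
      simp
    rw [enorm_mul, h3, ← mul_assoc]
  have hnorm : ∀ i, ‖e i‖ₑ = 1 := fun i => by rw [← ofReal_norm, he.1]; simp
  have hnormf : ∀ i, ‖f i‖ₑ = 1 := fun i => by rw [← ofReal_norm, hf.1]; simp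
  have hnormg : ∀ i, ‖g i‖ₑ = 1 := fun i => by rw [← ofReal_norm, g.orthonormal.1]; simp
  have hnormo : ∀ k : {i // l i ≠ 0}, ‖(l k)⁻¹ • A (g k)‖ₑ = 1 :=
    fun i => by rw [← ofReal_norm, ho.1]; simp
  have hW1 : ∀ i, ∑' k, W i k ≤ 1 := by
    intro i
    have b1 := bessel (g.orthonormal.comp (Subtype.val : {i // l i ≠ 0} → w)
      Subtype.val_injective) (e i)
    have b2 := bessel ho (f i)
    rw [hnorm, one_pow] at b1
    rw [hnormf, one_pow] at b2
    exact tsum_mul_le_one b1 b2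
  have hW2 : ∀ k, ∑' i, W i k ≤ 1 := by
    intro k
    have b1 := bessel he (g k)
    have b2 := bessel hf ((l k)⁻¹ • A (g k))
    rw [hnormg, one_pow] at b1
    rw [hnormo, one_pow] at b2
    refine tsum_mul_le_one (le_of_eq_of_le ?_ b1) (le_of_eq_of_le ?_ b2)
    · exact tsum_congr fun i => by rw [enorm_inner_symm (e i)]
    · exact tsum_congr fun i => by rw [enorm_inner_symm (f i)]
  refine ENNReal.rpow_le_rpow ?_ (by positivity)
  calc ∑ i, ‖⟪f i, A (e i)⟫_ℂ‖ₑ ^ p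
      ≤ ∑ i, (∑' k : {i // l i ≠ 0}, W i k * ENNReal.ofReal (l k)) ^ p :=
        Finset.sum_le_sum fun i _ => ENNReal.rpow_le_rpow (key i) hp0.le
    _ = ∑' i, (∑' k : {i // l i ≠ 0}, W i k * ENNReal.ofReal (l k)) ^ p :=
        (tsum_fintype _).symm
    _ ≤ ∑' k : {i // l i ≠ 0}, ENNReal.ofReal (l k) ^ p :=
        doubly_substochastic hp W _ hW1 hW2
    _ ≤ ∑' k, ENNReal.ofReal (l k) ^ p :=
        ENNReal.tsum_comp_le_tsum_of_injective (f := Subtype.val) Subtype.val_injective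
          (fun k => ENNReal.ofReal (l k) ^ p)

theorem eSchattenNorm_le {p : ℝ} (hp : 1 ≤ p) {A : H →L[ℂ] H} (hA : IsCompactOperator A)
    {C : ℝ≥0∞}
    (hC : ∀ (n : ℕ) (e f : Fin n → H), Orthonormal ℂ e → Orthonormal ℂ f →
      (∑ i, ‖⟪f i, A (e i)⟫_ℂ‖ₑ ^ p) ^ (1 / p) ≤ C) :
    eSchattenNorm p A ≤ C := by
  classical
  obtain ⟨w, g, l, hl, h⟩ := exists_singular_basis hA
  have hp0 : 0 < p := by linarith
  rw [eSchattenNorm_of_eigen hp g hl h, one_div, ENNReal.rpow_inv_le_iff hp0]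
  rw [ENNReal.tsum_eq_iSup_sum]
  refine iSup_le fun s => ?_
  let t : Finset {i // l i ≠ 0} := s.subtype _
  have ho := orthonormal_singular g h
  let eq := t.equivFin.symm
  have h1 := hC _ (fun i => g (eq i).1) (fun i => (l (eq i).1)⁻¹ • A (g (eq i).1))
    (g.orthonormal.comp _ (Subtype.val_injective.comp
      (Subtype.val_injective.comp eq.injective)))
    (ho.comp _ (Subtype.val_injective.comp eq.injective))
  rw [one_div, ENNReal.rpow_inv_le_iff hp0] at h1
  refine le_trans (le_of_eq ?_) h1
  have h2 : ∀ k : {i // l i ≠ 0}, ‖⟪(l k)⁻¹ • A (g k), A (g k)⟫_ℂ‖ₑ ^ p =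
      ENNReal.ofReal (l k) ^ p := by
    intro k
    rw [inner_smul_left_eq_smul, inner_singular g h, inner_self_eq_norm_sq_to_K, g.orthonormal.1,
      smul_smul, ← Real.enorm_of_nonneg (hl k)]
    have : (l k)⁻¹ * (l k) ^ 2 = l k := by have := k.2; field_simp
    rw [this, enorm_smul]; simp
  rw [eq.sum_comp (fun k : t => ‖⟪(l k.1)⁻¹ • A (g k.1), A (g k.1)⟫_ℂ‖ₑ ^ p)]
  simp_rw [h2]
  rw [Finset.sum_coe_sort t (fun k => ENNReal.ofReal (l k) ^ p)]
  simp only [t]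
  rw [Finset.sum_subtype_eq_sum_filter (f := fun k => ENNReal.ofReal (l k) ^ p),
    Finset.sum_filter_of_ne]
  intro i _ hi h0
  apply hi
  rw [h0]
  simp [hp0]

theorem eSchattenNorm_zero {p : ℝ} (hp : 1 ≤ p) : eSchattenNorm p (0 : H →L[ℂ] H) = 0 := by
  have hp0 : 0 < p := by linarith
  refine le_antisymm (eSchattenNorm_le hp isCompactOperator_zero fun n e f _ _ => ?_) bot_le
  simp [hp0]

theorem eSchattenNorm_add_le {p : ℝ} (hp : 1 ≤ p) {A B : H →L[ℂ] H}
    (hA : IsCompactOperator A) (hB : IsCompactOperator B) :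
    eSchattenNorm p (A + B) ≤ eSchattenNorm p A + eSchattenNorm p B := by
  have hp0 : 0 < p := by linarith
  refine eSchattenNorm_le hp (hA.add hB) fun n e f he hf => ?_
  calc _ ≤ (∑ i, (‖⟪f i, A (e i)⟫_ℂ‖ₑ + ‖⟪f i, B (e i)⟫_ℂ‖ₑ) ^ p) ^ (1 / p) := by
        gcongr with i
        rw [add_apply, inner_add_right]
        exact enorm_add_le _ _
    _ ≤ _ := (ENNReal.Lp_add_le _ _ _ hp).trans
        (add_le_add (sum_le_eSchattenNorm hp hA he hf) (sum_le_eSchattenNorm hp hB he hf))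

theorem eSchattenNorm_smul_le {p : ℝ} (hp : 1 ≤ p) {A : H →L[ℂ] H} (hA : IsCompactOperator A)
    (c : ℂ) : eSchattenNorm p (c • A) ≤ ‖c‖ₑ * eSchattenNorm p A := by
  have hp0 : 0 < p := by linarith
  refine eSchattenNorm_le hp (hA.smul c) fun n e f he hf => ?_
  refine le_trans (le_of_eq ?_) (mul_le_mul_right (sum_le_eSchattenNorm hp hA he hf) _)
  have : ∀ i, ‖⟪f i, (c • A) (e i)⟫_ℂ‖ₑ ^ p = ‖c‖ₑ ^ p * ‖⟪f i, A (e i)⟫_ℂ‖ₑ ^ p := fun i => by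
    rw [smul_apply, inner_smul_right, enorm_mul, ENNReal.mul_rpow_of_nonneg _ _ hp0.le]
  simp_rw [this]
  rw [← Finset.mul_sum, ENNReal.mul_rpow_of_nonneg _ _ (by positivity), one_div,
    ENNReal.rpow_rpow_inv hp0.ne']

theorem eSchattenNorm_neg {p : ℝ} (A : H →L[ℂ] H) : eSchattenNorm p (-A) = eSchattenNorm p A := by
  rw [eSchattenNorm, CFC.abs_neg, eSchattenNorm]

theorem enorm_apply_le {p : ℝ} (hp : 1 ≤ p) {A : H →L[ℂ] H} (hA : IsCompactOperator A) (x : H) :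
    ‖A x‖ₑ ≤ eSchattenNorm p A * ‖x‖ₑ := by
  have hp0 : 0 < p := by linarith
  rcases eq_or_ne (A x) 0 with h0 | h0
  · simp [h0]
  have hx : x ≠ 0 := fun h => h0 (by simp [h])
  have ho : ∀ y : H, y ≠ 0 → Orthonormal ℂ (fun _ : Unit => ((‖y‖ : ℂ))⁻¹ • y) := fun y hy => by
    refine ⟨fun _ => ?_, fun i j hij => absurd (Subsingleton.elim i j) hij⟩
    rw [norm_smul, norm_inv, Complex.norm_real, norm_norm,
      inv_mul_cancel₀ (norm_ne_zero_iff.2 hy)]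
  have := sum_le_eSchattenNorm hp hA (ho x hx) (ho (A x) h0)
  simp only [Finset.univ_unique, Finset.sum_singleton, one_div] at this
  rw [ENNReal.rpow_rpow_inv hp0.ne', map_smul, inner_smul_left, inner_smul_right,
    inner_self_eq_norm_sq_to_K] at this
  have h2 : ((starRingEnd ℂ) (‖A x‖ : ℂ)⁻¹ * ((‖x‖ : ℂ)⁻¹ * (‖A x‖ : ℂ) ^ 2)) =
      ((‖A x‖ / ‖x‖ : ℝ) : ℂ) := by
    have : (‖A x‖ : ℂ) ≠ 0 := by exact_mod_cast norm_ne_zero_iff.2 h0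
    simp
    field_simp
  erw [h2] at this
  have h3 : ‖((‖A x‖ / ‖x‖ : ℝ) : ℂ)‖ₑ * ‖x‖ₑ = ‖A x‖ₑ := by
    rw [← ofReal_norm, ← ofReal_norm x, ← ENNReal.ofReal_mul (norm_nonneg _), Complex.norm_real,
      Real.norm_of_nonneg (by positivity), div_mul_cancel₀ _ (norm_ne_zero_iff.2 hx), ofReal_norm]
  rw [← h3]
  gcongr

theorem eSchattenNorm_rankOne_le {p : ℝ} (hp : 1 ≤ p) (x y : H) :
    eSchattenNorm p (InnerProductSpace.rankOne ℂ x y) ≤ ‖x‖ₑ * ‖y‖ₑ := by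
  have hp0 : 0 < p := by linarith
  refine eSchattenNorm_le hp (rankOne_compact x y) fun n e f he hf => ?_
  have h1 : ∀ i, ‖⟪f i, InnerProductSpace.rankOne ℂ x y (e i)⟫_ℂ‖ₑ =
      ‖⟪f i, x⟫_ℂ‖ₑ * ‖⟪e i, y⟫_ℂ‖ₑ := fun i => by
    rw [InnerProductSpace.rankOne_apply, inner_smul_right, enorm_mul, mul_comm,
      enorm_inner_symm (e i) y]
  simp_rw [h1]
  have h2 : ∑ i, ‖⟪f i, x⟫_ℂ‖ₑ * ‖⟪e i, y⟫_ℂ‖ₑ ≤ ‖x‖ₑ * ‖y‖ₑ := by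
    refine (ENNReal.inner_le_Lp_mul_Lq Finset.univ _ _ (p := 2) (q := 2)
        (by constructor <;> norm_num)).trans ?_
    have b1 := bessel hf x
    have b2 := bessel he y
    rw [tsum_fintype] at b1 b2
    simp only [ENNReal.rpow_ofNat]
    have : ∀ a : ℝ≥0∞, (a ^ 2) ^ (1 / 2 : ℝ) = a := fun a => by
      rw [← ENNReal.rpow_natCast, ← ENNReal.rpow_mul]; norm_num
    calc _ ≤ (‖x‖ₑ ^ 2) ^ (1 / 2 : ℝ) * (‖y‖ₑ ^ 2) ^ (1 / 2 : ℝ) := by gcongr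
      _ = _ := by rw [this, this]
  set M := ‖x‖ₑ * ‖y‖ₑ with hM
  have hM' : M ≠ ⊤ := ENNReal.mul_ne_top enorm_ne_top enorm_ne_top
  rw [one_div, ENNReal.rpow_inv_le_iff hp0]
  calc ∑ i, (‖⟪f i, x⟫_ℂ‖ₑ * ‖⟪e i, y⟫_ℂ‖ₑ) ^ p
      ≤ ∑ i, M ^ (p - 1) * (‖⟪f i, x⟫_ℂ‖ₑ * ‖⟪e i, y⟫_ℂ‖ₑ) := by
        refine Finset.sum_le_sum fun i _ => ?_
        set a := ‖⟪f i, x⟫_ℂ‖ₑ * ‖⟪e i, y⟫_ℂ‖ₑ with ha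
        have haM : a ≤ M := le_trans (Finset.single_le_sum
          (f := fun i => ‖⟪f i, x⟫_ℂ‖ₑ * ‖⟪e i, y⟫_ℂ‖ₑ) (fun _ _ => bot_le) (Finset.mem_univ i)) h2
        calc a ^ p = a ^ ((p - 1) + 1) := by ring_nf
          _ = a ^ (p - 1) * a := by
            rw [ENNReal.rpow_add_of_nonneg _ _ (by linarith) zero_le_one, ENNReal.rpow_one]
          _ ≤ _ := by gcongr
    _ = M ^ (p - 1) * ∑ i, ‖⟪f i, x⟫_ℂ‖ₑ * ‖⟪e i, y⟫_ℂ‖ₑ := by rw [Finset.mul_sum]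
    _ ≤ M ^ (p - 1) * M := by gcongr
    _ = M ^ p := by
        conv_rhs => rw [show p = (p - 1) + 1 by ring]
        rw [ENNReal.rpow_add_of_nonneg _ _ (by linarith) zero_le_one, ENNReal.rpow_one]

/-- Finite sums of rank one operators are dense in the Schatten class. -/
theorem exists_sum_rankOne {p : ℝ} (hp : 1 ≤ p) {A : H →L[ℂ] H} (hA : eSchattenNorm p A < ⊤)
    {ε : ℝ≥0∞} (hε : 0 < ε) :
    ∃ (n : ℕ) (x y : Fin n → H),
      eSchattenNorm p (A - ∑ i, InnerProductSpace.rankOne ℂ (x i) (y i)) < ε := by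
  classical
  have hp0 : 0 < p := by linarith
  obtain ⟨w, g, l, hl, h⟩ := exists_singular_basis (compact_of_eSchattenNorm_lt_top hp hA)
  let D : Finset w → (H →L[ℂ] H) := fun s => ∑ k ∈ s, InnerProductSpace.rankOne ℂ (A (g k)) (g k)
  have hD : ∀ s k, (A - D s) (g k) = if k ∈ s then 0 else A (g k) := by
    intro s k
    have : ∀ j, ⟪g j, g k⟫_ℂ = if j = k then 1 else 0 := fun j =>
      orthonormal_iff_ite.1 g.orthonormal j k
    simp only [D, sub_apply, FunLike.coe_sum, Finset.sum_apply,
      InnerProductSpace.rankOne_apply, this, ite_smul, one_smul, zero_smul,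
      Finset.sum_ite_eq']
    split_ifs <;> simp
  have heig : ∀ s k, (star (A - D s) * (A - D s)) (g k) =
      ((if k ∈ s then 0 else l k) ^ 2 : ℝ) • g k := by
    intro s k
    rw [mul_apply_eq_comp, hD]
    split_ifs with hk
    · simp
    · refine g.repr.injective ?_
      ext j
      rw [HilbertBasis.repr_apply_apply, HilbertBasis.repr_apply_apply,
        ContinuousLinearMap.star_eq_adjoint, ContinuousLinearMap.adjoint_inner_right, hD,
        inner_smul_right_eq_smul]
      split_ifs with hj
      · have : j ≠ k := fun h => hk (h ▸ hj)
        rw [orthonormal_iff_ite.1 g.orthonormal, if_neg this]; simp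
      · exact inner_singular g h j k
  have hnorm : ∀ s, eSchattenNorm p (A - D s) =
      (∑' k : {k // k ∉ s}, ENNReal.ofReal (l k) ^ p) ^ (1 / p) := by
    intro s
    rw [eSchattenNorm_of_eigen hp g (l := fun k => if k ∈ s then 0 else l k)
      (fun k => by split_ifs <;> simp [hl]) (heig s)]
    congr 1
    have : ∀ k, ENNReal.ofReal (if k ∈ s then 0 else l k) ^ p =
        Set.indicator {k | k ∉ s} (fun k => ENNReal.ofReal (l k) ^ p) k := fun k => by
      by_cases hk : k ∈ s <;> simp [hk, hp0]
    simp_rw [this]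
    exact (tsum_subtype {k | k ∉ s} (fun k => ENNReal.ofReal (l k) ^ p)).symm
  have hfin : ∑' k, ENNReal.ofReal (l k) ^ p ≠ ⊤ := by
    rw [eSchattenNorm_of_eigen hp g hl h, ENNReal.rpow_lt_top_iff_of_pos (by positivity)] at hA
    exact hA.ne
  have h1 := (ENNReal.tendsto_tsum_compl_atTop_zero hfin).ennrpow_const (1 / p)
  rw [ENNReal.zero_rpow_of_pos (by positivity)] at h1
  obtain ⟨s, hs⟩ := ((tendsto_order.1 h1).2 ε hε).exists
  refine ⟨s.card, fun i => A (g (s.equivFin.symm i)), fun i => g (s.equivFin.symm i), ?_⟩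
  rw [s.equivFin.symm.sum_comp (fun k : s => InnerProductSpace.rankOne ℂ (A (g k)) (g k)),
    Finset.sum_coe_sort s (fun k => InnerProductSpace.rankOne ℂ (A (g k)) (g k))]
  exact (hnorm s).trans_lt hs

end Variational

section SchattenClass

variable (p : ℝ) [Fact (1 ≤ p)] (H : Type*) [NormedAddCommGroup H] [InnerProductSpace ℂ H]
  [CompleteSpace H]

/-- The bounded operators `A` on `H` with `‖A‖_p < ∞`, as a subspace of `B(H)`. -/
noncomputable def schattenSubmodule : Submodule ℂ (H →L[ℂ] H) where
  carrier := {A | eSchattenNorm p A < ⊤}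
  add_mem' {A B} hA hB := by
    have hp : 1 ≤ p := Fact.out
    exact (eSchattenNorm_add_le hp (compact_of_eSchattenNorm_lt_top hp hA)
      (compact_of_eSchattenNorm_lt_top hp hB)).trans_lt (ENNReal.add_lt_top.2 ⟨hA, hB⟩)
  zero_mem' := by
    change eSchattenNorm p (0 : H →L[ℂ] H) < ⊤
    rw [eSchattenNorm_zero Fact.out]; exact ENNReal.zero_lt_top
  smul_mem' c A hA := by
    have hp : 1 ≤ p := Fact.out
    exact (eSchattenNorm_smul_le hp (compact_of_eSchattenNorm_lt_top hp hA) c).trans_lt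
      (ENNReal.mul_lt_top enorm_lt_top hA)

/-- The Schatten class `S^p(H)`. It is a type of its own, because its norm is not the operator
norm. -/
def SchattenClass : Type _ := schattenSubmodule p H

variable {p H}

namespace SchattenClass

noncomputable instance : AddCommGroup (SchattenClass p H) :=
  inferInstanceAs (AddCommGroup (schattenSubmodule p H))

noncomputable instance : Module ℂ (SchattenClass p H) :=
  inferInstanceAs (Module ℂ (schattenSubmodule p H))

/-- The operator underlying an element of `S^p(H)`. -/
noncomputable def toOp : SchattenClass p H →ₗ[ℂ] (H →L[ℂ] H) := (schattenSubmodule p H).subtype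

/-- An operator with `‖A‖_p < ∞` as an element of `S^p(H)`. -/
def mk (A : H →L[ℂ] H) (hA : eSchattenNorm p A < ⊤) : SchattenClass p H := ⟨A, hA⟩

theorem toOp_mk (A : H →L[ℂ] H) (hA : eSchattenNorm p A < ⊤) : toOp (mk A hA) = A := rfl

theorem toOp_injective : Function.Injective (toOp : SchattenClass p H → (H →L[ℂ] H)) :=
  Subtype.val_injective

theorem lt_top (x : SchattenClass p H) : eSchattenNorm p (toOp x) < ⊤ := x.2

theorem compact (x : SchattenClass p H) : IsCompactOperator (toOp x) :=
  compact_of_eSchattenNorm_lt_top Fact.out x.lt_top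

/-- The norm of `S^p(H)` is `‖A‖_p = Tr(|A|^p)^(1/p)`. -/
noncomputable instance : NormedAddCommGroup (SchattenClass p H) :=
  AddGroupNorm.toNormedAddCommGroup
    { toFun := fun x => (eSchattenNorm p (toOp x)).toReal
      map_zero' := by rw [map_zero, eSchattenNorm_zero Fact.out, ENNReal.toReal_zero]
      add_le' := fun x y => by
        rw [map_add, ← ENNReal.toReal_add x.lt_top.ne y.lt_top.ne]
        exact ENNReal.toReal_mono (ENNReal.add_lt_top.2 ⟨x.lt_top, y.lt_top⟩).ne
          (eSchattenNorm_add_le Fact.out x.compact y.compact)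
      neg' := fun x => by rw [map_neg, eSchattenNorm_neg]
      eq_zero_of_map_eq_zero' := fun x hx => by
        apply toOp_injective
        rw [map_zero]
        have h0 : eSchattenNorm p (toOp x) = 0 :=
          ((ENNReal.toReal_eq_zero_iff _).1 hx).resolve_right x.lt_top.ne
        ext v
        have := enorm_apply_le (p := p) Fact.out x.compact v
        rw [h0, zero_mul] at this
        simpa using this }

theorem norm_def (x : SchattenClass p H) : ‖x‖ = (eSchattenNorm p (toOp x)).toReal := rfl

theorem enorm_def (x : SchattenClass p H) : ‖x‖ₑ = eSchattenNorm p (toOp x) := by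
  rw [← ofReal_norm, norm_def, ENNReal.ofReal_toReal x.lt_top.ne]

noncomputable instance : NormedSpace ℂ (SchattenClass p H) where
  norm_smul_le c x := by
    rw [norm_def, norm_def, map_smul, ← toReal_enorm c, ← ENNReal.toReal_mul]
    exact ENNReal.toReal_mono (ENNReal.mul_lt_top enorm_lt_top x.lt_top).ne
      (eSchattenNorm_smul_le Fact.out x.compact c)

/-- The rank one operator `v ↦ ⟪y, v⟫ x` as an element of `S^p(H)`. -/
noncomputable def rankOne (x y : H) : SchattenClass p H :=
  mk (InnerProductSpace.rankOne ℂ x y) ((eSchattenNorm_rankOne_le Fact.out x y).trans_lt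
    (ENNReal.mul_lt_top enorm_lt_top enorm_lt_top))

theorem norm_rankOne_le (x y : H) : ‖(rankOne x y : SchattenClass p H)‖ ≤ ‖x‖ * ‖y‖ := by
  rw [norm_def, ← toReal_enorm x, ← toReal_enorm y, ← ENNReal.toReal_mul]
  exact ENNReal.toReal_mono (ENNReal.mul_lt_top enorm_lt_top enorm_lt_top).ne
    (eSchattenNorm_rankOne_le Fact.out x y)

theorem rankOne_add_left (x x' y : H) :
    (rankOne (x + x') y : SchattenClass p H) = rankOne x y + rankOne x' y := by
  apply toOp_injective
  rw [map_add]
  simp only [rankOne, toOp_mk]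
  rw [map_add]; rfl

theorem rankOne_add_right (x y y' : H) :
    (rankOne x (y + y') : SchattenClass p H) = rankOne x y + rankOne x y' := by
  apply toOp_injective
  rw [map_add]
  simp only [rankOne, toOp_mk]
  rw [map_add]

theorem rankOne_sub_left (x x' y : H) :
    (rankOne (x - x') y : SchattenClass p H) = rankOne x y - rankOne x' y := by
  rw [eq_sub_iff_add_eq, ← rankOne_add_left, sub_add_cancel]

theorem rankOne_sub_right (x y y' : H) :
    (rankOne x (y - y') : SchattenClass p H) = rankOne x y - rankOne x y' := by
  rw [eq_sub_iff_add_eq, ← rankOne_add_right, sub_add_cancel]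

/-- A closed subspace of `S^p(H)` that contains the rank one operators is everything. -/
theorem mem_of_rankOne_mem {M : Submodule ℂ (SchattenClass p H)}
    (hM : IsClosed (M : Set (SchattenClass p H))) (h : ∀ x y, rankOne x y ∈ M)
    (z : SchattenClass p H) : z ∈ M := by
  rw [← SetLike.mem_coe, ← hM.closure_eq, Metric.mem_closure_iff]
  intro ε hε
  obtain ⟨n, x, y, hxy⟩ := exists_sum_rankOne (p := p) Fact.out z.lt_top
    (ENNReal.ofReal_pos.2 hε)
  refine ⟨∑ i, rankOne (x i) (y i), M.sum_mem fun i _ => h _ _, ?_⟩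
  rw [dist_eq_norm, norm_def, map_sub, map_sum]
  simp only [rankOne, toOp_mk]
  exact (ENNReal.toReal_lt_of_lt_ofReal hxy)

end SchattenClass

end SchattenClass

section Tensor

variable (K H : Type*) [NormedAddCommGroup K] [InnerProductSpace ℂ K]
  [NormedAddCommGroup H] [InnerProductSpace ℂ H]

/-- The Hilbert space tensor product `K ⊗₂ H`. -/
abbrev HilbertTensor : Type _ := UniformSpace.Completion (K ⊗[ℂ] H)

variable {K H}

/-- The elementary tensor `ξ ⊗ h` in `K ⊗₂ H`. -/
noncomputable def tmul (ξ : K) (h : H) : HilbertTensor K H := ((ξ ⊗ₜ[ℂ] h : K ⊗[ℂ] H) : _)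

/-- `z` is the operator `a ⊗ b` on `K ⊗₂ H`: it maps `ξ ⊗ h` to `a ξ ⊗ b h`. -/
def IsTensor (a : K →L[ℂ] K) (b : H →L[ℂ] H) (z : HilbertTensor K H →L[ℂ] HilbertTensor K H) :
    Prop :=
  ∀ ξ h, z (tmul ξ h) = tmul (a ξ) (b h)

/-- A closed subspace of `K ⊗₂ H` that contains the elementary tensors is everything. -/
theorem mem_of_tmul_mem {M : Submodule ℂ (HilbertTensor K H)}
    (hM : IsClosed (M : Set (HilbertTensor K H))) (h : ∀ ξ k, tmul ξ k ∈ M)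
    (z : HilbertTensor K H) : z ∈ M := by
  induction z using UniformSpace.Completion.induction_on with
  | hp => exact hM
  | ih u =>
    induction u using TensorProduct.induction_on with
    | zero => rw [UniformSpace.Completion.coe_zero]; exact M.zero_mem
    | tmul x y => exact h x y
    | add x y hx hy => rw [UniformSpace.Completion.coe_add]; exact M.add_mem hx hy

theorem IsTensor.unique {a : K →L[ℂ] K} {b : H →L[ℂ] H}
    {z z' : HilbertTensor K H →L[ℂ] HilbertTensor K H} (hz : IsTensor a b z)
    (hz' : IsTensor a b z') : z = z' := by
  ext u
  have := mem_of_tmul_mem (M := LinearMap.ker ((z - z' : HilbertTensor K H →L[ℂ] _) :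
      HilbertTensor K H →ₗ[ℂ] HilbertTensor K H)) (z - z').isClosed_ker
    (fun ξ k => by
      rw [LinearMap.mem_ker]
      change z (tmul ξ k) - z' (tmul ξ k) = 0
      rw [hz, hz', sub_self]) u
  exact sub_eq_zero.1 this

theorem isTensor_rankOne (ξ η : K) (h k : H) :
    IsTensor (InnerProductSpace.rankOne ℂ ξ η) (InnerProductSpace.rankOne ℂ h k)
      (InnerProductSpace.rankOne ℂ (tmul ξ h) (tmul η k)) := by
  intro ξ' h'
  rw [InnerProductSpace.rankOne_apply, InnerProductSpace.rankOne_apply,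
    InnerProductSpace.rankOne_apply]
  simp only [tmul]
  rw [UniformSpace.Completion.inner_coe, TensorProduct.inner_tmul, TensorProduct.smul_tmul_smul,
    UniformSpace.Completion.coe_smul]

theorem isTensor_add_right {a : K →L[ℂ] K} {b b' : H →L[ℂ] H} {z z' : HilbertTensor K H →L[ℂ] HilbertTensor K H}
    (hz : IsTensor a b z) (hz' : IsTensor a b' z') : IsTensor a (b + b') (z + z') := by
  intro ξ h
  rw [add_apply, hz, hz', add_apply]
  simp only [tmul]
  rw [TensorProduct.tmul_add, UniformSpace.Completion.coe_add]

theorem isTensor_smul_right {a : K →L[ℂ] K} {b : H →L[ℂ] H} {z : HilbertTensor K H →L[ℂ] HilbertTensor K H}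
    (hz : IsTensor a b z) (c : ℂ) : IsTensor a (c • b) (c • z) := by
  intro ξ h
  rw [smul_apply, hz, smul_apply]
  simp only [tmul]
  rw [TensorProduct.tmul_smul, UniformSpace.Completion.coe_smul]

theorem rankOne_tmul_mem {p : ℝ} [Fact (1 ≤ p)]
    {M : Submodule ℂ (SchattenClass p (HilbertTensor K H))}
    (hM : IsClosed (M : Set (SchattenClass p (HilbertTensor K H))))
    (h : ∀ ξ η h k, SchattenClass.rankOne (tmul ξ h) (tmul η k) ∈ M)
    (z : SchattenClass p (HilbertTensor K H)) : z ∈ M := by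
  have smul_left : ∀ (c : ℂ) (x y : HilbertTensor K H),
      (SchattenClass.rankOne (c • x) y : SchattenClass p _) = c • SchattenClass.rankOne x y := by
    intro c x y
    apply SchattenClass.toOp_injective
    rw [map_smul]
    simp only [SchattenClass.rankOne, SchattenClass.toOp_mk]
    rw [map_smul]; rfl
  have smul_right : ∀ (c : ℂ) (x y : HilbertTensor K H),
      (SchattenClass.rankOne x (c • y) : SchattenClass p _) =
        (starRingEnd ℂ c) • SchattenClass.rankOne x y := by
    intro c x y
    apply SchattenClass.toOp_injective
    rw [map_smul]
    simp only [SchattenClass.rankOne, SchattenClass.toOp_mk]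
    rw [map_smulₛₗ]
  have zero_left : ∀ y : HilbertTensor K H,
      (SchattenClass.rankOne 0 y : SchattenClass p _) = 0 := fun y => by
    have := smul_left 0 0 y
    simpa using this
  have zero_right : ∀ y : HilbertTensor K H,
      (SchattenClass.rankOne y 0 : SchattenClass p _) = 0 := fun y => by
    have := smul_right 0 y 0
    simpa using this
  have cont_left : ∀ y : HilbertTensor K H, Continuous fun x : HilbertTensor K H =>
      (SchattenClass.rankOne x y : SchattenClass p _) := fun y => by
    refine (LipschitzWith.of_dist_le_mul (K := ‖y‖₊) fun x x' => ?_).continuous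
    rw [dist_eq_norm, ← SchattenClass.rankOne_sub_left, dist_eq_norm, mul_comm]
    exact SchattenClass.norm_rankOne_le _ _
  have cont_right : ∀ x : HilbertTensor K H, Continuous fun y : HilbertTensor K H =>
      (SchattenClass.rankOne x y : SchattenClass p _) := fun x => by
    refine (LipschitzWith.of_dist_le_mul (K := ‖x‖₊) fun y y' => ?_).continuous
    rw [dist_eq_norm, ← SchattenClass.rankOne_sub_right, dist_eq_norm]
    exact SchattenClass.norm_rankOne_le _ _
  have h1 : ∀ x η k, SchattenClass.rankOne x (tmul η k) ∈ M := by
    intro x η k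
    let N : Submodule ℂ (HilbertTensor K H) :=
      { carrier := {x | SchattenClass.rankOne x (tmul η k) ∈ M}
        add_mem' := fun {x y} hx hy => by
          simp only [Set.mem_ofPred_eq] at hx hy ⊢
          rw [SchattenClass.rankOne_add_left]; exact M.add_mem hx hy
        zero_mem' := by
          simp only [Set.mem_ofPred_eq]
          rw [zero_left]; exact M.zero_mem
        smul_mem' := fun c x hx => by
          simp only [Set.mem_ofPred_eq] at hx ⊢
          rw [smul_left]; exact M.smul_mem _ hx }
    exact mem_of_tmul_mem (M := N) (hM.preimage (cont_left _)) (fun ξ h' => h ξ η h' k) x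
  refine SchattenClass.mem_of_rankOne_mem hM (fun x y => ?_) z
  let N : Submodule ℂ (HilbertTensor K H) :=
    { carrier := {y | SchattenClass.rankOne x y ∈ M}
      add_mem' := fun {y y'} hx hy => by
        simp only [Set.mem_ofPred_eq] at hx hy ⊢
        rw [SchattenClass.rankOne_add_right]; exact M.add_mem hx hy
      zero_mem' := by
        simp only [Set.mem_ofPred_eq]
        rw [zero_right]; exact M.zero_mem
      smul_mem' := fun c y hx => by
        simp only [Set.mem_ofPred_eq] at hx ⊢
        rw [smul_right]; exact M.smul_mem _ hx }
  exact mem_of_tmul_mem (M := N) (hM.preimage (cont_right _)) (fun η k => h1 x η k) y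

end Tensor

section CompletelyBounded

variable {p : ℝ} [Fact (1 ≤ p)]
variable {H : Type*} [NormedAddCommGroup H] [InnerProductSpace ℂ H] [CompleteSpace H]

/-- `Φ` is a bounded operator on `S^p(K ⊗₂ H)` that extends `id ⊗ T`, that is, `Φ (a ⊗ b) = a ⊗ T b`
for all `a ∈ S^p(K)` and `b ∈ S^p(H)`. Here the algebraic tensor product `S^p(K) ⊗ S^p(H)` is viewed
as a dense subspace of `S^p(K ⊗₂ H)`; so there is at most one such `Φ`, see
`IsAmpliation.unique`. -/
def IsAmpliation (K : Type*) [NormedAddCommGroup K] [InnerProductSpace ℂ K] [CompleteSpace K]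
    (T : SchattenClass p H →L[ℂ] SchattenClass p H)
    (Φ : SchattenClass p (HilbertTensor K H) →L[ℂ] SchattenClass p (HilbertTensor K H)) : Prop :=
  ∀ (a : SchattenClass p K) (b : SchattenClass p H) (z : SchattenClass p (HilbertTensor K H)),
    IsTensor a.toOp b.toOp z.toOp → IsTensor a.toOp (T b).toOp (Φ z).toOp

/-- The bounded extension of `id ⊗ T` is unique. -/
theorem IsAmpliation.unique {K : Type*} [NormedAddCommGroup K] [InnerProductSpace ℂ K]
    [CompleteSpace K] {T : SchattenClass p H →L[ℂ] SchattenClass p H}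
    {Φ Φ' : SchattenClass p (HilbertTensor K H) →L[ℂ] SchattenClass p (HilbertTensor K H)}
    (h : IsAmpliation K T Φ) (h' : IsAmpliation K T Φ') : Φ = Φ' := by
  ext1 z
  have := rankOne_tmul_mem (M := LinearMap.ker ((Φ - Φ' : SchattenClass p (HilbertTensor K H) →L[ℂ]
      SchattenClass p (HilbertTensor K H)) : SchattenClass p (HilbertTensor K H) →ₗ[ℂ]
      SchattenClass p (HilbertTensor K H))) (Φ - Φ').isClosed_ker (fun ξ η k l => by
    rw [LinearMap.mem_ker]
    change Φ _ - Φ' _ = 0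
    rw [sub_eq_zero]
    apply SchattenClass.toOp_injective
    have ht : IsTensor (SchattenClass.rankOne ξ η : SchattenClass p K).toOp
        (SchattenClass.rankOne k l : SchattenClass p H).toOp
        (SchattenClass.rankOne (tmul ξ k) (tmul η l) :
          SchattenClass p (HilbertTensor K H)).toOp := isTensor_rankOne ξ η k l
    exact (h _ _ _ ht).unique (h' _ _ _ ht)) z
  exact sub_eq_zero.1 this

theorem IsAmpliation.add {K : Type*} [NormedAddCommGroup K] [InnerProductSpace ℂ K]
    [CompleteSpace K] {T T' : SchattenClass p H →L[ℂ] SchattenClass p H}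
    {Φ Φ' : SchattenClass p (HilbertTensor K H) →L[ℂ] SchattenClass p (HilbertTensor K H)}
    (h : IsAmpliation K T Φ) (h' : IsAmpliation K T' Φ') : IsAmpliation K (T + T') (Φ + Φ') :=
  fun a b z hz => by
    rw [add_apply, add_apply, map_add, map_add]
    exact isTensor_add_right (h a b z hz) (h' a b z hz)

theorem IsAmpliation.smul {K : Type*} [NormedAddCommGroup K] [InnerProductSpace ℂ K]
    [CompleteSpace K] {T : SchattenClass p H →L[ℂ] SchattenClass p H}
    {Φ : SchattenClass p (HilbertTensor K H) →L[ℂ] SchattenClass p (HilbertTensor K H)}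
    (h : IsAmpliation K T Φ) (c : ℂ) : IsAmpliation K (c • T) (c • Φ) :=
  fun a b z hz => by
    rw [smul_apply, smul_apply, map_smul, map_smul]
    exact isTensor_smul_right (h a b z hz) c

variable (p H)

/-- The space `CB(S^p(H), S^p(H))` of completely bounded maps: for every Hilbert space `K`, the map
`id ⊗ T` on `S^p(K) ⊗ S^p(H)` extends to a bounded map on `S^p(K ⊗₂ H)`. The universe of `K` is no
restriction, since `K = ℓ²` already gives both the condition and the norm `‖T‖_cb`. -/
noncomputable def CB : Submodule ℂ (SchattenClass p H →L[ℂ] SchattenClass p H) where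
  carrier := {T | ∀ (K : Type) [NormedAddCommGroup K] [InnerProductSpace ℂ K] [CompleteSpace K],
    ∃ Φ, IsAmpliation K T Φ}
  add_mem' := fun hT hT' K _ _ _ => by
    obtain ⟨Φ, h⟩ := hT K
    obtain ⟨Φ', h'⟩ := hT' K
    exact ⟨_, h.add h'⟩
  zero_mem' := fun K _ _ _ => ⟨0, fun a b z _ ξ h => by
    change (SchattenClass.toOp (0 : SchattenClass p (HilbertTensor K H))) (tmul ξ h) =
      tmul (a.toOp ξ) ((SchattenClass.toOp (0 : SchattenClass p H)) h)
    rw [map_zero, map_zero]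
    simp only [tmul, zero_apply, TensorProduct.tmul_zero]
    exact UniformSpace.Completion.coe_zero.symm⟩
  smul_mem' := fun c T hT K _ _ _ => by
    obtain ⟨Φ, h⟩ := hT K
    exact ⟨_, h.smul c⟩

variable {p H}

/-- The identity map of `S^p(H)` as an element of `CB(S^p(H), S^p(H))`. -/
noncomputable def idCB : CB p H :=
  ⟨ContinuousLinearMap.id ℂ _, fun _ _ _ _ => ⟨ContinuousLinearMap.id ℂ _, fun _ _ _ h => h⟩⟩

/-- The bounded extension of `id ⊗ T` to `S^p(K ⊗₂ H)`, as a linear function of the completely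
bounded map `T`. -/
noncomputable def ampliation (K : Type) [NormedAddCommGroup K] [InnerProductSpace ℂ K]
    [CompleteSpace K] :
    CB p H →ₗ[ℂ]
      (SchattenClass p (HilbertTensor K H) →L[ℂ] SchattenClass p (HilbertTensor K H)) where
  toFun T := (T.2 K).choose
  map_add' T T' := ((T + T').2 K).choose_spec.unique
    ((T.2 K).choose_spec.add (T'.2 K).choose_spec)
  map_smul' c T := ((c • T).2 K).choose_spec.unique ((T.2 K).choose_spec.smul c)

theorem ampliation_spec (K : Type) [NormedAddCommGroup K] [InnerProductSpace ℂ K]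
    [CompleteSpace K] (T : CB p H) :
    IsAmpliation K (T : SchattenClass p H →L[ℂ] SchattenClass p H) (ampliation K T) :=
  (T.2 K).choose_spec

/-- The completely bounded norm `‖T‖_cb`, the supremum over all Hilbert spaces `K` of the norm of
`id ⊗ T` on `S^p(K ⊗₂ H)`. -/
noncomputable def cbNorm (T : CB p H) : ℝ≥0∞ :=
  ⨆ (K : Type) (_ : NormedAddCommGroup K) (_ : InnerProductSpace ℂ K) (_ : CompleteSpace K),
    ‖ampliation K T‖ₑ

/-- The Hilbert space `ℓ²`. -/
abbrev EllTwo : Type := lp (fun _ : ℕ => ℂ) 2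

variable (p H)

/-- The sequences `(x_i)` in `c₀(S^p(ℓ² ⊗₂ H))`. -/
def NullSeq : Type _ :=
  {x : ℕ → SchattenClass p (HilbertTensor EllTwo H) // Filter.Tendsto x Filter.atTop (𝓝 0)}

variable {p H}

theorem bddAbove_stable (x : NullSeq p H) (T : CB p H) :
    BddAbove (Set.range fun i => ‖ampliation EllTwo T (x.1 i)‖) := by
  obtain ⟨C, hC⟩ := (Metric.isBounded_range_of_tendsto x.1 x.2).exists_norm_le
  refine ⟨‖ampliation EllTwo T‖ * C, ?_⟩
  rintro _ ⟨i, rfl⟩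
  exact (ContinuousLinearMap.le_opNorm _ _).trans (by gcongr; exact hC _ ⟨i, rfl⟩)

/-- The seminorm `T ↦ sup_i ‖(id ⊗ T)(x_i)‖_p` on `CB(S^p(H), S^p(H))`. -/
noncomputable def stableSeminorm (x : NullSeq p H) : Seminorm ℂ (CB p H) :=
  Seminorm.of (fun T => ⨆ i, ‖ampliation EllTwo T (x.1 i)‖)
    (fun T T' => by
      refine ciSup_le fun i => ?_
      rw [map_add, add_apply]
      exact (norm_add_le _ _).trans (add_le_add (le_ciSup (bddAbove_stable x T) i)
        (le_ciSup (bddAbove_stable x T') i)))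
    (fun c T => by
      simp_rw [map_smul, smul_apply, norm_smul]
      exact (Real.mul_iSup_of_nonneg (norm_nonneg c) _).symm)

noncomputable instance : Nonempty (NullSeq p H) := ⟨⟨fun _ => 0, tendsto_const_nhds⟩⟩

variable (p H)

/-- The stable point-norm topology on `CB(S^p(H), S^p(H))`: the locally convex topology defined by
the seminorms `T ↦ sup_i ‖(id ⊗ T)(x_i)‖_p`, for `(x_i)` in `c₀(S^p(ℓ² ⊗₂ H))`. -/
@[reducible] noncomputable def stableTopology : TopologicalSpace (CB p H) :=
  (SeminormFamily.moduleFilterBasis (fun x : NullSeq p H => stableSeminorm x)).topology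

end CompletelyBounded

end Schatten

/-
For star projections `P` on a Hilbert space, the compressions `x ↦ P x P` of `S^p` satisfy
power-type smoothness and convexity inequalities that are uniform in `P`, because `1 < p < ∞`.
These pass to the maps `T ↦ C ∘ T ∘ C` on operators between Schatten classes, hence to the
completely bounded norm. Uniform smoothness implies that a functional `φ` with `φ ≤ ‖·‖_cb` is, on
finite rank maps, close in norm to `T ↦ φ (C T C)` for a large enough finite-dimensional
compression `C`. Choosing increasing compressions `C_n` with error `4⁻ⁿ`, and a null sequence that
norms the maps compressed by `C_n` up to the factor `2ⁿ`, the functionals `φ (C_n T C_n)` converge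
to a stably continuous functional `g` that agrees with `φ` on finite rank maps and satisfies
`g id ≤ 1`. Hahn–Banach separation concludes.
-/

namespace Schatten

section Smoothness

variable {ι V : Type*} [AddCommGroup V] [Module ℝ V]

/-- Uniform smoothness of a seminorm, in the sense of `q (x + t y) = 1 + o(t)`, tested only for
`x` in the range of some `P i` and `y` in the range of `1 - P i`, and uniformly in `i`. The maps
`P i` are meant to be contractive projections. -/
def UniformlySmoothAlong (q : Seminorm ℝ V) (P : ι → V → V) : Prop :=
  ∀ δ > 0, ∃ t > 0, ∀ i x y, q x ≤ 1 → q y ≤ 1 → q (P i x + t • (y - P i y)) ≤ 1 + δ * t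

/-- The property dual to `UniformlySmoothAlong`: if `q x ≤ 1` and `q (P i x)` is close to `1`, then
`q (x - P i x)` is small, uniformly in `i`. -/
def UniformlyConvexAlong (q : Seminorm ℝ V) (P : ι → V → V) : Prop :=
  ∀ δ > 0, ∃ t > 0, ∀ i x, q x ≤ 1 → q (P i x) + t * q (x - P i x) ≤ 1 + δ * t

theorem le_mul_of_unitBall {q : Seminorm ℝ V} {φ : V →ₗ[ℝ] ℝ} {u : ℝ}
    (h : ∀ x, q x ≤ 1 → φ x ≤ u) (x : V) : φ x ≤ u * q x := by
  have hr : ∀ r > q x, φ x ≤ u * r := fun r hr => by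
    have hr0 : 0 < r := (apply_nonneg q x).trans_lt hr
    have := h (r⁻¹ • x) (by
      rw [map_smul_eq_mul, norm_inv, Real.norm_of_nonneg hr0.le, inv_mul_le_one₀ hr0]
      exact hr.le)
    rwa [map_smul, smul_eq_mul, inv_mul_le_iff₀ hr0, mul_comm] at this
  have hlim : Filter.Tendsto (fun r => u * r) (𝓝[>] q x) (𝓝 (u * q x)) :=
    (continuous_const_mul u).continuousAt.continuousWithinAt
  exact ge_of_tendsto hlim (eventually_mem_nhdsWithin.mono hr)

theorem exists_pos_mul_rpow_le (C : ℝ) {s δ : ℝ} (hs : 0 < s) (hδ : 0 < δ) :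
    ∃ t > 0, C * t ^ s ≤ δ := by
  have hlim : Filter.Tendsto (fun t : ℝ => C * t ^ s) (𝓝[>] 0) (𝓝 0) := by
    have := ((Real.continuous_rpow_const hs.le).const_mul C).tendsto 0
    rw [Real.zero_rpow hs.ne', mul_zero] at this
    exact this.mono_left nhdsWithin_le_nhds
  obtain ⟨t, ht, ht0⟩ := ((hlim.eventually_le_const hδ).and self_mem_nhdsWithin).exists
  exact ⟨t, ht0, ht⟩

theorem UniformlySmoothAlong.of_rpow {q : Seminorm ℝ V} {P : ι → V →ₗ[ℝ] V} {r C : ℝ}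
    (hP : ∀ i x, P i (P i x) = P i x) (hq : ∀ i x, q (P i x) ≤ q x) (hr : 1 < r) (hC : 0 ≤ C)
    (h : ∀ i x, q x ^ r ≤ q (P i x) ^ r + C * q (x - P i x) ^ r) :
    UniformlySmoothAlong q fun i => P i := by
  intro δ hδ
  obtain ⟨t, ht, htδ⟩ := exists_pos_mul_rpow_le (C * 2 ^ r) (sub_pos.2 hr) hδ
  refine ⟨t, ht, fun i x y hx hy => ?_⟩
  have hpow := h i (P i x + t • (y - P i y))
  simp only [map_add, map_smul, map_sub, hP, sub_self, smul_zero, add_zero, add_sub_cancel_left,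
    map_smul_eq_mul, Real.norm_of_nonneg ht.le] at hpow
  have hPx : q (P i x) ^ r ≤ 1 :=
    Real.rpow_le_one (apply_nonneg q _) ((hq i x).trans hx) (by linarith)
  have hy2 : q (y - P i y) ≤ 2 := by linarith [map_sub_le_add q y (P i y), hq i y]
  have hty : (t * q (y - P i y)) ^ r ≤ 2 ^ r * t ^ (r - 1) * t := by
    rw [mul_assoc, ← Real.rpow_add_one ht.ne', sub_add_cancel, mul_comm,
      ← Real.mul_rpow zero_le_two ht.le]
    exact Real.rpow_le_rpow (by positivity) (mul_le_mul_of_nonneg_right hy2 ht.le) (by linarith)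
  have h1 : 1 ≤ 1 + δ * t := by nlinarith
  refine (Real.rpow_le_rpow_iff (apply_nonneg q _) (zero_le_one.trans h1)
    (zero_lt_one.trans hr)).1 ?_
  calc q (P i x + t • (y - P i y)) ^ r
      ≤ q (P i x) ^ r + C * (t * q (y - P i y)) ^ r := hpow
    _ ≤ 1 + C * (2 ^ r * t ^ (r - 1) * t) := by gcongr
    _ ≤ 1 + δ * t := by nlinarith
    _ ≤ (1 + δ * t) ^ r := Real.self_le_rpow_of_one_le h1 hr.le

theorem UniformlyConvexAlong.of_rpow {q : Seminorm ℝ V} {P : ι → V → V} {s c : ℝ} (hs : 1 < s)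
    (hc : 0 < c) (h : ∀ i x, q (P i x) ^ s + (c * q (x - P i x)) ^ s ≤ q x ^ s) :
    UniformlyConvexAlong q P := by
  intro δ hδ
  have hconj : s.HolderConjugate s.conjExponent := .conjExponent hs
  set s' := s.conjExponent
  obtain ⟨t, ht, htδ⟩ := exists_pos_mul_rpow_le (c⁻¹ ^ s') (sub_pos.2 hconj.symm.lt) hδ
  refine ⟨t, ht, fun i x hx => ?_⟩
  set a := q (P i x)
  set b := c * q (x - P i x) with hb
  have ha0 : 0 ≤ a := apply_nonneg q _
  have hb0 : 0 ≤ b := by positivity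
  have hyoung_a : a ≤ a ^ s / s + s'⁻¹ := by
    simpa using Real.young_inequality_of_nonneg ha0 zero_le_one hconj
  have hyoung_b := Real.young_inequality_of_nonneg hb0 (by positivity : 0 ≤ c⁻¹ * t) hconj
  have hsum : a ^ s / s + b ^ s / s ≤ s⁻¹ := by
    rw [← add_div, div_le_iff₀ (by linarith), inv_mul_cancel₀ (by linarith)]
    exact (h i x).trans (Real.rpow_le_one (apply_nonneg q x) hx (by linarith))
  have hsmall : (c⁻¹ * t) ^ s' / s' ≤ δ * t :=
    calc (c⁻¹ * t) ^ s' / s' ≤ (c⁻¹ * t) ^ s' := div_le_self (by positivity) hconj.symm.lt.le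
      _ = c⁻¹ ^ s' * t ^ (s' - 1) * t := by
        rw [mul_assoc, ← Real.rpow_add_one ht.ne', sub_add_cancel,
          Real.mul_rpow (inv_nonneg.2 hc.le) ht.le]
      _ ≤ δ * t := by gcongr
  calc a + t * q (x - P i x) = a + b * (c⁻¹ * t) := by rw [hb]; field_simp
    _ ≤ 1 + δ * t := by linarith [hconj.inv_add_inv_eq_one]

theorem UniformlySmoothAlong.comp {W : Type*} [AddCommGroup W] [Module ℝ W] {q : Seminorm ℝ V}
    {P : ι → V → V} (hP : UniformlySmoothAlong q P) (A : W →ₗ[ℝ] V) {R : ι → W → W}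
    (hR : ∀ i x, A (R i x) = P i (A x)) : UniformlySmoothAlong (q.comp A) R := by
  intro δ hδ
  obtain ⟨t, ht, h⟩ := hP δ hδ
  refine ⟨t, ht, fun i x y hx hy => ?_⟩
  rw [Seminorm.comp_apply, map_add, map_smul, map_sub, hR, hR]
  exact h i _ _ hx hy

/-- A functional of norm `N` that is almost attained at `x ≈ P i x` cannot be large at `y - P i y`:
otherwise it would exceed `N` at a small perturbation of `x`. -/
theorem UniformlySmoothAlong.eventually_le {q : Seminorm ℝ V} {P : ι → V →ₗ[ℝ] V}
    (hP : UniformlySmoothAlong q fun i => P i) {l : Filter ι}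
    (hl : ∀ x, Filter.Tendsto (fun i => q (x - P i x)) l (𝓝 0)) {φ : V →ₗ[ℝ] ℝ} {u : ℝ}
    (hφ : ∀ x, φ x ≤ u * q x) {ε : ℝ} (hε : 0 < ε) :
    ∀ᶠ i in l, ∀ x, φ (x - P i x) ≤ ε * q x := by
  set N := sSup (φ '' {x | q x ≤ 1})
  have hne : (φ '' {x | q x ≤ 1}).Nonempty := ⟨φ 0, 0, by simp, rfl⟩
  have hbdd : BddAbove (φ '' {x | q x ≤ 1}) := by
    refine ⟨|u|, ?_⟩
    rintro _ ⟨x, hx, rfl⟩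
    calc φ x ≤ u * q x := hφ x
      _ ≤ |u| * 1 := mul_le_mul (le_abs_self u) hx (apply_nonneg q x) (abs_nonneg u)
      _ = |u| := mul_one _
  have hφN : ∀ x, φ x ≤ N * q x := le_mul_of_unitBall fun x hx => le_csSup hbdd ⟨x, hx, rfl⟩
  have hN0 : 0 ≤ N := le_csSup hbdd ⟨0, by simp, map_zero φ⟩
  obtain ⟨t, ht, hsmooth⟩ := hP (ε / (2 * (N + 1))) (by positivity)
  obtain ⟨_, ⟨x, hx, rfl⟩, hφx⟩ := exists_lt_of_lt_csSup hne
    (show N - ε * t / 4 < N by linarith [mul_pos hε ht])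
  have hnear : ∀ᶠ i in l, N * q (x - P i x) < ε * t / 4 := by
    have := (hl x).const_mul N
    rw [mul_zero] at this
    exact this.eventually_lt_const (by positivity)
  filter_upwards [hnear] with i hi
  refine le_mul_of_unitBall (φ := φ ∘ₗ (LinearMap.id - P i)) fun y hy => ?_
  have hPx : N - ε * t / 2 ≤ φ (P i x) := by
    have := (hφN (x - P i x)).trans hi.le
    rw [map_sub] at this
    linarith
  have hN1 : N * (ε / (2 * (N + 1))) ≤ ε / 2 := by
    rw [mul_div_assoc', div_le_div_iff₀ (by positivity) two_pos]
    nlinarith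
  have hpert : φ (P i x) + t * φ (y - P i y) ≤ N * (1 + ε / (2 * (N + 1)) * t) := by
    rw [← smul_eq_mul, ← map_smul, ← map_add]
    exact (hφN _).trans (mul_le_mul_of_nonneg_left (hsmooth i x y hx hy) hN0)
  refine le_of_mul_le_mul_left (a := t) ?_ ht
  change t * φ (y - P i y) ≤ t * ε
  nlinarith

theorem UniformlySmoothAlong.eventually_abs_le_of_mem {q : Seminorm ℝ V} {P : ι → V →ₗ[ℝ] V}
    (hP : UniformlySmoothAlong q fun i => P i) {F : Submodule ℝ V}
    (hF : ∀ i, ∀ x ∈ F, P i x ∈ F) {l : Filter ι}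
    (hl : ∀ x ∈ F, Filter.Tendsto (fun i => q (x - P i x)) l (𝓝 0)) {φ : V →ₗ[ℝ] ℝ}
    (hφ : ∀ x, φ x ≤ q x) {ε : ℝ} (hε : 0 < ε) :
    ∀ᶠ i in l, ∀ x ∈ F, |φ (x - P i x)| ≤ ε * q x := by
  have hsmooth : UniformlySmoothAlong (q.comp F.subtype) fun i => (P i).restrict (hF i) :=
    hP.comp F.subtype fun _ _ => rfl
  filter_upwards [hsmooth.eventually_le (φ := φ ∘ₗ F.subtype) (u := 1) (fun x => hl x x.2)
    (fun x => (hφ x).trans_eq (one_mul _).symm) hε] with i hi x hx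
  refine abs_le'.2 ⟨hi ⟨x, hx⟩, ?_⟩
  have hneg : φ (-x - P i (-x)) ≤ ε * q (-x) := hi (-⟨x, hx⟩)
  rwa [map_neg_eq_map q, map_neg (P i), ← neg_sub', map_neg φ] at hneg

theorem norm_add_smul_add_le {G : Type*} [NormedAddCommGroup G] [NormedSpace ℝ G] {x y z : G}
    {t₁ t₂ δ : ℝ} (ht₁ : 0 < t₁) (ht₂ : 0 < t₂) (hy : ‖x + t₁ • y‖ ≤ 1 + δ * t₁)
    (hz : ‖x + t₂ • z‖ ≤ 1 + δ * t₂) :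
    ‖x + (t₁ * t₂ / (t₁ + t₂)) • (y + z)‖ ≤ 1 + 2 * δ * (t₁ * t₂ / (t₁ + t₂)) := by
  have ht : 0 < t₁ + t₂ := add_pos ht₁ ht₂
  have hsplit : (t₁ + t₂) • (x + (t₁ * t₂ / (t₁ + t₂)) • (y + z)) =
      t₂ • (x + t₁ • y) + t₁ • (x + t₂ • z) := by
    rw [smul_add, smul_smul, mul_div_cancel₀ _ ht.ne']
    module
  refine le_of_mul_le_mul_left ?_ ht
  calc (t₁ + t₂) * ‖x + (t₁ * t₂ / (t₁ + t₂)) • (y + z)‖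
      = ‖t₂ • (x + t₁ • y) + t₁ • (x + t₂ • z)‖ := by
        rw [← hsplit, norm_smul, Real.norm_of_nonneg ht.le]
    _ ≤ t₂ * ‖x + t₁ • y‖ + t₁ * ‖x + t₂ • z‖ :=
        (norm_add_le _ _).trans_eq (by
          rw [norm_smul, norm_smul, Real.norm_of_nonneg ht₁.le, Real.norm_of_nonneg ht₂.le])
    _ ≤ t₂ * (1 + δ * t₁) + t₁ * (1 + δ * t₂) := by gcongr
    _ = (t₁ + t₂) * (1 + 2 * δ * (t₁ * t₂ / (t₁ + t₂))) := by
        field_simp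
        ring

variable {E F : Type*} [NormedAddCommGroup E] [NormedSpace ℂ E] [NormedAddCommGroup F]
  [NormedSpace ℂ F]

theorem UniformlySmoothAlong.conj {P : ι → E →L[ℂ] E} {R : ι → F →L[ℂ] F}
    (hR : UniformlySmoothAlong (normSeminorm ℝ F) fun i => R i)
    (hP : UniformlyConvexAlong (normSeminorm ℝ E) fun i => P i)
    (hR1 : ∀ i, ‖R i‖ ≤ 1) (hP1 : ∀ i, ‖P i‖ ≤ 1) :
    UniformlySmoothAlong (normSeminorm ℝ (E →L[ℂ] F)) fun i X => R i ∘L X ∘L P i := by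
  simp only [UniformlySmoothAlong, UniformlyConvexAlong, coe_normSeminorm] at *
  intro δ hδ
  obtain ⟨t₁, ht₁, hsmooth⟩ := hR (δ / 2) (half_pos hδ)
  obtain ⟨t₂, ht₂, hconvex⟩ := hP (δ / 2) (half_pos hδ)
  refine ⟨t₁ * t₂ / (t₁ + t₂), by positivity, fun i X Y hX hY => ?_⟩
  refine ContinuousLinearMap.opNorm_le_of_unit_norm (by positivity) fun e he => ?_
  have hPe : ‖P i e‖ ≤ 1 := he ▸ (P i).le_of_opNorm_le (hP1 i) e |>.trans (by simp)
  have hleft : ‖R i (X (P i e)) + t₁ • (Y e - R i (Y e))‖ ≤ 1 + δ / 2 * t₁ :=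
    hsmooth i _ _ ((X.le_of_opNorm_le hX _).trans (by simpa using hPe))
      ((Y.le_of_opNorm_le hY _).trans (by simp [he]))
  have hcomp : ∀ {Z : E →L[ℂ] F}, ‖Z‖ ≤ 1 → ‖R i ∘L Z‖ ≤ 1 := fun {Z} hZ =>
    ((R i).opNorm_comp_le Z).trans (mul_le_one₀ (hR1 i) (norm_nonneg _) hZ)
  have hright : ‖R i (X (P i e)) + t₂ • R i (Y (e - P i e))‖ ≤ 1 + δ / 2 * t₂ := by
    have hRX : ‖R i (X (P i e))‖ ≤ ‖P i e‖ :=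
      ((R i ∘L X).le_of_opNorm_le (hcomp hX) _).trans_eq (one_mul _)
    have hRY : ‖R i (Y (e - P i e))‖ ≤ ‖e - P i e‖ :=
      ((R i ∘L Y).le_of_opNorm_le (hcomp hY) _).trans_eq (one_mul _)
    calc ‖R i (X (P i e)) + t₂ • R i (Y (e - P i e))‖
        ≤ ‖R i (X (P i e))‖ + t₂ * ‖R i (Y (e - P i e))‖ :=
          (norm_add_le _ _).trans_eq (by rw [norm_smul, Real.norm_of_nonneg ht₂.le])
      _ ≤ ‖P i e‖ + t₂ * ‖e - P i e‖ := by gcongr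
      _ ≤ 1 + δ / 2 * t₂ := hconvex i e he.le
  -- `Y - R Y P = (Y - R Y) + R Y (1 - P)`, and each part is paired with a share of `R X P`.
  have hparts : (R i ∘L X ∘L P i + (t₁ * t₂ / (t₁ + t₂)) • (Y - R i ∘L Y ∘L P i)) e =
      R i (X (P i e)) + (t₁ * t₂ / (t₁ + t₂)) • (Y e - R i (Y e) + R i (Y (e - P i e))) := by
    simp only [add_apply, sub_apply, smul_apply, ContinuousLinearMap.comp_apply, map_sub,
      sub_add_sub_cancel]
  rw [hparts]
  exact (norm_add_smul_add_le ht₁ ht₂ hleft hright).trans_eq (by ring)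

end Smoothness

section HahnBanach

variable {V : Type*} [AddCommGroup V] [Module ℝ V] [TopologicalSpace V] [IsTopologicalAddGroup V]
  [ContinuousSMul ℝ V] [LocallyConvexSpace ℝ V]

theorem mem_closure_unitBall_of_forall_extension {q : Seminorm ℝ V} {F : Submodule ℝ V} {x : V}
    (hx : x ∈ closure (F : Set V))
    (hext : ∀ φ : V →ₗ[ℝ] ℝ, (∀ y, φ y ≤ q y) →
      ∃ g : V →L[ℝ] ℝ, (∀ y ∈ F, g y = φ y) ∧ g x ≤ 1) :
    x ∈ closure {y | y ∈ F ∧ q y ≤ 1} := by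
  by_contra hxB
  have hconv : Convex ℝ {y | y ∈ F ∧ q y ≤ 1} := by
    convert F.convex.inter (q.convex_closedBall 0 1)
    ext
    simp
  obtain ⟨f, u, hfB, hfx⟩ :=
    geometric_hahn_banach_closed_point hconv.closure isClosed_closure hxB
  have hfB' : ∀ y : F, q y ≤ 1 → f y ≤ u := fun y hy => (hfB y (subset_closure ⟨y.2, hy⟩)).le
  have hu : 0 < u := by
    simpa using hfB 0 (subset_closure ⟨F.zero_mem, by simp⟩)
  have hfF : ∀ y : F, f y ≤ u * q y :=
    le_mul_of_unitBall (q := q.comp F.subtype) (φ := f.toLinearMap ∘ₗ F.subtype) hfB'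
  obtain ⟨φ, hφF, hφ⟩ := exists_extension_of_le_sublinear ⟨F, u⁻¹ • f.toLinearMap ∘ₗ F.subtype⟩ q
    (fun c hc y => by rw [map_smul_eq_mul, Real.norm_of_nonneg hc.le]) (map_add_le_add q)
    (fun y => (inv_mul_le_iff₀ hu).2 (hfF y))
  obtain ⟨g, hgF, hgx⟩ := hext φ hφ
  have hfg : f x = u * g x := by
    refine closure_minimal (t := {y | f y = u * g y}) (fun y hy => ?_)
      (isClosed_eq f.continuous (g.continuous.const_smul u)) hx
    have := (hgF y hy).trans (hφF ⟨y, hy⟩)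
    simp [this, hu.ne']
  nlinarith

end HahnBanach

section Bessel

theorem exists_contraction_eq_smul {E F : Type*} [NormedAddCommGroup E] [NormedSpace ℂ E]
    [NormedAddCommGroup F] [NormedSpace ℂ F] (A : E →L[ℂ] F) :
    ∃ C : E →L[ℂ] F, ‖C‖ ≤ 1 ∧ A = (‖A‖ : ℂ) • C := by
  rcases eq_or_ne A 0 with rfl | hA
  · exact ⟨0, by simp, by simp⟩
  · have hA' : (‖A‖ : ℂ) ≠ 0 := by simpa using hA
    exact ⟨(‖A‖ : ℂ)⁻¹ • A, by rw [norm_smul]; simp [hA], by rw [smul_inv_smul₀ hA']⟩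

variable {H : Type*} [NormedAddCommGroup H] [InnerProductSpace ℂ H]

/-- A family of vectors that satisfies Bessel's inequality. Unlike orthonormal families, these are
stable under contractions. -/
def IsBessel {κ : Type*} (e : κ → H) : Prop :=
  ∀ x, ∑' i, ‖⟪e i, x⟫_ℂ‖ₑ ^ 2 ≤ ‖x‖ₑ ^ 2

theorem isBessel_of_orthonormal {κ : Type*} {e : κ → H} (he : Orthonormal ℂ e) : IsBessel e :=
  bessel he

theorem IsBessel.enorm_sq_le_one {κ : Type*} {e : κ → H} (he : IsBessel e) (i : κ) :
    ‖e i‖ₑ ^ 2 ≤ 1 := by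
  have hsq : ‖e i‖ₑ ^ 2 * ‖e i‖ₑ ^ 2 ≤ ‖e i‖ₑ ^ 2 := by
    have hi : ‖⟪e i, e i⟫_ℂ‖ₑ = ‖e i‖ₑ ^ 2 := by
      rw [← ofReal_norm, inner_self_eq_norm_sq_to_K]
      simp [ENNReal.ofReal_pow]
    rw [← sq, ← hi]
    exact (ENNReal.le_tsum (f := fun j => ‖⟪e j, e i⟫_ℂ‖ₑ ^ 2) i).trans
      ((he (e i)).trans_eq hi.symm)
  by_contra! hlt
  have h0 : ‖e i‖ₑ ^ 2 ≠ 0 := (zero_lt_one.trans hlt).ne'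
  exact hsq.not_gt (by simpa using ENNReal.mul_lt_mul_right h0 (by simp) hlt)

variable [CompleteSpace H]

theorem IsBessel.map {κ K : Type*} [NormedAddCommGroup K] [InnerProductSpace ℂ K]
    [CompleteSpace K] {e : κ → H} (he : IsBessel e) {B : H →L[ℂ] K} (hB : ‖B‖ ≤ 1) :
    IsBessel fun i => B (e i) := by
  intro x
  simp_rw [← B.adjoint_inner_right]
  refine (he _).trans ?_
  gcongr
  rw [enorm_le_iff_norm_le]
  exact (B.adjoint.le_of_opNorm_le (by rwa [LinearIsometryEquiv.norm_map]) x).trans_eq (one_mul _)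

/-- The singular value decomposition of `A`, read on one matrix coefficient. -/
theorem enorm_inner_apply_le_tsum {w : Set H} {A : H →L[ℂ] H} (g : HilbertBasis w ℂ H) {l : w → ℝ}
    (hl : ∀ k, 0 ≤ l k) (h : ∀ k, (star A * A) (g k) = (l k ^ 2 : ℝ) • g k) (e f : H) :
    ‖⟪f, A e⟫_ℂ‖ₑ ≤ ∑' k : {k // l k ≠ 0},
      ‖⟪g k, e⟫_ℂ‖ₑ * ‖⟪(l k)⁻¹ • A (g k), f⟫_ℂ‖ₑ * ENNReal.ofReal (l k) := by
  have hexp : HasSum (fun k => ⟪g k, e⟫_ℂ * ⟪f, A (g k)⟫_ℂ) ⟪f, A e⟫_ℂ := by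
    have := ((g.hasSum_repr e).mapL A).mapL (innerSL ℂ f)
    simpa [HilbertBasis.repr_apply_apply, inner_smul_right] using this
  have hsupp : HasSum (fun k : {k // l k ≠ 0} => ⟪g k, e⟫_ℂ * ⟪f, A (g k)⟫_ℂ) ⟪f, A e⟫_ℂ := by
    refine (hasSum_subtype_iff_of_support_subset (s := {k | l k ≠ 0}) fun k hk h0 => ?_).2 hexp
    simp [apply_eq_zero_of_singular g h h0] at hk
  rw [← hsupp.tsum_eq]
  refine enorm_tsum_le_tsum_enorm.trans (tsum_congr fun k => ?_).le
  have hscale : ‖⟪f, A (g k)⟫_ℂ‖ₑ = ‖⟪(l k)⁻¹ • A (g k), f⟫_ℂ‖ₑ * ENNReal.ofReal (l k) := by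
    rw [inner_smul_left_eq_smul, enorm_smul, enorm_inner_symm, mul_comm, ← mul_assoc,
      ← Real.enorm_of_nonneg (hl k), ← enorm_mul, mul_inv_cancel₀ k.2, enorm_one, one_mul]
  rw [enorm_mul, hscale, mul_assoc]

theorem tsum_le_of_isBessel {p : ℝ} (hp : 1 ≤ p) {A : H →L[ℂ] H} (hA : IsCompactOperator A)
    {κ : Type*} {e f : κ → H} (he : IsBessel e) (hf : IsBessel f) :
    ∑' i, ‖⟪f i, A (e i)⟫_ℂ‖ₑ ^ p ≤ eSchattenNorm p A ^ p := by
  obtain ⟨w, g, l, hl, h⟩ := exists_singular_basis hA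
  have hp0 : 0 < p := by linarith
  rw [eSchattenNorm_of_eigen hp g hl h, one_div, ENNReal.rpow_inv_rpow hp0.ne']
  have hg : Orthonormal ℂ fun k : {k // l k ≠ 0} => g k :=
    g.orthonormal.comp _ Subtype.val_injective
  have hAg := orthonormal_singular g h
  let W : κ → {k // l k ≠ 0} → ℝ≥0∞ :=
    fun i k => ‖⟪g k, e i⟫_ℂ‖ₑ * ‖⟪(l k)⁻¹ • A (g k), f i⟫_ℂ‖ₑ
  have hrow : ∀ i, ∑' k, W i k ≤ 1 := fun i =>
    tsum_mul_le_one ((bessel hg (e i)).trans (he.enorm_sq_le_one i))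
      ((bessel hAg (f i)).trans (hf.enorm_sq_le_one i))
  have hcol : ∀ k, ∑' i, W i k ≤ 1 := by
    have hbound {κ' : Type _} {v : κ' → H} {b : κ → H} (hv : Orthonormal ℂ v) (hb : IsBessel b)
        (k : κ') : ∑' i, ‖⟪v k, b i⟫_ℂ‖ₑ ^ 2 ≤ 1 := by
      simp_rw [fun i => enorm_inner_symm (v k) (b i)]
      exact (hb (v k)).trans ((isBessel_of_orthonormal hv).enorm_sq_le_one k)
    exact fun k => tsum_mul_le_one (hbound hg he k) (hbound hAg hf k)
  calc ∑' i, ‖⟪f i, A (e i)⟫_ℂ‖ₑ ^ p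
      ≤ ∑' i, (∑' k, W i k * ENNReal.ofReal (l k)) ^ p :=
        ENNReal.tsum_le_tsum fun i =>
          ENNReal.rpow_le_rpow (enorm_inner_apply_le_tsum g hl h _ _) hp0.le
    _ ≤ ∑' k : {k // l k ≠ 0}, ENNReal.ofReal (l k) ^ p :=
        doubly_substochastic hp W _ hrow hcol
    _ ≤ ∑' k, ENNReal.ofReal (l k) ^ p :=
        ENNReal.tsum_comp_le_tsum_of_injective Subtype.val_injective
          fun k => ENNReal.ofReal (l k) ^ p

variable {K : Type*} [NormedAddCommGroup K] [InnerProductSpace ℂ K] [CompleteSpace K]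

theorem eSchattenNorm_sandwich_le_of_contraction {p : ℝ} (hp : 1 ≤ p) {z : H →L[ℂ] H}
    (hz : IsCompactOperator z) {A : H →L[ℂ] K} {B : K →L[ℂ] H} (hA : ‖A‖ ≤ 1) (hB : ‖B‖ ≤ 1) :
    eSchattenNorm p (A ∘L z ∘L B) ≤ eSchattenNorm p z := by
  have hp0 : 0 < p := by linarith
  refine eSchattenNorm_le hp ((hz.comp_clm B).clm_comp A) fun n e f he hf => ?_
  rw [one_div, ENNReal.rpow_inv_le_iff hp0]
  have := tsum_le_of_isBessel hp hz ((isBessel_of_orthonormal he).map hB)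
    ((isBessel_of_orthonormal hf).map (B := A.adjoint) (by rwa [LinearIsometryEquiv.norm_map]))
  rw [tsum_fintype] at this
  simpa only [ContinuousLinearMap.adjoint_inner_left, ContinuousLinearMap.comp_apply] using this

theorem eSchattenNorm_sandwich_le {p : ℝ} (hp : 1 ≤ p) {z : H →L[ℂ] H} (hz : IsCompactOperator z)
    (A : H →L[ℂ] K) (B : K →L[ℂ] H) :
    eSchattenNorm p (A ∘L z ∘L B) ≤ ‖A‖ₑ * ‖B‖ₑ * eSchattenNorm p z := by
  obtain ⟨C, hC, hAC⟩ := exists_contraction_eq_smul A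
  obtain ⟨D, hD, hBD⟩ := exists_contraction_eq_smul B
  have hscale : A ∘L z ∘L B = ((‖A‖ : ℂ) * (‖B‖ : ℂ)) • (C ∘L z ∘L D) := by
    conv_lhs => rw [hAC, hBD]
    simp only [ContinuousLinearMap.smul_comp, ContinuousLinearMap.comp_smul, smul_smul,
      mul_comm]
  have henorm (r : ℝ) : ‖(r : ℂ)‖ₑ = ‖r‖ₑ := by rw [← ofReal_norm, Complex.norm_real, ofReal_norm]
  calc eSchattenNorm p (A ∘L z ∘L B)
      ≤ ‖(‖A‖ : ℂ) * (‖B‖ : ℂ)‖ₑ * eSchattenNorm p (C ∘L z ∘L D) := by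
        rw [hscale]
        exact eSchattenNorm_smul_le hp ((hz.comp_clm D).clm_comp C) _
    _ = ‖A‖ₑ * ‖B‖ₑ * eSchattenNorm p (C ∘L z ∘L D) := by
        rw [enorm_mul, henorm, henorm, enorm_norm, enorm_norm]
    _ ≤ ‖A‖ₑ * ‖B‖ₑ * eSchattenNorm p z := by
        gcongr
        exact eSchattenNorm_sandwich_le_of_contraction hp hz hC hD

theorem isCompactOperator_star {z : H →L[ℂ] H} (hz : IsCompactOperator z) :
    IsCompactOperator (star z : H →L[ℂ] H) := by
  apply compact_of_star_mul_self
  rw [star_star]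
  exact hz.comp_clm (star z)

theorem eSchattenNorm_le_star {p : ℝ} (hp : 1 ≤ p) {z : H →L[ℂ] H}
    (hz : IsCompactOperator z) : eSchattenNorm p z ≤ eSchattenNorm p (star z) := by
  have hp0 : 0 < p := by linarith
  refine eSchattenNorm_le hp hz fun n e f he hf => ?_
  rw [one_div, ENNReal.rpow_inv_le_iff hp0]
  have := tsum_le_of_isBessel hp (isCompactOperator_star hz)
    (isBessel_of_orthonormal hf) (isBessel_of_orthonormal he)
  rw [tsum_fintype] at this
  refine le_of_eq_of_le (Finset.sum_congr rfl fun i _ => ?_) this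
  rw [ContinuousLinearMap.star_eq_adjoint, ContinuousLinearMap.adjoint_inner_right,
    enorm_inner_symm]

theorem eSchattenNorm_star {p : ℝ} (hp : 1 ≤ p) {z : H →L[ℂ] H} (hz : IsCompactOperator z) :
    eSchattenNorm p (star z) = eSchattenNorm p z :=
  le_antisymm (by simpa using eSchattenNorm_le_star hp (isCompactOperator_star hz))
    (eSchattenNorm_le_star hp hz)

end Bessel

section Sandwich

variable {p : ℝ} [Fact (1 ≤ p)]
variable {H : Type*} [NormedAddCommGroup H] [InnerProductSpace ℂ H] [CompleteSpace H]
variable {K : Type*} [NormedAddCommGroup K] [InnerProductSpace ℂ K] [CompleteSpace K]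

namespace SchattenClass

/-- The operator `z ↦ A z B` from `S^p(H)` to `S^p(K)`. -/
noncomputable def sandwich (A : H →L[ℂ] K) (B : K →L[ℂ] H) :
    SchattenClass p H →L[ℂ] SchattenClass p K :=
  LinearMap.mkContinuous
    { toFun := fun z => mk (A ∘L z.toOp ∘L B)
        ((eSchattenNorm_sandwich_le Fact.out z.compact A B).trans_lt
          (ENNReal.mul_lt_top (ENNReal.mul_lt_top enorm_lt_top enorm_lt_top) z.lt_top))
      map_add' := fun x y => by
        apply toOp_injective
        ext v
        change A (toOp (x + y) (B v)) = A (toOp x (B v)) + A (toOp y (B v))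
        rw [map_add, add_apply, map_add]
      map_smul' := fun c x => by
        apply toOp_injective
        ext v
        change A (toOp (c • x) (B v)) = c • A (toOp x (B v))
        rw [map_smul, smul_apply, map_smul] }
    (‖A‖ * ‖B‖) (fun z => by
      rw [norm_def, norm_def, ← toReal_enorm A, ← toReal_enorm B, ← ENNReal.toReal_mul,
        ← ENNReal.toReal_mul]
      exact ENNReal.toReal_mono (ENNReal.mul_lt_top (ENNReal.mul_lt_top enorm_lt_top enorm_lt_top)
        z.lt_top).ne (eSchattenNorm_sandwich_le Fact.out z.compact A B))

theorem toOp_sandwich (A : H →L[ℂ] K) (B : K →L[ℂ] H) (z : SchattenClass p H) :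
    (sandwich A B z).toOp = A ∘L z.toOp ∘L B := rfl

theorem norm_sandwich_le (A : H →L[ℂ] K) (B : K →L[ℂ] H) :
    ‖(sandwich A B : SchattenClass p H →L[ℂ] SchattenClass p K)‖ ≤ ‖A‖ * ‖B‖ :=
  LinearMap.mkContinuous_norm_le _ (by positivity) _

theorem norm_sandwich_apply_le {A : H →L[ℂ] K} {B : K →L[ℂ] H} (hA : ‖A‖ ≤ 1) (hB : ‖B‖ ≤ 1)
    (z : SchattenClass p H) : ‖sandwich A B z‖ ≤ ‖z‖ :=
  ((sandwich A B).le_opNorm z).trans (mul_le_of_le_one_left (norm_nonneg _)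
    ((norm_sandwich_le A B).trans (mul_le_one₀ hA (norm_nonneg _) hB)))

theorem sandwich_rankOne (A : H →L[ℂ] K) (B : K →L[ℂ] H) (x y : H) :
    sandwich A B (rankOne x y : SchattenClass p H) = rankOne (A x) (B.adjoint y) := by
  apply toOp_injective
  rw [toOp_sandwich]
  simp only [rankOne, toOp_mk]
  ext v
  simp [InnerProductSpace.rankOne_apply, ContinuousLinearMap.adjoint_inner_left]

end SchattenClass

end Sandwich

section PowerSums

theorem rpow_eq_sq_rpow_half (a : ℝ≥0∞) (p : ℝ) : a ^ p = (a ^ 2) ^ (p / 2) := by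
  rw [← ENNReal.rpow_two, ← ENNReal.rpow_mul, mul_div_cancel₀ p two_ne_zero]

theorem enorm_sq_eq_ofReal {E : Type*} [SeminormedAddCommGroup E] (x : E) :
    ‖x‖ₑ ^ 2 = ENNReal.ofReal (‖x‖ ^ 2) := by
  rw [ENNReal.ofReal_pow (norm_nonneg x), ofReal_norm]

theorem jensen_tsum_concave {ι : Type*} {r : ℝ} (hr0 : 0 < r) (hr : r ≤ 1) (w l : ι → ℝ≥0∞)
    (hw : ∑' k, w k ≤ 1) : ∑' k, w k * l k ^ r ≤ (∑' k, w k * l k) ^ r := by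
  have h := jensen_tsum (one_le_inv_iff₀.2 ⟨hr0, hr⟩) w (fun k => l k ^ r) hw
  simp_rw [ENNReal.rpow_rpow_inv hr0.ne'] at h
  rwa [ENNReal.rpow_inv_le_iff hr0] at h

theorem minkowski_tsum {ι : Type*} {σ : ℝ} (hσ : 1 ≤ σ) (a b : ι → ℝ≥0∞) :
    (∑' i, (a i + b i) ^ σ) ^ σ⁻¹ ≤ (∑' i, a i ^ σ) ^ σ⁻¹ + (∑' i, b i ^ σ) ^ σ⁻¹ := by
  let : MeasurableSpace ι := ⊤
  simpa only [MeasureTheory.lintegral_count, one_div, Pi.add_apply] using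
    ENNReal.lintegral_Lp_add_le (μ := .count) (f := a) (g := b) measurable_from_top.aemeasurable
      measurable_from_top.aemeasurable hσ

theorem minkowski_add_add {σ : ℝ} (hσ : 1 ≤ σ) (a b a' b' : ℝ≥0∞) :
    ((a + a') ^ σ + (b + b') ^ σ) ^ σ⁻¹ ≤ (a ^ σ + b ^ σ) ^ σ⁻¹ + (a' ^ σ + b' ^ σ) ^ σ⁻¹ := by
  simpa [tsum_fintype, Fin.sum_univ_two] using minkowski_tsum hσ ![a, b] ![a', b']

theorem minkowski_tsum_add_tsum {ι : Type*} {σ : ℝ} (hσ : 1 ≤ σ) (a b : ι → ℝ≥0∞) :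
    ((∑' i, a i) ^ σ + (∑' i, b i) ^ σ) ^ σ⁻¹ ≤ ∑' i, (a i ^ σ + b i ^ σ) ^ σ⁻¹ := by
  classical
  have hfin (s : Finset ι) : ((∑ i ∈ s, a i) ^ σ + (∑ i ∈ s, b i) ^ σ) ^ σ⁻¹ ≤
      ∑ i ∈ s, (a i ^ σ + b i ^ σ) ^ σ⁻¹ := by
    induction s using Finset.induction_on with
    | empty => simp [zero_lt_one.trans_le hσ]
    | insert i s hi ih =>
      rw [Finset.sum_insert hi, Finset.sum_insert hi, Finset.sum_insert hi]
      exact (minkowski_add_add hσ _ _ _ _).trans (by gcongr)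
  have htsum (c : ι → ℝ≥0∞) :
      Filter.Tendsto (fun s : Finset ι => ∑ i ∈ s, c i) Filter.atTop (𝓝 (∑' i, c i)) :=
    ENNReal.summable.hasSum
  exact le_of_tendsto
    ((((htsum a).ennrpow_const σ).add ((htsum b).ennrpow_const σ)).ennrpow_const σ⁻¹)
    (.of_forall fun s => (hfin s).trans (ENNReal.sum_le_tsum s))

end PowerSums

section SingularBasis

variable {H : Type*} [NormedAddCommGroup H] [InnerProductSpace ℂ H] [CompleteSpace H]
variable {ι : Type*} {A : H →L[ℂ] H} (g : HilbertBasis ι ℂ H) {l : ι → ℝ}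

theorem enorm_sq_apply_eq_tsum (h : ∀ i, (star A * A) (g i) = (l i ^ 2) • g i) (x : H) :
    ‖A x‖ₑ ^ 2 = ∑' k, ‖⟪g k, x⟫_ℂ‖ₑ ^ 2 * ENNReal.ofReal (l k ^ 2) := by
  have hterm (k) : ⟪x, g k⟫_ℂ * ⟪g k, (star A * A) x⟫_ℂ =
      ((‖⟪g k, x⟫_ℂ‖ ^ 2 * l k ^ 2 : ℝ) : ℂ) := by
    rw [← ContinuousLinearMap.adjoint_inner_left, ← ContinuousLinearMap.star_eq_adjoint, star_mul,
      star_star, h, inner_smul_left_eq_smul, Complex.real_smul, mul_left_comm,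
      ← inner_conj_symm x, RCLike.conj_mul]
    push_cast
    exact mul_comm _ _
  have hsq : ⟪x, (star A * A) x⟫_ℂ = ((‖A x‖ ^ 2 : ℝ) : ℂ) := by
    rw [mul_apply_eq_comp, ContinuousLinearMap.star_eq_adjoint,
      ContinuousLinearMap.adjoint_inner_right, inner_self_eq_norm_sq_to_K]
    push_cast
    rfl
  have hsum : HasSum (fun k => ‖⟪g k, x⟫_ℂ‖ ^ 2 * l k ^ 2) (‖A x‖ ^ 2) := by
    rw [← Complex.hasSum_ofReal, ← hsq]
    simpa only [hterm] using g.hasSum_inner_mul_inner x ((star A * A) x)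
  simp_rw [enorm_sq_eq_ofReal, ← ENNReal.ofReal_mul (sq_nonneg ‖_‖)]
  rw [← ENNReal.ofReal_tsum_of_nonneg (fun _ => by positivity) hsum.summable, hsum.tsum_eq]

theorem enorm_apply_singular (hl : ∀ i, 0 ≤ l i)
    (h : ∀ i, (star A * A) (g i) = (l i ^ 2) • g i) (i : ι) :
    ‖A (g i)‖ₑ = ENNReal.ofReal (l i) := by
  have hinner := inner_singular g h i i
  rw [inner_self_eq_norm_sq_to_K, inner_self_eq_norm_sq_to_K, g.orthonormal.1] at hinner
  have hsq : ‖A (g i)‖ ^ 2 = l i ^ 2 := by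
    simp only [Complex.coe_algebraMap, Complex.ofReal_one, one_pow, Complex.real_smul,
      mul_one] at hinner
    exact_mod_cast hinner
  rw [← ofReal_norm, (pow_left_inj₀ (norm_nonneg _) (hl i) two_ne_zero).1 hsq]

theorem eSchattenNorm_rpow_of_singular {p : ℝ} (hp : 1 ≤ p) (hl : ∀ i, 0 ≤ l i)
    (h : ∀ i, (star A * A) (g i) = (l i ^ 2) • g i) :
    eSchattenNorm p A ^ p = ∑' i, ‖A (g i)‖ₑ ^ p := by
  rw [eSchattenNorm_of_eigen hp g hl h, one_div, ENNReal.rpow_inv_rpow (by linarith)]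
  simp_rw [enorm_apply_singular g hl h]

end SingularBasis

section Parseval

variable {H : Type*} [NormedAddCommGroup H] [InnerProductSpace ℂ H]

/-- A family of vectors that satisfies Parseval's identity, without being orthonormal. -/
def IsParseval {κ : Type*} (e : κ → H) : Prop :=
  ∀ x, ∑' i, ‖⟪e i, x⟫_ℂ‖ₑ ^ 2 = ‖x‖ₑ ^ 2

theorem IsParseval.isBessel {κ : Type*} {e : κ → H} (he : IsParseval e) : IsBessel e :=
  fun x => (he x).le

variable [CompleteSpace H]

theorem tsum_enorm_apply_le {p : ℝ} (hp : 2 ≤ p) {A : H →L[ℂ] H} (hA : IsCompactOperator A)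
    {κ : Type*} {e : κ → H} (he : IsBessel e) :
    ∑' i, ‖A (e i)‖ₑ ^ p ≤ eSchattenNorm p A ^ p := by
  obtain ⟨w, g, l, hl, h⟩ := exists_singular_basis hA
  rw [eSchattenNorm_rpow_of_singular g (by linarith) hl h]
  simp_rw [rpow_eq_sq_rpow_half ‖A _‖ₑ, enorm_sq_apply_eq_tsum g h (e _),
    enorm_apply_singular g hl h, ← ENNReal.ofReal_pow (hl _)]
  refine doubly_substochastic (by linarith) (fun i k => ‖⟪g k, e i⟫_ℂ‖ₑ ^ 2) _ (fun i => ?_)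
    fun k => ?_
  · exact (bessel g.orthonormal (e i)).trans (he.enorm_sq_le_one i)
  · simp_rw [enorm_inner_symm (g k)]
    exact (he (g k)).trans ((isBessel_of_orthonormal g.orthonormal).enorm_sq_le_one k)

theorem le_tsum_enorm_apply {p : ℝ} (hp1 : 1 ≤ p) (hp : p ≤ 2) {A : H →L[ℂ] H}
    (hA : IsCompactOperator A) {κ : Type*} {e : κ → H} (he : IsParseval e) :
    eSchattenNorm p A ^ p ≤ ∑' i, ‖A (e i)‖ₑ ^ p := by
  obtain ⟨w, g, l, hl, h⟩ := exists_singular_basis hA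
  have hcol (k) : ∑' i, ‖⟪g k, e i⟫_ℂ‖ₑ ^ 2 = 1 := by
    simp_rw [enorm_inner_symm (g k)]
    rw [he, enorm_sq_eq_ofReal, g.orthonormal.1, one_pow, ENNReal.ofReal_one]
  have hrow (i) : ∑' k, ‖⟪g k, e i⟫_ℂ‖ₑ ^ 2 ≤ 1 :=
    (bessel g.orthonormal (e i)).trans (he.isBessel.enorm_sq_le_one i)
  rw [eSchattenNorm_rpow_of_singular g hp1 hl h]
  simp_rw [rpow_eq_sq_rpow_half ‖A _‖ₑ, enorm_sq_apply_eq_tsum g h (e _),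
    enorm_apply_singular g hl h, ← ENNReal.ofReal_pow (hl _)]
  calc ∑' k, ENNReal.ofReal (l k ^ 2) ^ (p / 2)
      = ∑' k, (∑' i, ‖⟪g k, e i⟫_ℂ‖ₑ ^ 2) * ENNReal.ofReal (l k ^ 2) ^ (p / 2) := by
        simp_rw [hcol, one_mul]
    _ = ∑' i, ∑' k, ‖⟪g k, e i⟫_ℂ‖ₑ ^ 2 * ENNReal.ofReal (l k ^ 2) ^ (p / 2) := by
        simp_rw [← ENNReal.tsum_mul_right]
        exact ENNReal.tsum_comm
    _ ≤ ∑' i, (∑' k, ‖⟪g k, e i⟫_ℂ‖ₑ ^ 2 * ENNReal.ofReal (l k ^ 2)) ^ (p / 2) :=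
        ENNReal.tsum_le_tsum fun i =>
          jensen_tsum_concave (by linarith) (by linarith) _ _ (hrow i)

end Parseval

section Projection

variable {H : Type*} [NormedAddCommGroup H] [InnerProductSpace ℂ H] [CompleteSpace H]

theorem enorm_sq_projection {Q : H →L[ℂ] H} (hQ : IsStarProjection Q) (x : H) :
    ‖x‖ₑ ^ 2 = ‖Q x‖ₑ ^ 2 + ‖(1 - Q) x‖ₑ ^ 2 := by
  have horth : ⟪Q x, (1 - Q) x⟫_ℂ = 0 := by
    rw [← ContinuousLinearMap.adjoint_inner_right, ← ContinuousLinearMap.star_eq_adjoint,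
      hQ.isSelfAdjoint.star_eq, ← mul_apply_eq_comp, hQ.isIdempotentElem.mul_one_sub_self,
      zero_apply, inner_zero_right]
  have hpyth := norm_add_sq_eq_norm_sq_add_norm_sq_of_inner_eq_zero (Q x) ((1 - Q) x) horth
  rw [show Q x + (1 - Q) x = x by simp, ← sq, ← sq, ← sq] at hpyth
  rw [enorm_sq_eq_ofReal, enorm_sq_eq_ofReal, enorm_sq_eq_ofReal, hpyth,
    ENNReal.ofReal_add (by positivity) (by positivity)]

/-- Images under `Q` and `1 - Q` of singular bases of `(Q z)*` and `((1 - Q) z)*`. -/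
theorem exists_isParseval_tsum_star {z Q : H →L[ℂ] H} (hz : IsCompactOperator z)
    (hQ : IsStarProjection Q) :
    ∃ (w w' : Set H) (e : w ⊕ w' → H), IsParseval e ∧ ∀ p : ℝ, 1 ≤ p →
      ∑' i, ‖star z (e i)‖ₑ ^ p =
        eSchattenNorm p (Q * z) ^ p + eSchattenNorm p ((1 - Q) * z) ^ p := by
  have hbasis (R : H →L[ℂ] H) (hR : IsStarProjection R) :
      ∃ (w : Set H) (g : HilbertBasis w ℂ H), ∀ p : ℝ, 1 ≤ p →
        ∑' i, ‖star z (R (g i))‖ₑ ^ p = eSchattenNorm p (R * z) ^ p := by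
    have hRz : IsCompactOperator (R * z : H →L[ℂ] H) := hz.clm_comp R
    obtain ⟨w, g, l, hl, hg⟩ := exists_singular_basis (isCompactOperator_star hRz)
    refine ⟨w, g, fun p hp => ?_⟩
    rw [← eSchattenNorm_star hp hRz, eSchattenNorm_rpow_of_singular g hp hl hg, star_mul,
      hR.isSelfAdjoint.star_eq]
    rfl
  have hinner {R : H →L[ℂ] H} (hR : IsStarProjection R) (u x : H) :
      ⟪R u, x⟫_ℂ = ⟪u, R x⟫_ℂ := by
    rw [← ContinuousLinearMap.adjoint_inner_right, ← ContinuousLinearMap.star_eq_adjoint,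
      hR.isSelfAdjoint.star_eq]
  obtain ⟨w, g, hg⟩ := hbasis Q hQ
  obtain ⟨w', g', hg'⟩ := hbasis (1 - Q) hQ.one_sub
  refine ⟨w, w', Sum.elim (fun i => Q (g i)) fun i => (1 - Q) (g' i), fun x => ?_,
    fun p hp => ?_⟩
  · rw [Summable.tsum_sum ENNReal.summable ENNReal.summable, enorm_sq_projection hQ]
    simp only [Sum.elim_inl, Sum.elim_inr, hinner hQ, hinner hQ.one_sub, parseval]
  · rw [Summable.tsum_sum ENNReal.summable ENNReal.summable]
    exact congrArg₂ _ (hg p hp) (hg' p hp)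

end Projection

section ProjectionPower

variable {H : Type*} [NormedAddCommGroup H] [InnerProductSpace ℂ H] [CompleteSpace H]
variable {p : ℝ} {z Q : H →L[ℂ] H}

theorem eSchattenNorm_projection_add_le (hp : 1 ≤ p) (hz : IsCompactOperator z)
    (hQ : IsStarProjection Q) :
    eSchattenNorm p (Q * z) ^ max p 2 + eSchattenNorm p ((1 - Q) * z) ^ max p 2 ≤
      eSchattenNorm p z ^ max p 2 := by
  have hp0 : 0 < p := by linarith
  have hc (R : H →L[ℂ] H) : IsCompactOperator (R * z : H →L[ℂ] H) := hz.clm_comp R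
  rcases le_total 2 p with h2 | h2
  · obtain ⟨w, w', e, he, hsum⟩ := exists_isParseval_tsum_star hz hQ
    rw [max_eq_left h2, ← hsum p hp, ← eSchattenNorm_star hp hz]
    exact tsum_enorm_apply_le h2 (isCompactOperator_star hz) he.isBessel
  · obtain ⟨w, g, l, hl, hg⟩ := exists_singular_basis hz
    have hpow (a : ℝ≥0∞) : (a ^ p) ^ (2 / p) = a ^ (2 : ℝ) := by
      rw [← ENNReal.rpow_mul, mul_div_cancel₀ _ hp0.ne']
    have hpyth (i) : ((‖(Q * z) (g i)‖ₑ ^ p) ^ (2 / p) + (‖((1 - Q) * z) (g i)‖ₑ ^ p) ^ (2 / p)) ^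
        (2 / p)⁻¹ = ‖z (g i)‖ₑ ^ p := by
      rw [hpow, hpow, ENNReal.rpow_two, ENNReal.rpow_two, mul_apply_eq_comp, mul_apply_eq_comp,
        ← enorm_sq_projection hQ, inv_div, ← rpow_eq_sq_rpow_half]
    have hmink := minkowski_tsum_add_tsum ((one_le_div hp0).2 h2) (fun i => ‖(Q * z) (g i)‖ₑ ^ p)
      (fun i => ‖((1 - Q) * z) (g i)‖ₑ ^ p)
    simp_rw [hpyth] at hmink
    rw [← eSchattenNorm_rpow_of_singular g hp hl hg, ENNReal.rpow_inv_le_iff (by positivity),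
      hpow] at hmink
    rw [max_eq_right h2]
    refine le_trans ?_ hmink
    rw [← hpow, ← hpow]
    gcongr <;> exact le_tsum_enorm_apply hp h2 (hc _) (parseval g)

theorem eSchattenNorm_le_projection_add (hp : 1 ≤ p) (hz : IsCompactOperator z)
    (hQ : IsStarProjection Q) :
    eSchattenNorm p z ^ min p 2 ≤
      eSchattenNorm p (Q * z) ^ min p 2 + eSchattenNorm p ((1 - Q) * z) ^ min p 2 := by
  have hp0 : 0 < p := by linarith
  have hc (R : H →L[ℂ] H) : IsCompactOperator (R * z : H →L[ℂ] H) := hz.clm_comp R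
  rcases le_total p 2 with h2 | h2
  · obtain ⟨w, w', e, he, hsum⟩ := exists_isParseval_tsum_star hz hQ
    rw [min_eq_left h2, ← hsum p hp, ← eSchattenNorm_star hp hz]
    exact le_tsum_enorm_apply hp h2 (isCompactOperator_star hz) he
  · obtain ⟨w, g, l, hl, hg⟩ := exists_singular_basis hz
    have hpow (a : ℝ≥0∞) : (a ^ p) ^ (p / 2)⁻¹ = a ^ (2 : ℝ) := by
      rw [← ENNReal.rpow_mul, inv_div, mul_div_cancel₀ _ hp0.ne']
    have hmink := minkowski_tsum (show 1 ≤ p / 2 by linarith) (fun i => ‖(Q * z) (g i)‖ₑ ^ 2)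
      (fun i => ‖((1 - Q) * z) (g i)‖ₑ ^ 2)
    simp_rw [mul_apply_eq_comp, ← enorm_sq_projection hQ, ← rpow_eq_sq_rpow_half] at hmink
    rw [← eSchattenNorm_rpow_of_singular g hp hl hg, hpow] at hmink
    rw [min_eq_right h2]
    refine hmink.trans ?_
    rw [← hpow, ← hpow]
    gcongr <;> exact tsum_enorm_apply_le h2 (hc _) (isBessel_of_orthonormal g.orthonormal)

end ProjectionPower

section Compression

theorem rpow_norm_add_le_of_enorm {E : Type*} [SeminormedAddCommGroup E] {s : ℝ} (hs : 0 ≤ s)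
    {x y z : E} (h : ‖x‖ₑ ^ s + ‖y‖ₑ ^ s ≤ ‖z‖ₑ ^ s) : ‖x‖ ^ s + ‖y‖ ^ s ≤ ‖z‖ ^ s := by
  simp only [← ofReal_norm, ENNReal.ofReal_rpow_of_nonneg (norm_nonneg _) hs] at h
  rw [← ENNReal.ofReal_add (by positivity) (by positivity)] at h
  exact (ENNReal.ofReal_le_ofReal_iff (by positivity)).1 h

theorem rpow_norm_le_add_of_enorm {E : Type*} [SeminormedAddCommGroup E] {s : ℝ} (hs : 0 ≤ s)
    {x y z : E} (h : ‖z‖ₑ ^ s ≤ ‖x‖ₑ ^ s + ‖y‖ₑ ^ s) : ‖z‖ ^ s ≤ ‖x‖ ^ s + ‖y‖ ^ s := by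
  simp only [← ofReal_norm, ENNReal.ofReal_rpow_of_nonneg (norm_nonneg _) hs] at h
  rw [← ENNReal.ofReal_add (by positivity) (by positivity)] at h
  exact (ENNReal.ofReal_le_ofReal_iff (by positivity)).1 h

variable {p : ℝ} [Fact (1 ≤ p)]
variable {H : Type*} [NormedAddCommGroup H] [InnerProductSpace ℂ H] [CompleteSpace H]

namespace SchattenClass

variable {Q : H →L[ℂ] H}

theorem enorm_sandwich_one_right (Q : H →L[ℂ] H) (z : SchattenClass p H) :
    ‖sandwich Q 1 z‖ₑ = eSchattenNorm p (Q * z.toOp) := by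
  rw [enorm_def, toOp_sandwich]
  rfl

theorem enorm_sandwich_one_left (hQ : IsSelfAdjoint Q) (z : SchattenClass p H) :
    ‖sandwich 1 Q z‖ₑ = eSchattenNorm p (Q * star z.toOp) := by
  have hzQ : IsCompactOperator (z.toOp * Q : H →L[ℂ] H) := z.compact.comp_clm Q
  rw [enorm_def, toOp_sandwich, show Q * star z.toOp = star (z.toOp * Q) by
    rw [star_mul, hQ.star_eq], eSchattenNorm_star Fact.out hzQ]
  rfl

theorem norm_left_add_le (hQ : IsStarProjection Q) (z : SchattenClass p H) :
    ‖sandwich Q 1 z‖ ^ max p 2 + ‖sandwich (1 - Q) 1 z‖ ^ max p 2 ≤ ‖z‖ ^ max p 2 := by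
  refine rpow_norm_add_le_of_enorm (by positivity) ?_
  rw [enorm_sandwich_one_right, enorm_sandwich_one_right, enorm_def]
  exact eSchattenNorm_projection_add_le Fact.out z.compact hQ

theorem norm_right_add_le (hQ : IsStarProjection Q) (z : SchattenClass p H) :
    ‖sandwich 1 Q z‖ ^ max p 2 + ‖sandwich 1 (1 - Q) z‖ ^ max p 2 ≤ ‖z‖ ^ max p 2 := by
  refine rpow_norm_add_le_of_enorm (by positivity) ?_
  rw [enorm_sandwich_one_left hQ.isSelfAdjoint, enorm_sandwich_one_left hQ.one_sub.isSelfAdjoint,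
    enorm_def, ← eSchattenNorm_star Fact.out z.compact]
  exact eSchattenNorm_projection_add_le Fact.out (isCompactOperator_star z.compact) hQ

theorem norm_le_left_add (hQ : IsStarProjection Q) (z : SchattenClass p H) :
    ‖z‖ ^ min p 2 ≤ ‖sandwich Q 1 z‖ ^ min p 2 + ‖sandwich (1 - Q) 1 z‖ ^ min p 2 := by
  have hp : 1 ≤ p := Fact.out
  refine rpow_norm_le_add_of_enorm (by positivity) ?_
  rw [enorm_sandwich_one_right, enorm_sandwich_one_right, enorm_def]
  exact eSchattenNorm_le_projection_add hp z.compact hQ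

theorem norm_le_right_add (hQ : IsStarProjection Q) (z : SchattenClass p H) :
    ‖z‖ ^ min p 2 ≤ ‖sandwich 1 Q z‖ ^ min p 2 + ‖sandwich 1 (1 - Q) z‖ ^ min p 2 := by
  have hp : 1 ≤ p := Fact.out
  refine rpow_norm_le_add_of_enorm (by positivity) ?_
  rw [enorm_sandwich_one_left hQ.isSelfAdjoint, enorm_sandwich_one_left hQ.one_sub.isSelfAdjoint,
    enorm_def, ← eSchattenNorm_star Fact.out z.compact]
  exact eSchattenNorm_le_projection_add hp (isCompactOperator_star z.compact) hQ

/-- The compression `z ↦ Q z Q` of `S^p(H)`. -/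
noncomputable def compress (Q : H →L[ℂ] H) : SchattenClass p H →L[ℂ] SchattenClass p H :=
  sandwich Q Q

theorem toOp_compress (Q : H →L[ℂ] H) (z : SchattenClass p H) :
    (compress Q z).toOp = Q * z.toOp * Q := rfl

theorem sandwich_one_left_right (Q : H →L[ℂ] H) (z : SchattenClass p H) :
    sandwich 1 Q (sandwich Q 1 z) = compress Q z := by
  apply toOp_injective
  ext v
  rfl

theorem compress_compress_of_mul_eq {Q R S : H →L[ℂ] H} (hQR : Q * R = S) (hRQ : R * Q = S)
    (z : SchattenClass p H) : compress Q (compress R z) = compress S z := by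
  apply toOp_injective
  rw [toOp_compress, toOp_compress, toOp_compress, ← mul_assoc, ← mul_assoc, hQR, mul_assoc, hRQ]

theorem norm_compress_le (hQ : IsStarProjection Q) :
    ‖(compress Q : SchattenClass p H →L[ℂ] SchattenClass p H)‖ ≤ 1 :=
  (norm_sandwich_le Q Q).trans (mul_le_one₀ hQ.norm_le (norm_nonneg _) hQ.norm_le)

theorem norm_compress_apply_le (hQ : IsStarProjection Q) (z : SchattenClass p H) :
    ‖compress Q z‖ ≤ ‖z‖ :=
  norm_sandwich_apply_le hQ.norm_le hQ.norm_le z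

theorem sub_compress_eq (Q : H →L[ℂ] H) (z : SchattenClass p H) :
    z - compress Q z = sandwich (1 - Q) 1 z + sandwich 1 (1 - Q) (sandwich Q 1 z) := by
  apply toOp_injective
  rw [map_sub, map_add, toOp_compress]
  simp only [toOp_sandwich, ← ContinuousLinearMap.mul_def]
  noncomm_ring

theorem norm_compress_add_le (hQ : IsStarProjection Q) (z : SchattenClass p H) :
    ‖compress Q z‖ ^ max p 2 + (2⁻¹ * ‖z - compress Q z‖) ^ max p 2 ≤ ‖z‖ ^ max p 2 := by
  have hs : 0 ≤ max p 2 := by positivity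
  have hleft := norm_left_add_le hQ z
  have hright := norm_right_add_le hQ (sandwich Q 1 z)
  rw [sandwich_one_left_right] at hright
  have htri := norm_add_le (sandwich (1 - Q) 1 z) (sandwich 1 (1 - Q) (sandwich Q 1 z))
  rw [← sub_compress_eq] at htri
  set a := ‖sandwich (1 - Q) 1 z‖
  set b := ‖sandwich 1 (1 - Q) (sandwich Q 1 z)‖
  have ha : 0 ≤ a := norm_nonneg _
  have hb : 0 ≤ b := norm_nonneg _
  have hab : (2⁻¹ * ‖z - compress Q z‖) ^ max p 2 ≤ a ^ max p 2 + b ^ max p 2 := by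
    have hmax : 2⁻¹ * ‖z - compress Q z‖ ≤ max a b := by
      linarith [le_max_left a b, le_max_right a b]
    refine (Real.rpow_le_rpow (by positivity) hmax hs).trans ?_
    rcases max_cases a b with h | h <;> rw [h.1] <;>
      linarith [Real.rpow_nonneg ha (max p 2), Real.rpow_nonneg hb (max p 2)]
  linarith

theorem norm_le_compress_add (hQ : IsStarProjection Q) (z : SchattenClass p H) :
    ‖z‖ ^ min p 2 ≤ ‖compress Q z‖ ^ min p 2 + 2 * ‖z - compress Q z‖ ^ min p 2 := by
  have hr : 0 ≤ min p 2 := le_min (zero_le_one.trans Fact.out) zero_le_two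
  have hone : ‖(1 : H →L[ℂ] H)‖ ≤ 1 := ContinuousLinearMap.norm_id_le
  have hQQ : Q * Q = Q := hQ.isIdempotentElem.eq
  have hleft : sandwich (1 - Q) 1 z = sandwich (1 - Q) 1 (z - compress Q z) := by
    apply toOp_injective
    simp only [map_sub, toOp_sandwich, toOp_compress, ← ContinuousLinearMap.mul_def]
    simp only [sub_mul, one_mul, mul_one, ← mul_assoc, hQQ, sub_self, zero_mul, sub_zero]
  have hright : sandwich 1 (1 - Q) (sandwich Q 1 z) = sandwich Q (1 - Q) (z - compress Q z) := by
    apply toOp_injective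
    simp only [map_sub, toOp_sandwich, toOp_compress, ← ContinuousLinearMap.mul_def]
    simp only [mul_sub, one_mul, mul_one, mul_assoc, hQQ, sub_self, mul_zero, sub_zero]
  calc ‖z‖ ^ min p 2
      ≤ ‖sandwich Q 1 z‖ ^ min p 2 + ‖sandwich (1 - Q) 1 z‖ ^ min p 2 := norm_le_left_add hQ z
    _ ≤ ‖compress Q z‖ ^ min p 2 + ‖sandwich 1 (1 - Q) (sandwich Q 1 z)‖ ^ min p 2 +
          ‖sandwich (1 - Q) 1 z‖ ^ min p 2 := by
        rw [← sandwich_one_left_right]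
        gcongr
        exact norm_le_right_add hQ (sandwich Q 1 z)
    _ ≤ ‖compress Q z‖ ^ min p 2 + ‖z - compress Q z‖ ^ min p 2 +
          ‖z - compress Q z‖ ^ min p 2 := by
        rw [hleft, hright]
        gcongr
        · exact norm_sandwich_apply_le hQ.norm_le hQ.one_sub.norm_le _
        · exact norm_sandwich_apply_le hQ.one_sub.norm_le hone _
    _ = ‖compress Q z‖ ^ min p 2 + 2 * ‖z - compress Q z‖ ^ min p 2 := by ring

variable {ι : Type*} {P : ι → H →L[ℂ] H}

theorem uniformlySmoothAlong_compress (hp : 1 < p) (hP : ∀ i, IsStarProjection (P i)) :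
    UniformlySmoothAlong (normSeminorm ℝ (SchattenClass p H)) fun i => compress (P i) :=
  .of_rpow (P := fun i => (compress (P i)).toLinearMap.restrictScalars ℝ) (r := min p 2) (C := 2)
    (fun i z => compress_compress_of_mul_eq (hP i).isIdempotentElem.eq (hP i).isIdempotentElem.eq z)
    (fun i z => norm_compress_apply_le (hP i) z) (lt_min hp one_lt_two) zero_le_two
    (fun i z => norm_le_compress_add (hP i) z)

theorem uniformlyConvexAlong_compress (hP : ∀ i, IsStarProjection (P i)) :
    UniformlyConvexAlong (normSeminorm ℝ (SchattenClass p H)) fun i => compress (P i) :=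
  .of_rpow (s := max p 2) (c := 2⁻¹) (one_lt_two.trans_le (le_max_right _ _)) (by norm_num)
    fun i z => norm_compress_add_le (hP i) z

end SchattenClass

end Compression

section TensorOperators

variable {K H K' H' K'' H'' : Type*} [NormedAddCommGroup K] [InnerProductSpace ℂ K]
  [NormedAddCommGroup H] [InnerProductSpace ℂ H] [NormedAddCommGroup K'] [InnerProductSpace ℂ K']
  [NormedAddCommGroup H'] [InnerProductSpace ℂ H'] [NormedAddCommGroup K'']
  [InnerProductSpace ℂ K''] [NormedAddCommGroup H''] [InnerProductSpace ℂ H'']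

theorem inner_tmul (ξ η : K) (h k : H) :
    ⟪tmul ξ h, tmul η k⟫_ℂ = ⟪ξ, η⟫_ℂ * ⟪h, k⟫_ℂ := by
  simp only [tmul]
  rw [UniformSpace.Completion.inner_coe, TensorProduct.inner_tmul]

theorem ext_tmul {E : Type*} [NormedAddCommGroup E] [NormedSpace ℂ E]
    {A B : HilbertTensor K H →L[ℂ] E} (h : ∀ ξ k, A (tmul ξ k) = B (tmul ξ k)) : A = B := by
  ext1 u
  exact mem_of_tmul_mem (M := LinearMap.eqLocus (A : HilbertTensor K H →ₗ[ℂ] E) B.toLinearMap)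
    (isClosed_eq A.continuous B.continuous) h u

theorem ext_inner_tmul {x y : HilbertTensor K H}
    (h : ∀ ξ k, ⟪x, tmul ξ k⟫_ℂ = ⟪y, tmul ξ k⟫_ℂ) : x = y :=
  (innerSL_inj (𝕜 := ℂ)).1 (ext_tmul (A := innerSL ℂ x) (B := innerSL ℂ y) h)

/-- The operator `a ⊗ b : K ⊗₂ H → K' ⊗₂ H'`. -/
noncomputable def tensorMap (a : K →L[ℂ] K') (b : H →L[ℂ] H') :
    HilbertTensor K H →L[ℂ] HilbertTensor K' H' :=
  (TensorProduct.mapL a b).completion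

theorem tensorMap_tmul (a : K →L[ℂ] K') (b : H →L[ℂ] H') (ξ : K) (h : H) :
    tensorMap a b (tmul ξ h) = tmul (a ξ) (b h) := by
  simp only [tensorMap, tmul]
  rw [ContinuousLinearMap.completion_apply_coe, TensorProduct.mapL_tmul]

theorem norm_tensorMap_le (a : K →L[ℂ] K') (b : H →L[ℂ] H') : ‖tensorMap a b‖ ≤ ‖a‖ * ‖b‖ := by
  refine ContinuousLinearMap.opNorm_le_bound _ (by positivity) fun x => ?_
  induction x using UniformSpace.Completion.induction_on with
  | hp => exact isClosed_le (by fun_prop) (by fun_prop)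
  | ih x =>
    rw [tensorMap, ContinuousLinearMap.completion_apply_coe, UniformSpace.Completion.norm_coe,
      UniformSpace.Completion.norm_coe]
    exact ((TensorProduct.mapL a b).le_opNorm x).trans
      (by gcongr; exact TensorProduct.norm_mapL_le a b)

theorem tensorMap_comp (a' : K' →L[ℂ] K'') (b' : H' →L[ℂ] H'') (a : K →L[ℂ] K') (b : H →L[ℂ] H') :
    tensorMap a' b' ∘L tensorMap a b = tensorMap (a' ∘L a) (b' ∘L b) :=
  ext_tmul fun ξ k => by
    rw [ContinuousLinearMap.comp_apply, tensorMap_tmul, tensorMap_tmul, tensorMap_tmul]; rfl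

theorem tensorMap_mul (a' a : K →L[ℂ] K) (b' b : H →L[ℂ] H) :
    tensorMap a' b' * tensorMap a b = tensorMap (a' * a) (b' * b) :=
  tensorMap_comp a' b' a b

theorem isTensor_tensorMap (a : K →L[ℂ] K) (b : H →L[ℂ] H) : IsTensor a b (tensorMap a b) :=
  tensorMap_tmul a b

theorem adjoint_tensorMap [CompleteSpace K] [CompleteSpace H] [CompleteSpace K']
    [CompleteSpace H'] (a : K →L[ℂ] K') (b : H →L[ℂ] H') :
    (tensorMap a b).adjoint = tensorMap a.adjoint b.adjoint := by
  refine ext_tmul fun ξ k => ext_inner_tmul fun η l => ?_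
  rw [ContinuousLinearMap.adjoint_inner_left, tensorMap_tmul, tensorMap_tmul, inner_tmul,
    inner_tmul, ContinuousLinearMap.adjoint_inner_left, ContinuousLinearMap.adjoint_inner_left]

theorem isStarProjection_tensorMap [CompleteSpace K] [CompleteSpace H] {a : K →L[ℂ] K}
    {b : H →L[ℂ] H} (ha : IsStarProjection a) (hb : IsStarProjection b) :
    IsStarProjection (tensorMap a b) where
  isIdempotentElem := by
    rw [IsIdempotentElem, tensorMap_mul, ha.isIdempotentElem.eq, hb.isIdempotentElem.eq]
  isSelfAdjoint := by
    rw [IsSelfAdjoint, ContinuousLinearMap.star_eq_adjoint, adjoint_tensorMap,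
      ← ContinuousLinearMap.star_eq_adjoint, ← ContinuousLinearMap.star_eq_adjoint,
      ha.isSelfAdjoint.star_eq, hb.isSelfAdjoint.star_eq]

theorem tmul_smul_left (c : ℂ) (ξ : K) (h : H) : tmul (c • ξ) h = c • tmul ξ h := by
  simp only [tmul]
  rw [← TensorProduct.smul_tmul', UniformSpace.Completion.coe_smul]

theorem tmul_smul_right (c : ℂ) (ξ : K) (h : H) : tmul ξ (c • h) = c • tmul ξ h := by
  simp only [tmul]
  rw [TensorProduct.tmul_smul, UniformSpace.Completion.coe_smul]

/-- The operator `h ↦ ξ ⊗ h`. -/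
noncomputable def tmulLeft (ξ : K) : H →L[ℂ] HilbertTensor K H :=
  UniformSpace.Completion.toComplL ∘L TensorProduct.mkL ℂ K H ξ

/-- The operator `ξ ↦ ξ ⊗ h`. -/
noncomputable def tmulRight (h : H) : K →L[ℂ] HilbertTensor K H :=
  UniformSpace.Completion.toComplL ∘L (TensorProduct.mkL ℂ K H).flip h

theorem tmulLeft_apply (ξ : K) (h : H) : tmulLeft ξ h = tmul ξ h := rfl

theorem tmulRight_apply (ξ : K) (h : H) : tmulRight h ξ = tmul ξ h := rfl

theorem orthonormal_tmul_sigma {ι : Type*} {κ : ι → Type*} {e : ι → K} (he : Orthonormal ℂ e)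
    {v : ∀ i, κ i → H} (hv : ∀ i, Orthonormal ℂ (v i)) :
    Orthonormal ℂ fun x : Σ i, κ i => tmul (e x.1) (v x.1 x.2) := by
  classical
  rw [orthonormal_iff_ite]
  rintro ⟨i, k⟩ ⟨j, l⟩
  rw [inner_tmul, orthonormal_iff_ite.1 he]
  by_cases hij : i = j
  · subst hij
    rw [if_pos rfl, one_mul, orthonormal_iff_ite.1 (hv i)]
    simp only [Sigma.mk.injEq, heq_eq_eq, true_and]
  · rw [if_neg hij, zero_mul, if_neg fun h => hij (congrArg Sigma.fst h)]

theorem eq_zero_of_forall_inner_eq_zero {ι : Type*} (g : HilbertBasis ι ℂ H) {x : H}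
    (h : ∀ i, ⟪g i, x⟫_ℂ = 0) : x = 0 := by
  refine (g.hasSum_repr x).unique ?_
  simp only [HilbertBasis.repr_apply_apply, h, zero_smul, hasSum_zero]

theorem eq_zero_of_inner_tmul_basis_eq_zero [CompleteSpace K] [CompleteSpace H] {ι κ : Type*}
    (g : HilbertBasis ι ℂ K) (g' : HilbertBasis κ ℂ H) {x : HilbertTensor K H}
    (h : ∀ i j, ⟪tmul (g i) (g' j), x⟫_ℂ = 0) : x = 0 := by
  have hleft (i) : (tmulLeft (g i)).adjoint x = (0 : H) :=
    eq_zero_of_forall_inner_eq_zero g' fun j => by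
      rw [ContinuousLinearMap.adjoint_inner_right]
      exact h i j
  have hright (k : H) : (tmulRight k).adjoint x = (0 : K) :=
    eq_zero_of_forall_inner_eq_zero g fun i => by
      rw [ContinuousLinearMap.adjoint_inner_right, tmulRight_apply, ← tmulLeft_apply,
        ← ContinuousLinearMap.adjoint_inner_right, hleft, inner_zero_right]
  refine ext_inner_tmul fun ξ k => ?_
  rw [inner_zero_left, ← tmulRight_apply, inner_eq_zero_symm,
    ← ContinuousLinearMap.adjoint_inner_right, hright, inner_zero_right]

/-- The Hilbert basis `g i ⊗ g' j` of `K ⊗₂ H`, indexed by a sigma type so that it is an instance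
of `orthonormal_tmul_sigma`. -/
noncomputable def tensorBasis [CompleteSpace K] [CompleteSpace H] {ι κ : Type*}
    (g : HilbertBasis ι ℂ K) (g' : HilbertBasis κ ℂ H) :
    HilbertBasis (Σ _ : ι, κ) ℂ (HilbertTensor K H) :=
  HilbertBasis.mkOfOrthogonalEqBot
    (orthonormal_tmul_sigma g.orthonormal fun _ => g'.orthonormal) <| by
      refine eq_bot_iff.2 fun x hx => (Submodule.mem_bot ℂ).2 ?_
      rw [Submodule.mem_orthogonal] at hx
      exact eq_zero_of_inner_tmul_basis_eq_zero g g' fun i j =>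
        hx _ (Submodule.subset_span ⟨⟨i, j⟩, rfl⟩)

theorem tensorBasis_apply [CompleteSpace K] [CompleteSpace H] {ι κ : Type*}
    (g : HilbertBasis ι ℂ K) (g' : HilbertBasis κ ℂ H) (x : Σ _ : ι, κ) :
    tensorBasis g g' x = tmul (g x.1) (g' x.2) := by
  simp [tensorBasis]

theorem eSchattenNorm_tensorMap [CompleteSpace K] [CompleteSpace H] {p : ℝ} (hp : 1 ≤ p)
    {a : K →L[ℂ] K} {b : H →L[ℂ] H} (ha : IsCompactOperator a) (hb : IsCompactOperator b) :
    eSchattenNorm p (tensorMap a b) = eSchattenNorm p a * eSchattenNorm p b := by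
  obtain ⟨w, g, l, hl, h⟩ := exists_singular_basis ha
  obtain ⟨w', g', l', hl', h'⟩ := exists_singular_basis hb
  have key := eSchattenNorm_of_eigen hp (A := tensorMap a b) (tensorBasis g g')
    (l := fun x => l x.1 * l' x.2) (fun x => mul_nonneg (hl x.1) (hl' x.2)) (fun x => by
      rw [ContinuousLinearMap.star_eq_adjoint, adjoint_tensorMap, tensorMap_mul, tensorBasis_apply,
        tensorMap_tmul, ← ContinuousLinearMap.star_eq_adjoint,
        ← ContinuousLinearMap.star_eq_adjoint, h, h', ← Complex.coe_smul, ← Complex.coe_smul,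
        tmul_smul_left, tmul_smul_right, smul_smul, ← Complex.ofReal_mul, ← mul_pow]
      exact Complex.coe_smul _ _)
  have hp0 : 0 < p := by linarith
  rw [key, eSchattenNorm_of_eigen hp g hl h, eSchattenNorm_of_eigen hp g' hl' h',
    ← ENNReal.mul_rpow_of_nonneg _ _ (by positivity), ENNReal.tsum_sigma', ← ENNReal.tsum_mul_right]
  congr 1
  refine tsum_congr fun i => ?_
  rw [← ENNReal.tsum_mul_left]
  refine tsum_congr fun j => ?_
  rw [ENNReal.ofReal_mul (hl i), ENNReal.mul_rpow_of_nonneg _ _ hp0.le]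

namespace SchattenClass

variable {p : ℝ} [Fact (1 ≤ p)] [CompleteSpace K] [CompleteSpace H]

/-- The element `a ⊗ b` of `S^p(K ⊗₂ H)`. -/
noncomputable def tensor (a : SchattenClass p K) (b : SchattenClass p H) :
    SchattenClass p (HilbertTensor K H) :=
  mk (tensorMap a.toOp b.toOp) (by
    rw [eSchattenNorm_tensorMap Fact.out a.compact b.compact]
    exact ENNReal.mul_lt_top a.lt_top b.lt_top)

theorem isTensor_tensor (a : SchattenClass p K) (b : SchattenClass p H) :
    IsTensor a.toOp b.toOp (tensor a b).toOp := isTensor_tensorMap _ _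

theorem norm_tensor (a : SchattenClass p K) (b : SchattenClass p H) :
    ‖tensor a b‖ = ‖a‖ * ‖b‖ := by
  rw [norm_def, norm_def, norm_def, ← ENNReal.toReal_mul,
    ← eSchattenNorm_tensorMap Fact.out a.compact b.compact]
  rfl

end SchattenClass

end TensorOperators

section Slices

variable {p : ℝ} [Fact (1 ≤ p)] {K H : Type*} [NormedAddCommGroup K] [InnerProductSpace ℂ K]
  [NormedAddCommGroup H] [InnerProductSpace ℂ H]

theorem ext_rankOne_tmul {F : Type*} [NormedAddCommGroup F] [NormedSpace ℂ F]
    {Φ Ψ : SchattenClass p (HilbertTensor K H) →L[ℂ] F}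
    (h : ∀ ξ η h k, Φ (SchattenClass.rankOne (tmul ξ h) (tmul η k)) =
      Ψ (SchattenClass.rankOne (tmul ξ h) (tmul η k))) : Φ = Ψ := by
  ext1 z
  exact rankOne_tmul_mem (M := LinearMap.eqLocus
    (Φ : SchattenClass p (HilbertTensor K H) →ₗ[ℂ] F) Ψ.toLinearMap)
    (isClosed_eq Φ.continuous Ψ.continuous) h z

theorem norm_apply_le_of_rankOne_tmul_mem {F : Type*} [SeminormedAddCommGroup F] [NormedSpace ℂ F]
    {Φ : SchattenClass p (HilbertTensor K H) →L[ℂ] F} {C : ℝ}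
    {M : Submodule ℂ (SchattenClass p (HilbertTensor K H))}
    (h : ∀ ξ η h k, SchattenClass.rankOne (tmul ξ h) (tmul η k) ∈ M)
    (hM : ∀ z ∈ M, ‖Φ z‖ ≤ C * ‖z‖) (z : SchattenClass p (HilbertTensor K H)) :
    ‖Φ z‖ ≤ C * ‖z‖ := by
  have hcl : IsClosed {z | ‖Φ z‖ ≤ C * ‖z‖} := isClosed_le (by fun_prop) (by fun_prop)
  have hz : z ∈ M.topologicalClosure := rankOne_tmul_mem M.isClosed_topologicalClosure
    (fun ξ η k l => M.le_topologicalClosure (h ξ η k l)) z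
  exact hcl.closure_subset_iff.2 hM hz

variable [CompleteSpace H]

namespace SchattenClass

/-- The entry `(⟨f| ⊗ 1) z (|e⟩ ⊗ 1)` of `z`, viewed as a matrix over `S^p(H)`. -/
noncomputable def entry (f e : K) :
    SchattenClass p (HilbertTensor K H) →L[ℂ] SchattenClass p H :=
  sandwich (tmulLeft f).adjoint (tmulLeft e)

theorem inner_entry (f e : K) (z : SchattenClass p (HilbertTensor K H)) (h k : H) :
    ⟪h, (entry f e z).toOp k⟫_ℂ = ⟪tmul f h, z.toOp (tmul e k)⟫_ℂ := by
  rw [entry, toOp_sandwich, ContinuousLinearMap.comp_apply, ContinuousLinearMap.comp_apply,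
    ContinuousLinearMap.adjoint_inner_right]
  rfl

theorem ext_entry {z z' : SchattenClass p (HilbertTensor K H)}
    (h : ∀ f e : K, entry f e z = entry f e z') : z = z' := by
  refine toOp_injective (ext_tmul fun e k => (ext_inner_tmul fun f l => ?_))
  rw [← inner_conj_symm, ← inner_entry, h, inner_entry, inner_conj_symm]

theorem entry_of_isTensor {a : K →L[ℂ] K} {b : SchattenClass p H}
    {z : SchattenClass p (HilbertTensor K H)} (hz : IsTensor a b.toOp z.toOp) (f e : K) :
    entry f e z = ⟪f, a e⟫_ℂ • b := by
  refine toOp_injective (ContinuousLinearMap.ext fun k => ext_inner_left ℂ fun h => ?_)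
  rw [inner_entry, hz, inner_tmul, map_smul, smul_apply, inner_smul_right]

end SchattenClass

theorem eSchattenNorm_rpow_eq_tsum_inner {p : ℝ} (hp : 1 ≤ p) {ι : Type*} {A : H →L[ℂ] H}
    (g : HilbertBasis ι ℂ H) {l : ι → ℝ} (hl : ∀ i, 0 ≤ l i)
    (h : ∀ i, (star A * A) (g i) = (l i ^ 2) • g i) :
    eSchattenNorm p A ^ p =
      ∑' i : {i // l i ≠ 0}, ‖⟪(l i)⁻¹ • A (g i), A (g i)⟫_ℂ‖ₑ ^ p := by
  have hsupp : Function.support (fun i => ‖A (g i)‖ₑ ^ p) ⊆ {i | l i ≠ 0} := fun i hi h0 => hi <| by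
    simp only [enorm_apply_singular g hl h, h0, ENNReal.ofReal_zero,
      ENNReal.zero_rpow_of_pos (zero_lt_one.trans_le hp)]
  rw [eSchattenNorm_rpow_of_singular g hp hl h, ← tsum_subtype_eq_of_support_subset hsupp]
  refine tsum_congr fun ⟨i, hi⟩ => ?_
  have hinner : ⟪(l i)⁻¹ • A (g i), A (g i)⟫_ℂ = (l i : ℂ) := by
    rw [inner_smul_left_eq_smul, inner_singular g h, inner_self_eq_norm_sq_to_K,
      g.orthonormal.1, smul_smul, pow_two, inv_mul_cancel_left₀ hi]
    simp
  rw [hinner, enorm_apply_singular g hl h, ← Real.enorm_of_nonneg (hl i), ← ofReal_norm,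
    ← ofReal_norm, Complex.norm_real]

namespace SchattenClass

theorem sum_enorm_entry_le {n : ℕ} {e f : Fin n → K} (he : Orthonormal ℂ e)
    (hf : Orthonormal ℂ f) (z : SchattenClass p (HilbertTensor K H)) :
    ∑ i, ‖entry (f i) (e i) z‖ₑ ^ p ≤ ‖z‖ₑ ^ p := by
  have hp : 1 ≤ p := Fact.out
  choose w g l hl h using fun i => exists_singular_basis (entry (f i) (e i) z).compact
  have hE := orthonormal_tmul_sigma he (v := fun i (k : {k // l i k ≠ 0}) => g i k)
    fun i => (g i).orthonormal.comp _ Subtype.val_injective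
  have hF := orthonormal_tmul_sigma hf fun i => orthonormal_singular (g i) (h i)
  have key := tsum_le_of_isBessel hp z.compact (isBessel_of_orthonormal hE)
    (isBessel_of_orthonormal hF)
  rw [← enorm_def, ENNReal.tsum_sigma', tsum_fintype] at key
  refine le_of_eq_of_le (Finset.sum_congr rfl fun i _ => ?_) key
  rw [enorm_def, eSchattenNorm_rpow_eq_tsum_inner hp (g i) (hl i) (h i)]
  exact tsum_congr fun k => by rw [← inner_entry]

variable [CompleteSpace K]

theorem isTensor_toOp_rankOne (ξ η : K) (h k : H) :
    IsTensor (rankOne (p := p) ξ η).toOp (rankOne (p := p) h k).toOp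
      (rankOne (p := p) (tmul ξ h) (tmul η k)).toOp :=
  isTensor_rankOne ξ η h k

/-- `s` is the slice `(id ⊗ ψ)(z)`, characterised by its matrix entries. -/
def IsSlice (ψ : SchattenClass p H →L[ℂ] ℂ) (z : SchattenClass p (HilbertTensor K H))
    (s : SchattenClass p K) : Prop :=
  ∀ f e, ⟪f, s.toOp e⟫_ℂ = ψ (entry f e z)

namespace IsSlice

variable {ψ : SchattenClass p H →L[ℂ] ℂ} {z z' : SchattenClass p (HilbertTensor K H)}
  {s s' : SchattenClass p K}

theorem norm_le (h : IsSlice ψ z s) : ‖s‖ ≤ ‖ψ‖ * ‖z‖ := by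
  have hp : 1 ≤ p := Fact.out
  have hp0 : 0 < p := by linarith
  have henorm : ‖s‖ₑ ≤ ‖ψ‖ₑ * ‖z‖ₑ := by
    rw [enorm_def s]
    refine eSchattenNorm_le hp s.compact fun n e f he hf => ?_
    rw [one_div, ENNReal.rpow_inv_le_iff hp0, ENNReal.mul_rpow_of_nonneg _ _ hp0.le]
    calc ∑ i, ‖⟪f i, s.toOp (e i)⟫_ℂ‖ₑ ^ p
        ≤ ∑ i, ‖ψ‖ₑ ^ p * ‖entry (f i) (e i) z‖ₑ ^ p := by
          refine Finset.sum_le_sum fun i _ => ?_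
          rw [h, ← ENNReal.mul_rpow_of_nonneg _ _ hp0.le]
          gcongr
          exact ψ.le_opENorm _
      _ ≤ ‖ψ‖ₑ ^ p * ‖z‖ₑ ^ p := by
          rw [← Finset.mul_sum]
          gcongr
          exact sum_enorm_entry_le he hf z
  rw [← ofReal_norm, ← ofReal_norm, ← ofReal_norm, ← ENNReal.ofReal_mul (norm_nonneg _)] at henorm
  exact (ENNReal.ofReal_le_ofReal_iff (by positivity)).1 henorm

theorem zero : IsSlice ψ (0 : SchattenClass p (HilbertTensor K H)) 0 := fun f e => by
  rw [map_zero, map_zero, map_zero]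
  exact inner_zero_right f

theorem add (h : IsSlice ψ z s) (h' : IsSlice ψ z' s') : IsSlice ψ (z + z') (s + s') :=
  fun f e => by rw [map_add, map_add, map_add, add_apply, inner_add_right, h, h']

theorem smul (h : IsSlice ψ z s) (c : ℂ) : IsSlice ψ (c • z) (c • s) := fun f e => by
  rw [map_smul, map_smul, map_smul, smul_apply, inner_smul_right, h, smul_eq_mul]

end IsSlice

theorem isSlice_rankOne (ψ : SchattenClass p H →L[ℂ] ℂ) (ξ η : K) (h k : H) :
    IsSlice ψ (rankOne (tmul ξ h) (tmul η k)) (ψ (rankOne h k) • rankOne ξ η) := fun f e => by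
  rw [entry_of_isTensor (isTensor_toOp_rankOne ξ η h k), map_smul, map_smul, smul_apply,
    inner_smul_right, smul_eq_mul, mul_comm]

/-- The elements of `S^p(K ⊗₂ H)` that have a slice along `ψ`. -/
def sliceable (ψ : SchattenClass p H →L[ℂ] ℂ) :
    Submodule ℂ (SchattenClass p (HilbertTensor K H)) where
  carrier := {z | ∃ s, IsSlice ψ z s}
  add_mem' := fun ⟨s, hs⟩ ⟨s', hs'⟩ => ⟨s + s', hs.add hs'⟩
  zero_mem' := ⟨0, .zero⟩
  smul_mem' := fun c _ ⟨s, hs⟩ => ⟨c • s, hs.smul c⟩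

end SchattenClass

end Slices

section Entries

open SchattenClass

variable {p : ℝ} [Fact (1 ≤ p)] {K H : Type*} [NormedAddCommGroup K] [InnerProductSpace ℂ K]
  [CompleteSpace K] [NormedAddCommGroup H] [InnerProductSpace ℂ H] [CompleteSpace H]
  {T : SchattenClass p H →L[ℂ] SchattenClass p H}
  {Φ : SchattenClass p (HilbertTensor K H) →L[ℂ] SchattenClass p (HilbertTensor K H)}

theorem IsAmpliation.entry_apply (hΦ : IsAmpliation K T Φ) (f e : K)
    (z : SchattenClass p (HilbertTensor K H)) : entry f e (Φ z) = T (entry f e z) := by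
  have hcomp : entry f e ∘L Φ = T ∘L entry f e := ext_rankOne_tmul fun ξ η h k => by
    have hz := isTensor_toOp_rankOne (p := p) ξ η h k
    rw [ContinuousLinearMap.comp_apply, ContinuousLinearMap.comp_apply, entry_of_isTensor hz,
      entry_of_isTensor (hΦ _ _ _ hz), map_smul]
  exact DFunLike.congr_fun hcomp z

theorem IsAmpliation.norm_le_of_finite_rank (hΦ : IsAmpliation K T Φ)
    {ι : Type*} [Fintype ι] (ψ : ι → SchattenClass p H →L[ℂ] ℂ) (b : ι → SchattenClass p H)
    (hT : ∀ x, T x = ∑ j, ψ j x • b j) : ‖Φ‖ ≤ ∑ j, ‖ψ j‖ * ‖b j‖ := by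
  refine ContinuousLinearMap.opNorm_le_bound _ (by positivity)
    (norm_apply_le_of_rankOne_tmul_mem (M := ⨅ j, sliceable (ψ j)) (fun ξ η h k => ?_)
      fun z hz => ?_)
  · exact Submodule.mem_iInf _ |>.2 fun j => ⟨_, isSlice_rankOne (ψ j) ξ η h k⟩
  · choose s hs using Submodule.mem_iInf _ |>.1 hz
    have hΦz : Φ z = ∑ j, tensor (s j) (b j) := ext_entry fun f e => by
      rw [hΦ.entry_apply, hT, map_sum]
      exact Finset.sum_congr rfl fun j _ => by
        rw [entry_of_isTensor (isTensor_tensor (s j) (b j)), hs]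
    rw [hΦz, Finset.sum_mul]
    refine (norm_sum_le _ _).trans (Finset.sum_le_sum fun j _ => ?_)
    rw [norm_tensor, mul_right_comm]
    gcongr
    exact (hs j).norm_le

variable {L : Type*} [NormedAddCommGroup L] [InnerProductSpace ℂ L] [CompleteSpace L]

theorem SchattenClass.entry_sandwich_tensorMap_one (A : K →L[ℂ] L) (B : L →L[ℂ] K) (f e : L)
    (z : SchattenClass p (HilbertTensor K H)) :
    entry f e (sandwich (tensorMap A 1) (tensorMap B 1) z) = entry (A.adjoint f) (B e) z := by
  refine toOp_injective (ContinuousLinearMap.ext fun k => ext_inner_left ℂ fun h => ?_)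
  rw [inner_entry, inner_entry, toOp_sandwich, ContinuousLinearMap.comp_apply,
    ContinuousLinearMap.comp_apply, tensorMap_tmul, ← ContinuousLinearMap.adjoint_inner_left,
    adjoint_tensorMap, tensorMap_tmul, ContinuousLinearMap.one_def, ContinuousLinearMap.adjoint_id]
  rfl

theorem IsAmpliation.sandwich_comm (hΦ : IsAmpliation K T Φ)
    {Ψ : SchattenClass p (HilbertTensor L H) →L[ℂ] SchattenClass p (HilbertTensor L H)}
    (hΨ : IsAmpliation L T Ψ) (A : K →L[ℂ] L) (B : L →L[ℂ] K)
    (z : SchattenClass p (HilbertTensor K H)) :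
    Ψ (sandwich (tensorMap A 1) (tensorMap B 1) z) =
      sandwich (tensorMap A 1) (tensorMap B 1) (Φ z) :=
  ext_entry fun f e => by
    rw [hΨ.entry_apply, entry_sandwich_tensorMap_one, entry_sandwich_tensorMap_one, hΦ.entry_apply]

end Entries

section CbNorm

open SchattenClass

variable {p : ℝ} [Fact (1 ≤ p)] {K H : Type*} [NormedAddCommGroup K] [InnerProductSpace ℂ K]
  [NormedAddCommGroup H] [InnerProductSpace ℂ H]

theorem starProjection_mul_of_le {L M : Submodule ℂ K} [L.HasOrthogonalProjection]
    [M.HasOrthogonalProjection] (h : L ≤ M) :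
    L.starProjection * M.starProjection = L.starProjection :=
  Submodule.starProjection_comp_starProjection_of_le h

theorem mul_starProjection_of_le {L M : Submodule ℂ K} [L.HasOrthogonalProjection]
    [M.HasOrthogonalProjection] (h : L ≤ M) :
    M.starProjection * L.starProjection = L.starProjection :=
  ContinuousLinearMap.ext fun x =>
    Submodule.starProjection_eq_self_iff.2 (h (Submodule.starProjection_apply_mem _ x))

theorem norm_tensorMap_one_le {K' : Type*} [NormedAddCommGroup K'] [InnerProductSpace ℂ K']
    {a : K →L[ℂ] K'} (ha : ‖a‖ ≤ 1) : ‖tensorMap a (1 : H →L[ℂ] H)‖ ≤ 1 :=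
  (norm_tensorMap_le _ _).trans (mul_le_one₀ ha (norm_nonneg _) ContinuousLinearMap.norm_id_le)

namespace SchattenClass

theorem compress_tensorMap_eq_of_le {L M : Submodule ℂ K} [L.HasOrthogonalProjection]
    [M.HasOrthogonalProjection] (h : L ≤ M) {z : SchattenClass p (HilbertTensor K H)}
    (hz : compress (tensorMap L.starProjection 1) z = z) :
    compress (tensorMap M.starProjection 1) z = z := by
  rw [← hz, compress_compress_of_mul_eq]
  · rw [tensorMap_mul, mul_starProjection_of_le h, one_mul]
  · rw [tensorMap_mul, starProjection_mul_of_le h, one_mul]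

variable (p K H) in
/-- The elements of `S^p(K ⊗₂ H)` living on `L ⊗ H` for a finite-dimensional `L ⊆ K`. -/
def finiteSupport : Submodule ℂ (SchattenClass p (HilbertTensor K H)) where
  carrier := {z | ∃ (L : Submodule ℂ K) (_ : FiniteDimensional ℂ L),
    compress (tensorMap L.starProjection 1) z = z}
  add_mem' := by
    rintro z z' ⟨L, _, hz⟩ ⟨L', _, hz'⟩
    refine ⟨L ⊔ L', inferInstance, ?_⟩
    rw [map_add, compress_tensorMap_eq_of_le le_sup_left hz,
      compress_tensorMap_eq_of_le le_sup_right hz']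
  zero_mem' := ⟨⊥, inferInstance, map_zero _⟩
  smul_mem' := by
    rintro c z ⟨L, _, hz⟩
    exact ⟨L, inferInstance, by rw [map_smul, hz]⟩

end SchattenClass

variable [CompleteSpace K]

theorem exists_adjoint_comp_eq_starProjection (L : Submodule ℂ K) [FiniteDimensional ℂ L] :
    ∃ W : K →L[ℂ] EllTwo, ‖W‖ ≤ 1 ∧ W.adjoint ∘L W = L.starProjection := by
  let g : HilbertBasis ℕ ℂ EllTwo := HilbertBasis.ofRepr (LinearIsometryEquiv.refl ℂ _)
  let b := stdOrthonormalBasis ℂ L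
  let f : L →ₗ[ℂ] EllTwo := b.toBasis.constr ℂ fun i => g i
  have hf : f ∘ b.toBasis = fun i : Fin (Module.finrank ℂ L) => g i :=
    funext fun i => b.toBasis.constr_basis ℂ _ i
  let J : L →ₗᵢ[ℂ] EllTwo := f.isometryOfOrthonormal (v := b.toBasis)
    (by rw [OrthonormalBasis.coe_toBasis]; exact b.orthonormal)
    (by rw [hf]; exact g.orthonormal.comp _ Fin.val_injective)
  refine ⟨J.toContinuousLinearMap ∘L L.orthogonalProjectionOnto, ?_, ?_⟩
  · refine ContinuousLinearMap.opNorm_le_bound _ zero_le_one fun x => ?_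
    rw [one_mul, ContinuousLinearMap.comp_apply]
    exact (J.norm_map _).trans_le (L.norm_orthogonalProjectionOnto_apply_le x)
  · ext x
    refine ext_inner_left ℂ fun v => ?_
    rw [ContinuousLinearMap.comp_apply, ContinuousLinearMap.adjoint_inner_right]
    change ⟪J (L.orthogonalProjectionOnto v), J (L.orthogonalProjectionOnto x)⟫_ℂ = _
    rw [J.inner_map_map, Submodule.inner_orthogonalProjectionOnto_eq_of_mem_right]
    rfl

namespace SchattenClass

theorem exists_sandwich_sandwich_eq {z : SchattenClass p (HilbertTensor K H)}
    (hz : z ∈ finiteSupport p K H) :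
    ∃ W : K →L[ℂ] EllTwo, ‖W‖ ≤ 1 ∧
      sandwich (tensorMap W.adjoint (1 : H →L[ℂ] H)) (tensorMap W (1 : H →L[ℂ] H))
        (sandwich (tensorMap W (1 : H →L[ℂ] H)) (tensorMap W.adjoint (1 : H →L[ℂ] H)) z) = z := by
  obtain ⟨L, _, hL⟩ := hz
  obtain ⟨W, hW, hWL⟩ := exists_adjoint_comp_eq_starProjection L
  have hone : tensorMap W.adjoint (1 : H →L[ℂ] H) ∘L tensorMap W (1 : H →L[ℂ] H) =
      tensorMap L.starProjection 1 := by
    rw [tensorMap_comp, hWL]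
    rfl
  refine ⟨W, hW, Eq.trans (toOp_injective ?_) hL⟩
  rw [toOp_compress, toOp_sandwich, toOp_sandwich, ← hone]
  rfl

variable [CompleteSpace H]

theorem compress_rankOne {Q : H →L[ℂ] H} (hQ : IsSelfAdjoint Q) (x y : H) :
    compress Q (rankOne x y : SchattenClass p H) = rankOne (Q x) (Q y) := by
  rw [compress, sandwich_rankOne, ← ContinuousLinearMap.star_eq_adjoint, hQ.star_eq]

theorem rankOne_tmul_mem_finiteSupport (ξ η : K) (h k : H) :
    rankOne (tmul ξ h) (tmul η k) ∈ finiteSupport p K H := by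
  have hfin : FiniteDimensional ℂ (Submodule.span ℂ {ξ, η}) :=
    FiniteDimensional.span_of_finite ℂ (Set.toFinite _)
  refine ⟨Submodule.span ℂ {ξ, η}, hfin, ?_⟩
  rw [compress_rankOne (isStarProjection_tensorMap isStarProjection_starProjection
      (.one _)).isSelfAdjoint, tensorMap_tmul, tensorMap_tmul,
    Submodule.starProjection_eq_self_iff.2 (Submodule.subset_span (.inl rfl)),
    Submodule.starProjection_eq_self_iff.2 (Submodule.subset_span (.inr rfl))]
  rfl

end SchattenClass

variable [CompleteSpace H]

theorem IsAmpliation.norm_le_ellTwo {T : SchattenClass p H →L[ℂ] SchattenClass p H}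
    {Φ : SchattenClass p (HilbertTensor K H) →L[ℂ] SchattenClass p (HilbertTensor K H)}
    {Ψ : SchattenClass p (HilbertTensor EllTwo H) →L[ℂ] SchattenClass p (HilbertTensor EllTwo H)}
    (hΦ : IsAmpliation K T Φ) (hΨ : IsAmpliation EllTwo T Ψ) : ‖Φ‖ ≤ ‖Ψ‖ := by
  refine ContinuousLinearMap.opNorm_le_bound _ (norm_nonneg _)
    (norm_apply_le_of_rankOne_tmul_mem rankOne_tmul_mem_finiteSupport fun z hz => ?_)
  obtain ⟨W, hW, hWz⟩ := exists_sandwich_sandwich_eq hz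
  have hW1 : ‖tensorMap W (1 : H →L[ℂ] H)‖ ≤ 1 := norm_tensorMap_one_le hW
  have hW2 : ‖tensorMap W.adjoint (1 : H →L[ℂ] H)‖ ≤ 1 :=
    norm_tensorMap_one_le (by rwa [LinearIsometryEquiv.norm_map])
  rw [← hWz, hΨ.sandwich_comm hΦ, hWz]
  exact (norm_sandwich_apply_le hW2 hW1 _).trans ((Ψ.le_opNorm _).trans
    (by gcongr; exact norm_sandwich_apply_le hW1 hW2 _))

theorem cbNorm_le_enorm_ampliation (T : CB p H) : cbNorm T ≤ ‖ampliation EllTwo T‖ₑ := by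
  refine iSup_le fun K => iSup_le fun _ => iSup_le fun _ => iSup_le fun _ => ?_
  rw [enorm_le_iff_norm_le]
  exact (ampliation_spec K T).norm_le_ellTwo (ampliation_spec EllTwo T)

end CbNorm

section Algebra

open SchattenClass

variable {p : ℝ} [Fact (1 ≤ p)] {H : Type*} [NormedAddCommGroup H] [InnerProductSpace ℂ H]
  [CompleteSpace H]

namespace CB

/-- The composition of completely bounded maps. -/
noncomputable def comp (S T : CB p H) : CB p H :=
  ⟨(S : SchattenClass p H →L[ℂ] SchattenClass p H) ∘L T, fun K _ _ _ =>
    ⟨ampliation K S ∘L ampliation K T, fun a b z hz =>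
      ampliation_spec K S a _ _ (ampliation_spec K T a b z hz)⟩⟩

theorem isAmpliation_compress {K : Type*} [NormedAddCommGroup K] [InnerProductSpace ℂ K]
    [CompleteSpace K] (Q : H →L[ℂ] H) :
    IsAmpliation K (compress Q : SchattenClass p H →L[ℂ] _) (compress (tensorMap 1 Q)) :=
  fun a b z hz ξ h => by
    rw [toOp_compress, mul_apply_eq_comp, mul_apply_eq_comp, tensorMap_tmul, hz, tensorMap_tmul]
    rfl

/-- The compression `z ↦ Q z Q` as a completely bounded map. -/
noncomputable def compression (Q : H →L[ℂ] H) : CB p H :=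
  ⟨compress Q, fun _ _ _ _ => ⟨_, isAmpliation_compress Q⟩⟩

/-- The linear map `T ↦ C T C` on completely bounded maps, where `C` is the compression by `Q`. -/
noncomputable def conj (Q : H →L[ℂ] H) : CB p H →ₗ[ℂ] CB p H where
  toFun T := comp (compression Q) (comp T (compression Q))
  map_add' S T := Subtype.ext <| by
    ext1 x
    exact map_add (compress Q) _ _
  map_smul' c T := Subtype.ext <| by
    ext1 x
    exact map_smul (compress Q) _ _

theorem conj_apply_apply (Q : H →L[ℂ] H) (T : CB p H) (x : SchattenClass p H) :
    (conj Q T : SchattenClass p H →L[ℂ] SchattenClass p H) x =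
      compress Q ((T : SchattenClass p H →L[ℂ] SchattenClass p H) (compress Q x)) := rfl

theorem conj_conj_of_mul_eq {Q R S : H →L[ℂ] H} (hQR : Q * R = S) (hRQ : R * Q = S)
    (T : CB p H) : conj Q (conj R T) = conj S T := by
  refine Subtype.ext (ContinuousLinearMap.ext fun x => ?_)
  rw [conj_apply_apply, conj_apply_apply, conj_apply_apply, compress_compress_of_mul_eq hQR hRQ,
    compress_compress_of_mul_eq hRQ hQR]

section Ampliation

variable (K : Type) [NormedAddCommGroup K] [InnerProductSpace ℂ K] [CompleteSpace K]

theorem ampliation_idCB : ampliation K (idCB : CB p H) = ContinuousLinearMap.id ℂ _ :=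
  (ampliation_spec K idCB).unique fun _ _ _ h => h

theorem ampliation_conj (Q : H →L[ℂ] H) (T : CB p H) :
    ampliation K (conj Q T) =
      compress (tensorMap 1 Q) ∘L ampliation K T ∘L compress (tensorMap 1 Q) :=
  (ampliation_spec K _).unique fun a b _ hz =>
    isAmpliation_compress Q a _ _ (ampliation_spec K T a _ _ (isAmpliation_compress Q a b _ hz))

variable {Q : H →L[ℂ] H} (hQ : IsStarProjection Q)
include hQ

theorem norm_ampliation_conj_apply_le (T : CB p H) (z : SchattenClass p (HilbertTensor K H)) :
    ‖ampliation K (conj Q T) z‖ ≤ ‖ampliation K T (compress (tensorMap 1 Q) z)‖ := by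
  rw [ampliation_conj]
  exact norm_compress_apply_le (isStarProjection_tensorMap (.one _) hQ) _

theorem norm_ampliation_conj_le (T : CB p H) : ‖ampliation K (conj Q T)‖ ≤ ‖ampliation K T‖ :=
  ContinuousLinearMap.opNorm_le_bound _ (norm_nonneg _) fun z =>
    (norm_ampliation_conj_apply_le K hQ T z).trans <| (ContinuousLinearMap.le_opNorm _ _).trans <|
      by gcongr; exact norm_compress_apply_le (isStarProjection_tensorMap (.one _) hQ) _

end Ampliation

section FiniteRank

variable (p H) in
/-- The completely bounded maps of finite rank. -/
noncomputable def finiteRank : Submodule ℂ (CB p H) where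
  carrier := {T | FiniteDimensional ℂ
    (T : SchattenClass p H →L[ℂ] SchattenClass p H).toLinearMap.range}
  add_mem' {S T} (_ : FiniteDimensional ℂ _) (_ : FiniteDimensional ℂ _) :=
    Submodule.finiteDimensional_of_le (LinearMap.range_add_le _ _)
  zero_mem' := Submodule.finiteDimensional_of_le (S₂ := ⊥) LinearMap.range_zero.le
  smul_mem' c T (_ : FiniteDimensional ℂ _) :=
    Submodule.finiteDimensional_of_le
      (S₂ := (T : SchattenClass p H →L[ℂ] SchattenClass p H).toLinearMap.range) <| by
        rintro _ ⟨x, rfl⟩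
        exact Submodule.smul_mem _ c ⟨x, rfl⟩

theorem comp_mem_finiteRank_left {S : CB p H} (hS : S ∈ finiteRank p H) (T : CB p H) :
    comp S T ∈ finiteRank p H := by
  have : FiniteDimensional ℂ (S : SchattenClass p H →L[ℂ] SchattenClass p H).toLinearMap.range := hS
  exact Submodule.finiteDimensional_of_le (LinearMap.range_comp_le_range _ _)

theorem comp_mem_finiteRank_right (S : CB p H) {T : CB p H} (hT : T ∈ finiteRank p H) :
    comp S T ∈ finiteRank p H := by
  have : FiniteDimensional ℂ (T : SchattenClass p H →L[ℂ] SchattenClass p H).toLinearMap.range := hT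
  exact Submodule.finiteDimensional_of_le (LinearMap.range_comp _ _).le

theorem conj_mem_finiteRank (Q : H →L[ℂ] H) {T : CB p H} (hT : T ∈ finiteRank p H) :
    conj Q T ∈ finiteRank p H :=
  comp_mem_finiteRank_right _ (comp_mem_finiteRank_left hT _)

end FiniteRank

end CB

end Algebra

section FiniteProjections

open SchattenClass Filter

variable {p : ℝ} [Fact (1 ≤ p)] {H : Type*} [NormedAddCommGroup H] [InnerProductSpace ℂ H]

/-- The orthogonal projection onto the span of a finite set. The finite sets form a directed index
set, along which these projections increase. -/
noncomputable def finProj (s : Finset H) : H →L[ℂ] H :=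
  (Submodule.span ℂ (s : Set H)).starProjection

theorem finProj_apply_of_mem {s : Finset H} {x : H} (hx : x ∈ s) : finProj s x = x :=
  Submodule.starProjection_eq_self_iff.2 (Submodule.subset_span hx)

theorem finProj_mul_finProj_of_subset {s t : Finset H} (h : s ⊆ t) :
    finProj s * finProj t = finProj s :=
  starProjection_mul_of_le (Submodule.span_mono (Finset.coe_subset.2 h))

theorem finProj_mul_finProj_of_superset {s t : Finset H} (h : s ⊆ t) :
    finProj t * finProj s = finProj s :=
  mul_starProjection_of_le (Submodule.span_mono (Finset.coe_subset.2 h))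

variable [CompleteSpace H]

theorem isStarProjection_finProj (s : Finset H) : IsStarProjection (finProj s) :=
  isStarProjection_starProjection

theorem tendsto_compress_finProj (z : SchattenClass p H) :
    Tendsto (fun s : Finset H => compress (finProj s) z) atTop (𝓝 z) := by
  classical
  rw [Metric.tendsto_atTop]
  intro ε hε
  obtain ⟨n, x, y, hxy⟩ := exists_sum_rankOne (p := p) Fact.out z.lt_top
    (ENNReal.ofReal_pos.2 (half_pos hε))
  let a : SchattenClass p H := ∑ i, rankOne (x i) (y i)
  have hza : ‖z - a‖ < ε / 2 := by
    rw [norm_def, map_sub, map_sum]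
    exact ENNReal.toReal_lt_of_lt_ofReal hxy
  refine ⟨Finset.univ.image x ∪ Finset.univ.image y, fun s hs => ?_⟩
  have hfix : compress (finProj s) a = a := by
    rw [map_sum]
    refine Finset.sum_congr rfl fun i _ => ?_
    rw [compress_rankOne (isStarProjection_finProj s).isSelfAdjoint,
      finProj_apply_of_mem (hs (by simp)), finProj_apply_of_mem (hs (by simp))]
  rw [dist_eq_norm]
  calc ‖compress (finProj s) z - z‖ = ‖compress (finProj s) (z - a) - (z - a)‖ := by
        rw [map_sub, hfix, sub_sub_sub_cancel_right]
    _ ≤ ‖compress (finProj s) (z - a)‖ + ‖z - a‖ := norm_sub_le _ _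
    _ ≤ ‖z - a‖ + ‖z - a‖ := by
        gcongr; exact norm_compress_apply_le (isStarProjection_finProj s) _
    _ < ε := by linarith

theorem tendsto_norm_sub_compress_finProj (z : SchattenClass p H) :
    Tendsto (fun s : Finset H => ‖z - compress (finProj s) z‖) atTop (𝓝 0) := by
  simpa only [sub_self, norm_zero] using ((tendsto_compress_finProj z).const_sub z).norm

theorem tendsto_norm_sub_comp_compress_finProj (hp : 1 < p) (ψ : SchattenClass p H →L[ℂ] ℂ) :
    Tendsto (fun s : Finset H => ‖ψ - ψ ∘L compress (finProj s)‖) atTop (𝓝 0) := by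
  let φ : SchattenClass p H →ₗ[ℝ] ℝ := Complex.reLm ∘ₗ ψ.toLinearMap.restrictScalars ℝ
  have hφ : ∀ z, φ z ≤ ‖ψ‖ * ‖z‖ := fun z => (Complex.re_le_norm _).trans (ψ.le_opNorm z)
  rw [Metric.tendsto_nhds]
  intro ε hε
  filter_upwards [UniformlySmoothAlong.eventually_le
    (P := fun s : Finset H => (compress (finProj s)).toLinearMap.restrictScalars ℝ)
    (uniformlySmoothAlong_compress hp isStarProjection_finProj) tendsto_norm_sub_compress_finProj
    hφ (half_pos hε)] with s hs
  rw [dist_zero_right, norm_norm]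
  refine (ContinuousLinearMap.opNorm_le_bound _ (half_pos hε).le fun z => ?_).trans_lt
    (half_lt_self hε)
  obtain ⟨c, hc, hcz⟩ := RCLike.exists_norm_eq_mul_self ((ψ - ψ ∘L compress (finProj s)) z)
  have hre : φ (c • z - compress (finProj s) (c • z)) =
      ‖(ψ - ψ ∘L compress (finProj s)) z‖ := by
    rw [map_smul, ← smul_sub]
    change (ψ (c • (z - compress (finProj s) z))).re = _
    rw [map_smul, map_sub]
    exact (congrArg Complex.re hcz).symm
  calc ‖(ψ - ψ ∘L compress (finProj s)) z‖ ≤ ε / 2 * ‖c • z‖ := hre ▸ hs (c • z)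
    _ = ε / 2 * ‖z‖ := by rw [norm_smul, hc, one_mul]

theorem exists_eq_sum_smul_of_finiteDimensional_range {E F : Type*} [NormedAddCommGroup E]
    [NormedSpace ℂ E] [NormedAddCommGroup F] [NormedSpace ℂ F] (T : E →L[ℂ] F)
    [FiniteDimensional ℂ T.toLinearMap.range] :
    ∃ (n : ℕ) (ψ : Fin n → E →L[ℂ] ℂ) (b : Fin n → F), ∀ x, T x = ∑ j, ψ j x • b j := by
  let b := Module.finBasis ℂ T.toLinearMap.range
  refine ⟨_, fun j => (b.coord j).toContinuousLinearMap ∘L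
    T.codRestrict _ (LinearMap.mem_range_self T.toLinearMap), fun j => b j, fun x => ?_⟩
  have hsum := congrArg Subtype.val (b.sum_repr ⟨T x, LinearMap.mem_range_self T.toLinearMap x⟩)
  rw [Submodule.coe_sum] at hsum
  exact hsum.symm

open CB

theorem norm_ampliation_sub_conj_le (K : Type) [NormedAddCommGroup K] [InnerProductSpace ℂ K]
    [CompleteSpace K] {T : CB p H} {ι : Type*} [Fintype ι] (ψ : ι → SchattenClass p H →L[ℂ] ℂ)
    (b : ι → SchattenClass p H)
    (hT : ∀ x, (T : SchattenClass p H →L[ℂ] SchattenClass p H) x = ∑ j, ψ j x • b j)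
    (Q : H →L[ℂ] H) :
    ‖ampliation K (T - conj Q T)‖ ≤ ∑ j, (‖ψ j - ψ j ∘L compress Q‖ * ‖b j‖ +
      ‖ψ j ∘L compress Q‖ * ‖b j - compress Q (b j)‖) := by
  have hsum := (ampliation_spec K (T - conj Q T)).norm_le_of_finite_rank
    (Sum.elim (fun j => ψ j - ψ j ∘L compress Q) fun j => ψ j ∘L compress Q)
    (Sum.elim b fun j => b j - compress Q (b j)) fun x => by
      rw [Submodule.coe_sub, sub_apply, conj_apply_apply, hT, hT, map_sum,
        Fintype.sum_sum_type, ← Finset.sum_sub_distrib, ← Finset.sum_add_distrib]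
      refine Finset.sum_congr rfl fun j _ => ?_
      simp only [Sum.elim_inl, Sum.elim_inr, sub_apply, ContinuousLinearMap.comp_apply, sub_smul,
        smul_sub, map_smul]
      abel
  rwa [Fintype.sum_sum_type, ← Finset.sum_add_distrib] at hsum

theorem tendsto_norm_ampliation_sub_conj_finProj (hp : 1 < p) (K : Type) [NormedAddCommGroup K]
    [InnerProductSpace ℂ K] [CompleteSpace K] {T : CB p H} (hT : T ∈ finiteRank p H) :
    Tendsto (fun s : Finset H => ‖ampliation K (T - conj (finProj s) T)‖) atTop (𝓝 0) := by
  have : FiniteDimensional ℂ (T : SchattenClass p H →L[ℂ] SchattenClass p H).toLinearMap.range := hT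
  obtain ⟨n, ψ, b, hψ⟩ := exists_eq_sum_smul_of_finiteDimensional_range
    (T : SchattenClass p H →L[ℂ] SchattenClass p H)
  refine squeeze_zero (fun _ => norm_nonneg _)
    (fun s => (norm_ampliation_sub_conj_le K ψ b hψ (finProj s)).trans <|
      Finset.sum_le_sum fun j _ => add_le_add_right (mul_le_mul_of_nonneg_right
        ((ψ j).opNorm_comp_le _ |>.trans <| mul_le_of_le_one_right (norm_nonneg _) <|
          norm_compress_le (isStarProjection_finProj s)) (norm_nonneg _)) _) ?_
  simpa only [zero_mul, mul_zero, add_zero, Finset.sum_const_zero] using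
    tendsto_finsetSum Finset.univ fun j _ =>
      ((tendsto_norm_sub_comp_compress_finProj hp (ψ j)).mul_const ‖b j‖).add
        ((tendsto_norm_sub_compress_finProj (b j)).const_mul ‖ψ j‖)

end FiniteProjections

section FiniteDimensional

open SchattenClass CB

variable {p : ℝ} [Fact (1 ≤ p)] {H : Type*} [NormedAddCommGroup H] [InnerProductSpace ℂ H]
  [CompleteSpace H] (L : Submodule ℂ H) [FiniteDimensional ℂ L]

theorem finiteDimensional_range_compress_starProjection :
    FiniteDimensional ℂ (LinearMap.range
      (compress L.starProjection : SchattenClass p H →L[ℂ] SchattenClass p H).toLinearMap) := by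
  let f : SchattenClass p H →ₗ[ℂ] (L →ₗ[ℂ] L) :=
    { toFun z := L.orthogonalProjectionOnto.toLinearMap ∘ₗ z.toOp.toLinearMap ∘ₗ L.subtype
      map_add' x y := by ext v; simp
      map_smul' c x := by ext v; simp }
  have hQ := isStarProjection_starProjection (U := L)
  refine FiniteDimensional.of_injective (f.domRestrict _)
    ((injective_iff_map_eq_zero _).2 fun y hy => ?_)
  obtain ⟨_, z, rfl⟩ := y
  refine Subtype.ext (toOp_injective ?_)
  change (compress L.starProjection z).toOp = _
  rw [← compress_compress_of_mul_eq hQ.isIdempotentElem.eq hQ.isIdempotentElem.eq, toOp_compress]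
  ext v
  exact congrArg (fun g : L →ₗ[ℂ] L => (g (L.orthogonalProjectionOnto v) : H)) hy

theorem conj_starProjection_mem_finiteRank (T : CB p H) :
    conj L.starProjection T ∈ finiteRank p H :=
  comp_mem_finiteRank_left (finiteDimensional_range_compress_starProjection L) _

theorem finiteDimensional_range_conj_starProjection :
    FiniteDimensional ℂ (LinearMap.range (conj L.starProjection : CB p H →ₗ[ℂ] CB p H)) := by
  have := finiteDimensional_range_compress_starProjection (p := p) L
  let P : SchattenClass p H →ₗ[ℂ] SchattenClass p H := (compress L.starProjection).toLinearMap
  let f : CB p H →ₗ[ℂ] (LinearMap.range P →ₗ[ℂ] LinearMap.range P) :=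
    { toFun T := P.rangeRestrict ∘ₗ
        (T : SchattenClass p H →L[ℂ] SchattenClass p H).toLinearMap ∘ₗ Submodule.subtype _
      map_add' x y := by ext v; simp
      map_smul' c x := by ext v; simp }
  have hQ := isStarProjection_starProjection (U := L)
  refine FiniteDimensional.of_injective (f.domRestrict _)
    ((injective_iff_map_eq_zero _).2 fun y hy => ?_)
  obtain ⟨_, T, rfl⟩ := y
  refine Subtype.ext ?_
  change conj L.starProjection T = 0
  rw [← conj_conj_of_mul_eq hQ.isIdempotentElem.eq hQ.isIdempotentElem.eq]
  refine Subtype.ext (ContinuousLinearMap.ext fun v => ?_)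
  exact congrArg (fun g : LinearMap.range P →ₗ[ℂ] LinearMap.range P =>
    (g (P.rangeRestrict v) : SchattenClass p H)) hy

end FiniteDimensional

section CbSeminorm

open SchattenClass Filter CB

variable {p : ℝ} [Fact (1 ≤ p)] {H : Type*} [NormedAddCommGroup H] [InnerProductSpace ℂ H]
  [CompleteSpace H]

variable (p H) in
/-- The completely bounded norm as a real-valued seminorm. It is computed on the single
amplification space `K = ℓ²`, which dominates all others by `cbNorm_le_enorm_ampliation`. -/
noncomputable def cbSeminorm : Seminorm ℝ (CB p H) :=
  (normSeminorm ℝ _).comp ((ampliation EllTwo).restrictScalars ℝ)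

theorem cbSeminorm_apply (T : CB p H) : cbSeminorm p H T = ‖ampliation EllTwo T‖ := rfl

theorem cbNorm_le_one {T : CB p H} (hT : cbSeminorm p H T ≤ 1) : cbNorm T ≤ 1 := by
  refine (cbNorm_le_enorm_ampliation T).trans ?_
  rw [← ofReal_norm]
  exact ENNReal.ofReal_le_one.2 hT

theorem uniformlySmoothAlong_compress_comp_compress (hp : 1 < p) {ι : Type*} {P : ι → H →L[ℂ] H}
    (hP : ∀ i, IsStarProjection (P i)) :
    UniformlySmoothAlong (normSeminorm ℝ (SchattenClass p H →L[ℂ] SchattenClass p H))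
      fun i X => compress (P i) ∘L X ∘L compress (P i) :=
  UniformlySmoothAlong.conj (E := SchattenClass p H) (F := SchattenClass p H)
    (P := fun i => compress (P i)) (R := fun i => compress (P i))
    (uniformlySmoothAlong_compress hp hP) (uniformlyConvexAlong_compress hP)
    (fun i => norm_compress_le (hP i)) fun i => norm_compress_le (hP i)

theorem uniformlySmoothAlong_conj (hp : 1 < p) {ι : Type*} {P : ι → H →L[ℂ] H}
    (hP : ∀ i, IsStarProjection (P i)) :
    UniformlySmoothAlong (cbSeminorm p H) fun i => conj (P i) :=
  (uniformlySmoothAlong_compress_comp_compress hp fun i =>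
    isStarProjection_tensorMap (.one _) (hP i)).comp ((ampliation EllTwo).restrictScalars ℝ)
      fun i T => ampliation_conj EllTwo (P i) T

theorem eventually_abs_sub_conj_finProj_le (hp : 1 < p) {φ : CB p H →ₗ[ℝ] ℝ}
    (hφ : ∀ T, φ T ≤ cbSeminorm p H T) {ε : ℝ} (hε : 0 < ε) :
    ∀ᶠ s : Finset H in atTop, ∀ T ∈ finiteRank p H,
      |φ (T - conj (finProj s) T)| ≤ ε * cbSeminorm p H T :=
  UniformlySmoothAlong.eventually_abs_le_of_mem (F := (finiteRank p H).restrictScalars ℝ)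
    (P := fun s => (conj (finProj s)).restrictScalars ℝ)
    (uniformlySmoothAlong_conj hp isStarProjection_finProj)
    (fun _ _ => conj_mem_finiteRank _)
    (fun _ => tendsto_norm_ampliation_sub_conj_finProj hp EllTwo) hφ hε

end CbSeminorm

section NormingSequences

open SchattenClass Filter CB

variable {E F : Type*} [NormedAddCommGroup E] [NormedSpace ℂ E] [NormedAddCommGroup F]
  [NormedSpace ℂ F]

theorem exists_finset_forall_norm_le (U : Submodule ℂ (E →L[ℂ] F)) [FiniteDimensional ℂ U] :
    ∃ t : Finset E, (∀ x ∈ t, ‖x‖ ≤ 2) ∧ ∀ S ∈ U, S ≠ 0 → ∃ x ∈ t, ‖S‖ ≤ ‖S x‖ := by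
  classical
  have : ProperSpace U := FiniteDimensional.proper ℂ U
  obtain ⟨t, ht⟩ := (isCompact_sphere (0 : U) 1).elim_finite_subcover
    (fun x : Metric.closedBall (0 : E) 2 => {S : U | 1 < ‖(S : E →L[ℂ] F) x‖})
    (fun x => isOpen_lt continuous_const
      ((ContinuousLinearMap.apply ℂ F (x : E)).continuous.comp continuous_subtype_val).norm)
    fun S hS => by
      have hS1 : ‖(S : E →L[ℂ] F)‖ = 1 := mem_sphere_zero_iff_norm.1 hS
      obtain ⟨x, hx, hSx⟩ := (S : E →L[ℂ] F).exists_lt_apply_of_lt_opNorm (r := 1 / 2)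
        (by rw [hS1]; norm_num)
      refine Set.mem_iUnion.2 ⟨⟨(2 : ℝ) • x, ?_⟩, ?_⟩
      · rw [mem_closedBall_zero_iff, norm_smul, Real.norm_ofNat]
        linarith
      · change 1 < ‖(S : E →L[ℂ] F) ((2 : ℝ) • x)‖
        rw [ContinuousLinearMap.map_smul_of_tower, norm_smul, Real.norm_ofNat]
        linarith
  refine ⟨t.image (↑), fun x hx => ?_, fun S hS hS0 => ?_⟩
  · obtain ⟨y, -, rfl⟩ := Finset.mem_image.1 hx
    exact mem_closedBall_zero_iff.1 y.2
  · have hsphere : (‖S‖⁻¹ : ℂ) • (⟨S, hS⟩ : U) ∈ Metric.sphere (0 : U) 1 := by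
      rw [mem_sphere_zero_iff_norm]
      exact norm_smul_inv_norm (𝕜 := ℂ) (x := S) hS0
    obtain ⟨x, hx, hlt⟩ := Set.mem_iUnion₂.1 (ht hsphere)
    refine ⟨x, Finset.mem_image_of_mem _ hx, ?_⟩
    change 1 < ‖(‖S‖⁻¹ : ℂ) • S x‖ at hlt
    rw [norm_smul, norm_inv, Complex.norm_real, norm_norm, inv_mul_eq_div,
      one_lt_div (norm_pos_iff.2 hS0)] at hlt
    exact hlt.le

theorem exists_tendsto_zero_forall_mem_finset {C : ℝ} (t : ℕ → Finset E)
    (ht : ∀ n, ∀ x ∈ t n, ‖x‖ ≤ C) :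
    ∃ y : ℕ → E, Tendsto y atTop (𝓝 0) ∧
      ∀ n, ∀ x ∈ t n, ∃ i, y i = ((2⁻¹ : ℝ) ^ n) • x := by
  obtain ⟨e, he⟩ := Countable.exists_injective_nat (Σ n, t n)
  let f (j : Σ n, t n) : E := ((2⁻¹ : ℝ) ^ j.1) • (j.2 : E)
  have hf : ∀ j, ‖f j‖ ≤ 2⁻¹ ^ j.1 * C := fun j => by
    rw [norm_smul, norm_pow, norm_inv, Real.norm_ofNat]
    exact mul_le_mul_of_nonneg_left (ht _ _ j.2.2) (by positivity)
  refine ⟨Function.extend e f 0, ?_, fun n x hx => ⟨e ⟨n, x, hx⟩, he.extend_apply f 0 _⟩⟩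
  rw [← Nat.cofinite_eq_atTop, Metric.tendsto_nhds]
  intro ε hε
  have hC : Tendsto (fun n : ℕ => (2⁻¹ : ℝ) ^ n * C) atTop (𝓝 0) := by
    simpa only [zero_mul] using
      (tendsto_pow_atTop_nhds_zero_of_lt_one (by norm_num) (by norm_num)).mul_const C
  obtain ⟨N, hN⟩ := eventually_atTop.1 (hC.eventually_lt_const hε)
  refine (((Set.finite_Iio N).biUnion fun n _ => Set.finite_range (Sigma.mk n)).image e).subset
    fun i hi => ?_
  have hi : ε ≤ ‖Function.extend e f 0 i‖ := by
    simpa only [dist_zero_right, Set.mem_compl_iff, Set.mem_ofPred_eq, not_lt] using hi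
  by_cases hrange : ∃ j, e j = i
  · obtain ⟨⟨n, x⟩, rfl⟩ := hrange
    rw [he.extend_apply] at hi
    refine ⟨_, Set.mem_iUnion₂.2 ⟨n, ?_, x, rfl⟩, rfl⟩
    by_contra hn
    exact ((hi.trans (hf _)).trans_lt (hN n (not_lt.1 hn))).false
  · rw [Function.extend_apply' _ _ _ hrange, Pi.zero_apply, norm_zero] at hi
    exact (hε.not_ge hi).elim

variable {p : ℝ} [Fact (1 ≤ p)] {H : Type*} [NormedAddCommGroup H] [InnerProductSpace ℂ H]
  [CompleteSpace H]

theorem exists_finset_cbSeminorm_conj_le (s : Finset H) :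
    ∃ t : Finset (SchattenClass p (HilbertTensor EllTwo H)), (∀ x ∈ t, ‖x‖ ≤ 2) ∧
      ∀ T : CB p H, ampliation EllTwo (conj (finProj s) T) ≠ 0 →
        ∃ x ∈ t, cbSeminorm p H (conj (finProj s) T) ≤ ‖ampliation EllTwo T x‖ := by
  classical
  have : FiniteDimensional ℂ (LinearMap.range (conj (finProj s) : CB p H →ₗ[ℂ] CB p H)) :=
    finiteDimensional_range_conj_starProjection _
  have hQ := isStarProjection_finProj s
  obtain ⟨t, ht, hnorming⟩ := exists_finset_forall_norm_le
    ((LinearMap.range (conj (finProj s) : CB p H →ₗ[ℂ] CB p H)).map (ampliation EllTwo))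
  refine ⟨t.image (compress (tensorMap 1 (finProj s))), fun x hx => ?_, fun T hT => ?_⟩
  · obtain ⟨y, hy, rfl⟩ := Finset.mem_image.1 hx
    exact (norm_compress_apply_le (isStarProjection_tensorMap (.one _) hQ) y).trans (ht y hy)
  · obtain ⟨x, hx, hTx⟩ := hnorming _ ⟨_, ⟨T, rfl⟩, rfl⟩ hT
    exact ⟨_, Finset.mem_image_of_mem _ hx,
      hTx.trans (norm_ampliation_conj_apply_le EllTwo hQ T x)⟩

theorem exists_nullSeq_cbSeminorm_conj_le (s : ℕ → Finset H) :
    ∃ x : NullSeq p H, ∀ n (T : CB p H),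
      cbSeminorm p H (conj (finProj (s n)) T) ≤ 2 ^ n * stableSeminorm x T := by
  choose t ht hnorming using fun n => exists_finset_cbSeminorm_conj_le (p := p) (s n)
  obtain ⟨y, hy, hyt⟩ := exists_tendsto_zero_forall_mem_finset t ht
  refine ⟨⟨y, hy⟩, fun n T => ?_⟩
  by_cases hT : ampliation EllTwo (conj (finProj (s n)) T) = 0
  · rw [cbSeminorm_apply, hT, norm_zero]
    positivity
  obtain ⟨x, hx, hTx⟩ := hnorming n T hT
  obtain ⟨i, hi⟩ := hyt n x hx
  have hstable : ‖ampliation EllTwo T (y i)‖ ≤ stableSeminorm ⟨y, hy⟩ T :=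
    le_ciSup (bddAbove_stable ⟨y, hy⟩ T) i
  rw [hi, ContinuousLinearMap.map_smul_of_tower, norm_smul, norm_pow, norm_inv, Real.norm_ofNat,
    inv_pow, inv_mul_le_iff₀ (by positivity)] at hstable
  exact hTx.trans hstable

end NormingSequences

section Extension

open Filter

variable {V : Type*} [AddCommGroup V] [Module ℝ V] {q r : Seminorm ℝ V} {φ : V →ₗ[ℝ] ℝ}

/- The perturbation bound `4⁻ⁿ` beats the growth `2ⁿ`, so that `φ ∘ C n` converges geometrically
with respect to `r`. -/
theorem exists_tendsto_comp_of_le_geometric {F : Submodule ℝ V} {C : ℕ → V →ₗ[ℝ] V}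
    (hCF : ∀ n x, C n x ∈ F) (hCC : ∀ n x, C n (C (n + 1) x) = C n x) (hφ : ∀ x, φ x ≤ q x)
    (happrox : ∀ n, ∀ x ∈ F, |φ (x - C n x)| ≤ (1 / 4) ^ n * q x)
    (hqr : ∀ n x, q (C n x) ≤ 2 ^ n * r x) :
    ∃ g : V →ₗ[ℝ] ℝ, (∀ x, Tendsto (fun n => φ (C n x)) atTop (𝓝 (g x))) ∧
      ∀ x, |g x| ≤ 5 * r x := by
  have hstep : ∀ x n, dist (φ (C n x)) (φ (C (n + 1) x)) ≤ 2 * r x * (1 / 2) ^ n := fun x n => by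
    rw [dist_comm, Real.dist_eq, ← map_sub, ← hCC n x]
    calc |φ (C (n + 1) x - C n (C (n + 1) x))|
        ≤ (1 / 4) ^ n * q (C (n + 1) x) := happrox n _ (hCF _ x)
      _ ≤ (1 / 4) ^ n * (2 ^ (n + 1) * r x) := by gcongr; exact hqr _ x
      _ = 2 * r x * (1 / 2) ^ n := by
          have hpow : (1 / 4 : ℝ) ^ n * 2 ^ n = (1 / 2) ^ n := by rw [← mul_pow]; norm_num
          rw [← hpow]
          ring
  choose g hg using fun x =>
    cauchySeq_tendsto_of_complete (cauchySeq_of_le_geometric _ _ one_half_lt_one (hstep x))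
  refine ⟨linearMapOfTendsto g (fun n => φ ∘ₗ C n) (tendsto_pi_nhds.2 hg), hg, fun x => ?_⟩
  have hg0 : |g x - φ (C 0 x)| ≤ 4 * r x := by
    rw [← Real.dist_eq, dist_comm]
    exact (dist_le_of_le_geometric_of_tendsto₀ _ _ one_half_lt_one (hstep x) (hg x)).trans_eq
      (by ring)
  have hφ0 : |φ (C 0 x)| ≤ r x := by
    refine (abs_le'.2 ⟨hφ _, ?_⟩).trans ((hqr 0 x).trans_eq (by rw [pow_zero, one_mul]))
    rw [← map_neg, ← map_neg_eq_map q]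
    exact hφ _
  change |g x| ≤ _
  linarith [abs_sub_abs_le_abs_sub (g x) (φ (C 0 x))]

open CB SchattenClass

variable {p : ℝ} [Fact (1 ≤ p)] {H : Type*} [NormedAddCommGroup H] [InnerProductSpace ℂ H]
  [CompleteSpace H]

theorem withSeminorms_stableSeminorm :
    letI := stableTopology p H
    WithSeminorms fun x : NullSeq p H => stableSeminorm x :=
  letI := stableTopology p H
  ⟨rfl⟩

theorem continuous_of_abs_le_stableSeminorm {g : CB p H →ₗ[ℝ] ℝ} {x : NullSeq p H} {M : ℝ}
    (hg : ∀ T, |g T| ≤ M * stableSeminorm x T) : Continuous[stableTopology p H, _] g := by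
  let _ := stableTopology p H
  have hws := withSeminorms_stableSeminorm (p := p) (H := H)
  have := hws.topologicalAddGroup
  refine continuous_of_continuousAt_zero g ?_
  rw [ContinuousAt, map_zero]
  refine squeeze_zero_norm hg ?_
  simpa only [map_zero, mul_zero] using ((hws.continuous_seminorm x).tendsto 0).const_mul M

theorem exists_finset_seq_abs_sub_conj_le (hp : 1 < p) {φ : CB p H →ₗ[ℝ] ℝ}
    (hφ : ∀ T, φ T ≤ cbSeminorm p H T) :
    ∃ s : ℕ → Finset H, Monotone s ∧ ∀ n, ∀ T ∈ finiteRank p H,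
      |φ (T - conj (finProj (s n)) T)| ≤ (1 / 4) ^ n * cbSeminorm p H T := by
  classical
  choose t ht using fun n : ℕ => eventually_atTop.1
    (eventually_abs_sub_conj_finProj_le hp hφ (show (0 : ℝ) < (1 / 4) ^ n by positivity))
  exact ⟨partialSups t, (partialSups t).monotone, fun n => ht n _ (le_partialSups t n)⟩

theorem exists_stable_extension (hp : 1 < p) {φ : CB p H →ₗ[ℝ] ℝ}
    (hφ : ∀ T, φ T ≤ cbSeminorm p H T) :
    ∃ g : CB p H →ₗ[ℝ] ℝ, Continuous[stableTopology p H, _] g ∧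
      (∀ T ∈ finiteRank p H, g T = φ T) ∧ g idCB ≤ 1 := by
  obtain ⟨s, hs, happrox⟩ := exists_finset_seq_abs_sub_conj_le hp hφ
  obtain ⟨x, hx⟩ := exists_nullSeq_cbSeminorm_conj_le (p := p) s
  obtain ⟨g, hg, hgx⟩ := exists_tendsto_comp_of_le_geometric
    (F := (finiteRank p H).restrictScalars ℝ) (r := (stableSeminorm x).restrictScalars ℝ)
    (C := fun n => (conj (finProj (s n))).restrictScalars ℝ)
    (fun n => conj_starProjection_mem_finiteRank _)
    (fun n => conj_conj_of_mul_eq (finProj_mul_finProj_of_subset (hs n.le_succ))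
      (finProj_mul_finProj_of_superset (hs n.le_succ))) hφ happrox hx
  refine ⟨g, continuous_of_abs_le_stableSeminorm hgx, fun T hT => ?_,
    le_of_tendsto' (hg idCB) fun n => (hφ _).trans ?_⟩
  · refine tendsto_nhds_unique (hg T) (tendsto_iff_dist_tendsto_zero.2 ?_)
    refine squeeze_zero (fun _ => dist_nonneg) (fun n => ?_)
      (g := fun n => (1 / 4 : ℝ) ^ n * cbSeminorm p H T) ?_
    · rw [dist_comm, Real.dist_eq, ← map_sub]
      exact happrox n T hT
    · simpa only [zero_mul] using (tendsto_pow_atTop_nhds_zero_of_lt_one (r := (1 / 4 : ℝ))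
        (by norm_num) (by norm_num)).mul_const (cbSeminorm p H T)
  · refine (norm_ampliation_conj_le EllTwo (isStarProjection_finProj (s n)) idCB).trans ?_
    rw [ampliation_idCB]
    exact ContinuousLinearMap.norm_id_le

end Extension

end Schatten

theorem theorem3p10 (p : ℝ) [Fact (1 ≤ p)] (hp : 1 < p)
    (H : Type*) [NormedAddCommGroup H] [InnerProductSpace ℂ H] [CompleteSpace H]
    (F₀ : Submodule ℂ (Schatten.SchattenClass p H →L[ℂ] Schatten.SchattenClass p H))
    (hF₀ : ∀ T ∈ F₀, FiniteDimensional ℂ (LinearMap.range T.toLinearMap))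
    (hid : (Schatten.idCB : Schatten.CB p H) ∈ closure[Schatten.stableTopology p H]
      {T : Schatten.CB p H |
        (T : Schatten.SchattenClass p H →L[ℂ] Schatten.SchattenClass p H) ∈ F₀}) :
    (Schatten.idCB : Schatten.CB p H) ∈ closure[Schatten.stableTopology p H]
      {T : Schatten.CB p H |
        (T : Schatten.SchattenClass p H →L[ℂ] Schatten.SchattenClass p H) ∈ F₀ ∧
          Schatten.cbNorm T ≤ 1} := by
  let _ := Schatten.stableTopology p H
  have hws := Schatten.withSeminorms_stableSeminorm (p := p) (H := H)
  have := hws.topologicalAddGroup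
  have := hws.continuousSMul
  have : LocallyConvexSpace ℝ (Schatten.CB p H) := hws.toLocallyConvexSpace
  have : ContinuousSMul ℝ (Schatten.CB p H) := IsScalarTower.continuousSMul ℂ
  let F : Submodule ℝ (Schatten.CB p H) :=
    (F₀.comap (Schatten.CB p H).subtype).restrictScalars ℝ
  have hball : Schatten.idCB ∈ closure {T | T ∈ F ∧ Schatten.cbSeminorm p H T ≤ 1} := by
    refine Schatten.mem_closure_unitBall_of_forall_extension hid fun φ hφ => ?_
    obtain ⟨g, hg, hgφ, hgid⟩ := Schatten.exists_stable_extension hp hφ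
    exact ⟨⟨g, hg⟩, fun T hT => hgφ T (hF₀ T hT), hgid⟩
  refine closure_mono (fun T hT => ?_) hball
  exact ⟨hT.1, Schatten.cbNorm_le_one hT.2⟩
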